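/- Let $d\ge 1$, $s\ge 0$. On $d\times d$ symmetric positive definite matrices, with Lebesgue measure $dX=\prod_{i\le j}dX_{ij}$ and $\Gamma_d(a)=\int_{X\succ0}|X|^{a-(d+1)/2}e^{-\operatorname{tr}X}\,dX$, let $$\mathcal W(X;v,V)=\frac{|X|^{(v-d-1)/2}e^{-\operatorname{tr}(V^{-1}X)/2}}{2^{vd/2}\,\Gamma_d(v/2)\,|V|^{v/2}},\qquad \mathcal{IW}(X;v,V)=\frac{|V|^{(v-d-1)/2}\,|X|^{-v/2}e^{-\operatorname{tr}(VX^{-1})/2}}{2^{(v-d-1)d/2}\,\Gamma_d((v-d-1)/2)}$$ be the Wishart and inverse Wishart densities. For $m\in\mathbb R^{sd}$, a positive semidefinite $s\times s$ matrix $P$, $v>2d$ and $V\succ 0$, the conditional Gaussian inverse Wishart law $\mathrm{GIW}(m,P,v,V)$ is the law of $(x,X)$ with $X\sim\mathcal{IW}(v,V)$ and $x\mid X\sim\mathcal N(m,P\otimes X)$. Let the state be $\xi_k=(x_k,X_k)$, and let the filtered law of $\xi_k$, the predicted law of $\xi_{k+1}$ and the next smoothed law of $\xi_{k+1}$ be conditional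 Gaussian inverse Wishart with parameters $(m_{k|k},P_{k|k},v_{k|k},V_{k|k})$, $(m_{k+1|k},P_{k+1|k},v_{k+1|k},V_{k+1|k})$ and $(m_{k+1|K},P_{k+1|K},v_{k+1|K},V_{k+1|K})$, where $P_{k+1|k}$ and $P_{k+1|K}$ are positive definite ($P_{k|k}$ may be singular). Let the transition be $$p(\xi_{k+1}|\xi_k)=\mathcal N\big(x_{k+1};(F\otimes I_d)x_k,\,D\otimes X_{k+1}\big)\;\mathcal W\big(X_{k+1};n,\tfrac1nAX_kA^{T}\big),$$ with $F$ a real $s\times s$ matrix, $D$ positive semidefinite (possibly singular), $A$ an invertible $d\times d$ matrix. Assume that the predicted kinematic law is the Chapman–Kolmogorov prediction given the extent: for every $X\succ0$, $\mathcal N(m_{k+1|k},P_{k+1|k}\otimes X)$ is the law of $x_{k+1}$ when $x_k\sim\mathcal N(m_{k|k},P_{k|k}\otimes X)$ and $x_{k+1}|x_k\sim\mathcal N((F\otimes I_d)x_k,D\otimes X)$. Assume $n>2d+2$, $v_{k+1|K}-v_{k+1|k}>2d+2$ and $V_{k+1|K}-V_{k+1|k}\succ0$ (so that the moments matched below exist).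 Consider the Bayesian backward smoothing step $$p(\xi_k|Z_{1:K})=p(\xi_k|Z_{1:k})\int\frac{p(\xi_{k+1}|\xi_k)\,p(\xi_{k+1}|Z_{1:K})}{p(\xi_{k+1}|Z_{1:k})}\,d\xi_{k+1}$$ with the following approximations. 1. (Slowly changing extent.) In the three kinematic densities under the integral, $p(x_{k+1}|x_k,X_{k+1})$, $p(x_{k+1}|X_{k+1},Z_{1:K})$ and $p(x_{k+1}|X_{k+1},Z_{1:k})$, the extent $X_{k+1}$ is replaced by $X_k$. 2. In the extent integral $\int \mathcal W(X_{k+1};n,\tfrac1nAX_kA^T)\frac{\mathcal{IW}(X_{k+1};v_{k+1|K},V_{k+1|K})}{\mathcal{IW}(X_{k+1};v_{k+1|k},V_{k+1|k})}\,dX_{k+1}$, the transition density is, for each $X_{k+1}$, replaced as a function of $X_k$ by the multiple of a Wishart density in $X_k$ with the same total mass and the same expectations $\mathbb E[X]$ and $\mathbb E[X^{-1}]$. 3. The resulting extent integral, as a function of $X_k$, is replaced by the multiple of an inverse Wishart density with the same total mass and the same expectations $\mathbb E[X]$ and $\mathbb E[X^{-1}]$. 4. The resulting product is normalised to total mass one.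 Then after approximation 1 the integral over $\xi_{k+1}=(x_{k+1},X_{k+1})$ is the product of a kinematic integral over $x_{k+1}$ and the extent integral in 2 over $X_{k+1}$; approximations 2 and 3 can be carried out; and the smoothed law of $\xi_k$ that results from the steps 1–4 is uniquely determined and is exactly the conditional Gaussian inverse Wishart law $\mathrm{GIW}(m_{k|K},P_{k|K},v_{k|K},V_{k|K})$, where $$\begin{aligned} m_{k|K}&=m_{k|k}+(G\otimes I_d)(m_{k+1|K}-m_{k+1|k}),\\ P_{k|K}&=P_{k|k}-G(P_{k+1|k}-P_{k+1|K})G^{T},\\ v_{k|K}&=v_{k|k}+\eta^{-1}\Big(v_{k+1|K}-v_{k+1|k}-\tfrac{2(d+1)^2}{n}\Big),\\ V_{k|K}&=V_{k|k}+\eta^{-1}A^{-1}(V_{k+1|K}-V_{k+1|k})(A^{-1})^{T},\\ G&=P_{k|k}F^{T}P_{k+1|k}^{-1},\qquad \eta=1+\frac{v_{k+1|K}-v_{k+1|k}-3(d+1)}{n}, \end{aligned}$$ and these are admissible parameters: $P_{k|K}$ is positive semidefinite, $v_{k|K}>2d$ and $V_{k|K}\succ0$. -/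

import Mathlib

open MeasureTheory ProbabilityTheory Matrix
open scoped ENNReal Kronecker

noncomputable section

namespace RandomMatrix

/-- The product (Borel) sigma-algebra on real square matrices. -/
instance instMeasurableSpaceMatrix (d : ℕ) : MeasurableSpace (Matrix (Fin d) (Fin d) ℝ) :=
  inferInstanceAs (MeasurableSpace (Fin d → Fin d → ℝ))

/-- The symmetric matrix with prescribed entries on and above the diagonal. -/
def symOfUpper (d : ℕ) (u : {p : Fin d × Fin d // p.1 ≤ p.2} → ℝ) : Matrix (Fin d) (Fin d) ℝ :=
  fun i j => u ⟨(min i j, max i j), min_le_max⟩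

/-- Lebesgue measure `dX = ∏_{i ≤ j} dX i j` on symmetric `d × d` matrices, restricted to the
cone of positive definite matrices. -/
def spdVolume (d : ℕ) : Measure (Matrix (Fin d) (Fin d) ℝ) :=
  ((volume : Measure ({p : Fin d × Fin d // p.1 ≤ p.2} → ℝ)).map (symOfUpper d)).restrict
    {X | X.PosDef}

/-- The multivariate gamma function
`Γ_d(a) = ∫_{X > 0} det(X)^(a - (d+1)/2) exp(-tr X) dX`. -/
def multiGamma (d : ℕ) (a : ℝ) : ℝ :=
  ∫ X, X.det ^ (a - ((d : ℝ) + 1) / 2) * Real.exp (-X.trace) ∂(spdVolume d)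

/-- The Wishart pdf with `v` degrees of freedom and parameter matrix `V`, at a positive definite
matrix `X`; its mean is `v V`. -/
def wishartPDF {d : ℕ} (v : ℝ) (V X : Matrix (Fin d) (Fin d) ℝ) : ℝ :=
  ((2 : ℝ) ^ (v * d / 2) * multiGamma d (v / 2) * V.det ^ (v / 2))⁻¹ *
    X.det ^ ((v - d - 1) / 2) * Real.exp (-(V⁻¹ * X).trace / 2)

/-- The inverse Wishart pdf with `v > 2 d` degrees of freedom and parameter matrix `V`, at a
positive definite matrix `X`; its mean is `V / (v - 2 d - 2)`. -/
def invWishartPDF {d : ℕ} (v : ℝ) (V X : Matrix (Fin d) (Fin d) ℝ) : ℝ :=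
  (V.det ^ ((v - d - 1) / 2) /
      ((2 : ℝ) ^ ((v - d - 1) * d / 2) * multiGamma d ((v - d - 1) / 2))) *
    X.det ^ (-(v / 2)) * Real.exp (-(V * X⁻¹).trace / 2)

/-- The Gaussian pdf on `ℝ^ι` with mean `m` and positive definite covariance matrix `S`. -/
def normalPDF {ι : Type*} [Fintype ι] [DecidableEq ι] (m : EuclideanSpace ℝ ι)
    (S : Matrix ι ι ℝ) (x : EuclideanSpace ℝ ι) : ℝ :=
  (Real.sqrt ((2 * Real.pi) ^ Fintype.card ι * S.det))⁻¹ *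
    Real.exp (-((x - m).ofLp ⬝ᵥ (S⁻¹ *ᵥ (x - m).ofLp)) / 2)

/-- The kinematic space `ℝ^(s d)`; the index `(i, j)` is the `j`-th spatial component of the
`i`-th derivative, so that `P ⊗ X` acts on it for `P` of size `s` and `X` of size `d`. -/
abbrev Kin (s d : ℕ) : Type := EuclideanSpace ℝ (Fin s × Fin d)

/-- The parameters of a conditional Gaussian inverse Wishart distribution. -/
structure GIWParam (s d : ℕ) where
  /-- kinematic mean -/
  m : Kin s d
  /-- kinematic covariance factor -/
  P : Matrix (Fin s) (Fin s) ℝ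
  /-- degrees of freedom of the extent -/
  v : ℝ
  /-- parameter matrix of the extent -/
  V : Matrix (Fin d) (Fin d) ℝ

/-- The admissible parameters. -/
structure GIWParam.Valid {s d : ℕ} (q : GIWParam s d) : Prop where
  P_posSemidef : q.P.PosSemidef
  lt_v : 2 * (d : ℝ) < q.v
  V_posDef : q.V.PosDef

/-- The conditional Gaussian inverse Wishart distribution: the law of `(x, X)` with
`X ~ IW(v, V)` and `x | X ~ N(m, P ⊗ X)`. Singular `P` are allowed. -/
def condGIW {s d : ℕ} (q : GIWParam s d) :
    Measure (Kin s d × Matrix (Fin d) (Fin d) ℝ) :=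
  ((spdVolume d).withDensity fun X => ENNReal.ofReal (invWishartPDF q.v q.V X)).bind
    fun X => (multivariateGaussian q.m (q.P ⊗ₖ X)).map fun x => (x, X)

/-- The kinematic transition: the law `N((F ⊗ I) x, D ⊗ Y)`, where `Y` is the
extent on which the kinematics are conditioned. Singular `D` are allowed. -/
def kinTransition {s d : ℕ} (F D : Matrix (Fin s) (Fin s) ℝ) (x : Kin s d)
    (Y : Matrix (Fin d) (Fin d) ℝ) : Measure (Kin s d) :=
  multivariateGaussian
    (Matrix.toEuclideanLin (F ⊗ₖ (1 : Matrix (Fin d) (Fin d) ℝ)) x) (D ⊗ₖ Y)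

/-- The extent transition density `W(Y; n, A X Aᵀ / n)` from `X` to `Y`. -/
def extTransition {d : ℕ} (A : Matrix (Fin d) (Fin d) ℝ) (n : ℝ)
    (X Y : Matrix (Fin d) (Fin d) ℝ) : ℝ :=
  wishartPDF n (n⁻¹ • (A * X * Aᵀ)) Y

/-- The integral of the Bayesian backward smoothing recursion,
`∫ p(y, Y | x, X) p_next(y, Y) / p_pred(y, Y) d(y, Y)`, over the next state `(y, Y)`, where the
three kinematic densities (transition, next smoothed, predicted) are conditioned on the extent
`κ Y`. The exact recursion is `κ Y = Y`; the approximation for slowly changing extents replaces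
the next extent by the current one, `κ Y = X`. -/
def backwardFactor {s d : ℕ} (F D : Matrix (Fin s) (Fin s) ℝ) (A : Matrix (Fin d) (Fin d) ℝ)
    (n : ℝ) (pred next : GIWParam s d)
    (κ : Matrix (Fin d) (Fin d) ℝ → Matrix (Fin d) (Fin d) ℝ)
    (x : Kin s d) (X : Matrix (Fin d) (Fin d) ℝ) : ℝ≥0∞ :=
  ∫⁻ Y, ∫⁻ y,
      ENNReal.ofReal (extTransition A n X Y *
        ((normalPDF next.m (next.P ⊗ₖ κ Y) y * invWishartPDF next.v next.V Y) /
          (normalPDF pred.m (pred.P ⊗ₖ κ Y) y * invWishartPDF pred.v pred.V Y)))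
    ∂(kinTransition F D x (κ Y)) ∂(spdVolume d)

/-- The kinematic part of the backward integral, conditioned on the extent `X`:
`∫ p(y | x, X) p_next(y | X) / p_pred(y | X) dy`. -/
def kinFactor {s d : ℕ} (F D : Matrix (Fin s) (Fin s) ℝ) (pred next : GIWParam s d)
    (x : Kin s d) (X : Matrix (Fin d) (Fin d) ℝ) : ℝ≥0∞ :=
  ∫⁻ y, ENNReal.ofReal (normalPDF next.m (next.P ⊗ₖ X) y / normalPDF pred.m (pred.P ⊗ₖ X) y)
    ∂(kinTransition F D x X)

/-- The extent part of the backward integral for an extent transition `L`: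
`∫ L X Y p_next(Y) / p_pred(Y) dY`. -/
def extFactor {s d : ℕ} (pred next : GIWParam s d)
    (L : Matrix (Fin d) (Fin d) ℝ → Matrix (Fin d) (Fin d) ℝ → ℝ)
    (X : Matrix (Fin d) (Fin d) ℝ) : ℝ :=
  ∫ Y, L X Y * (invWishartPDF next.v next.V Y / invWishartPDF pred.v pred.V Y) ∂(spdVolume d)

/-- The functions `p` and `q`, unnormalised densities on the positive definite matrices, have the
same finite positive total mass and the same finite (unnormalised) expectations of `X` and of
`X⁻¹`. -/
structure SameMoments {d : ℕ} (p q : Matrix (Fin d) (Fin d) ℝ → ℝ) : Prop where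
  integrable_left : Integrable p (spdVolume d)
  integrable_right : Integrable q (spdVolume d)
  mass_pos : 0 < ∫ X, p X ∂(spdVolume d)
  mass_eq : ∫ X, p X ∂(spdVolume d) = ∫ X, q X ∂(spdVolume d)
  mean_left : ∀ i j, Integrable (fun X => X i j * p X) (spdVolume d)
  mean_right : ∀ i j, Integrable (fun X => X i j * q X) (spdVolume d)
  mean_eq : ∀ i j, ∫ X, X i j * p X ∂(spdVolume d) = ∫ X, X i j * q X ∂(spdVolume d)
  inv_mean_left : ∀ i j, Integrable (fun X => X⁻¹ i j * p X) (spdVolume d)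
  inv_mean_right : ∀ i j, Integrable (fun X => X⁻¹ i j * q X) (spdVolume d)
  inv_mean_eq : ∀ i j, ∫ X, X⁻¹ i j * p X ∂(spdVolume d) = ∫ X, X⁻¹ i j * q X ∂(spdVolume d)

/-- `c W(w, W)` is the moment matched (scaled) Wishart approximation of the unnormalised density
`p`. The condition `d + 1 < w` is the range in which a Wishart matrix has an expected inverse. -/
structure IsWishartApprox {d : ℕ} (p : Matrix (Fin d) (Fin d) ℝ → ℝ) (c w : ℝ)
    (W : Matrix (Fin d) (Fin d) ℝ) : Prop where
  lt_w : (d : ℝ) + 1 < w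
  posDef : W.PosDef
  moments : SameMoments p fun X => c * wishartPDF w W X

/-- `c IW(w, W)` is the moment matched (scaled) inverse Wishart approximation of the unnormalised
density `p`. The condition `2 d + 2 < w` is the range in which an inverse Wishart matrix has an
expected value. -/
structure IsInvWishartApprox {d : ℕ} (p : Matrix (Fin d) (Fin d) ℝ → ℝ) (c w : ℝ)
    (W : Matrix (Fin d) (Fin d) ℝ) : Prop where
  lt_w : 2 * (d : ℝ) + 2 < w
  posDef : W.PosDef
  moments : SameMoments p fun X => c * invWishartPDF w W X

/-- `μ` is a smoothed law of the current state `(x, X)`, computed by the backward smoothing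
recursion from the filtered, predicted and next smoothed laws under the slowly changing extent
approximation (so that the backward integral is `kinFactor` times `extFactor`) and with two
moment matching approximations in the extent part:
the transition density `X ↦ W(Y; n, A X Aᵀ / n)` is replaced, for each `Y`, by a scaled Wishart
density in `X`, and the resulting extent integral is replaced by a scaled inverse Wishart density
in `X`. The product is normalised to total mass one. -/
def IsSmoothed {s d : ℕ} (F D : Matrix (Fin s) (Fin s) ℝ) (A : Matrix (Fin d) (Fin d) ℝ)
    (n : ℝ) (filt pred next : GIWParam s d)
    (μ : Measure (Kin s d × Matrix (Fin d) (Fin d) ℝ)) : Prop :=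
  ∃ (c w : Matrix (Fin d) (Fin d) ℝ → ℝ)
    (W : Matrix (Fin d) (Fin d) ℝ → Matrix (Fin d) (Fin d) ℝ)
    (c' w' : ℝ) (W' : Matrix (Fin d) (Fin d) ℝ),
    (∀ Y, Y.PosDef →
      IsWishartApprox (fun X => extTransition A n X Y) (c Y) (w Y) (W Y)) ∧
    IsInvWishartApprox
      (extFactor pred next fun X Y => c Y * wishartPDF (w Y) (W Y) X) c' w' W' ∧
    ∃ ν : Measure (Kin s d × Matrix (Fin d) (Fin d) ℝ),
      ν = (condGIW filt).withDensity (fun ξ =>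
        kinFactor F D pred next ξ.1 ξ.2 * ENNReal.ofReal (c' * invWishartPDF w' W' ξ.2)) ∧
      ν Set.univ ≠ 0 ∧ ν Set.univ ≠ ∞ ∧ μ = (ν Set.univ)⁻¹ • ν

end RandomMatrix

end

open RandomMatrix

noncomputable section

namespace RandomMatrix

/-! ### Coordinates on symmetric matrices and the Jacobian of a congruence -/

section SymmetricMatrices

/-! After the extent has been frozen, the kinematic and the extent part separate, and each is
handled by its own principle.

Kinematics, given `X`. Let `x` follow the filtered law and `y = F x + e`, with covariance `S` of
`y`. The joint law can also be generated backwards: draw `y` from the predicted law and put `x = m +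
G (y - F m) + r`, where `G S = P Fᵀ` and `r` is independent of `y` with covariance `P - G S Gᵀ`
(`joint_gaussian`, by characteristic functions). The kinematic integral weights this joint law by a
ratio depending on `y` alone, so it replaces the predicted law of `y` by the next smoothed one and
keeps the conditional law of `x` given `y`. This yields the smoothed mean and covariance
(`kinematic_smoothing`). Only `y` needs a density, so `filt.P` and `D` may be singular. The
reweighted law is again a probability measure, so for the law of `X` the kinematic factor is
neutral.

Extent. As a function of `X` the transition density is a constant `C`, independent of `Y`, times
`IW(n, n A⁻¹ Y A⁻ᵀ)` (`extTransition_eq`), and a quotient of inverse Wishart densities is a multiple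
of an inverse Wishart density (`invWishartPDF_div`). What is matched are the moments `v V` and `V⁻¹
/ (v - d - 1)` of a Wishart law, and `V / (v - 2d - 2)` and `(v - d - 1) V⁻¹` of an inverse Wishart
law. In both families the product of mean and inverse mean is a scalar that determines the degrees
of freedom, whence uniqueness (`wishart_unique`, `invWishart_unique`). After the first matching, the
mean is linear in `Y` and the inverse mean linear in `Y⁻¹`, so the moments of the extent integral
follow from the law of total expectation (`HasScaledMoments.mixture`); the second matching produces
`η`. Finally, multiplying inverse Wishart densities adds their parameters (`invWishartPDF_mul`).

The Wishart moments themselves come from the standard case. Congruence by a square root of `2 V`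
removes `V`, with Jacobian `|det B| ^ (d + 1)`. Invariance under coordinate swaps and sign changes
makes both expectations multiples of the identity (`isotropic_moments`). One diagonal entry of each
is computed by splitting off the first row and column, which separates the gamma weight into a
gamma, a Gaussian and a smaller matrix integral (`lintegral_gammaDensity_succ`). Inversion, with
Jacobian `det X ^ -(d + 1)`, transfers everything to the inverse Wishart law. -/

instance instBorelSpaceMatrix (d : ℕ) : BorelSpace (Matrix (Fin d) (Fin d) ℝ) :=
  inferInstanceAs (BorelSpace (Fin d → Fin d → ℝ))

/-- The positions on and above the diagonal. -/
abbrev UpperIdx (d : ℕ) : Type := {p : Fin d × Fin d // p.1 ≤ p.2}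

/-- The entries of a matrix on and above the diagonal. -/
def upperPart {d : ℕ} (X : Matrix (Fin d) (Fin d) ℝ) : UpperIdx d → ℝ := fun p => X p.1.1 p.1.2

variable {d : ℕ}

lemma upperPart_symOfUpper (u : UpperIdx d → ℝ) : upperPart (symOfUpper d u) = u := by
  ext p
  have hp := p.2
  simp only [upperPart, symOfUpper]
  congr 1
  ext <;> simp [hp]

lemma symOfUpper_upperPart {X : Matrix (Fin d) (Fin d) ℝ} (hX : X.IsSymm) :
    symOfUpper d (upperPart X) = X := by
  ext i j
  simp only [upperPart, symOfUpper]
  rcases le_total i j with h | h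
  · simp [h]
  · simp [h, ← hX.apply i j]

lemma isSymm_symOfUpper (u : UpperIdx d → ℝ) : (symOfUpper d u).IsSymm := by
  ext i j
  simp [symOfUpper, min_comm i j, max_comm i j]

lemma measurable_entry (i j : Fin d) : Measurable fun X : Matrix (Fin d) (Fin d) ℝ => X i j :=
  (measurable_pi_apply j).comp (measurable_pi_apply i)

lemma measurable_matrix_iff {α : Type*} [MeasurableSpace α]
    {f : α → Matrix (Fin d) (Fin d) ℝ} : Measurable f ↔ ∀ i j, Measurable fun a => f a i j :=
  ⟨fun h i j => (measurable_entry i j).comp h,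
    fun h => measurable_pi_lambda _ fun i => measurable_pi_lambda _ fun j => h i j⟩

lemma measurable_symOfUpper : Measurable (symOfUpper d) :=
  measurable_matrix_iff.2 fun _ _ => measurable_pi_apply _

lemma measurable_upperPart : Measurable (upperPart (d := d)) :=
  measurable_pi_lambda _ fun _ => measurable_entry _ _

lemma measurable_det : Measurable fun X : Matrix (Fin d) (Fin d) ℝ => X.det :=
  (Continuous.matrix_det continuous_id).measurable

lemma measurable_trace : Measurable fun X : Matrix (Fin d) (Fin d) ℝ => X.trace :=
  (Continuous.matrix_trace continuous_id).measurable

lemma measurable_inv : Measurable fun X : Matrix (Fin d) (Fin d) ℝ => X⁻¹ := by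
  refine measurable_matrix_iff.2 fun i j => ?_
  have : (fun X : Matrix (Fin d) (Fin d) ℝ => X⁻¹ i j) = fun X => X.det⁻¹ * X.adjugate i j := by
    ext X
    simp [Matrix.inv_def]
  rw [this]
  exact measurable_det.inv.mul
    ((measurable_entry i j).comp (Continuous.matrix_adjugate continuous_id).measurable)

lemma measurable_mul_left (A : Matrix (Fin d) (Fin d) ℝ) : Measurable fun X => A * X :=
  (continuous_const.matrix_mul continuous_id).measurable

lemma measurable_mul_right (A : Matrix (Fin d) (Fin d) ℝ) : Measurable fun X => X * A :=
  (continuous_id.matrix_mul continuous_const).measurable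

lemma measurableSet_posSemidef : MeasurableSet {X : Matrix (Fin d) (Fin d) ℝ | X.PosSemidef} := by
  have : {X : Matrix (Fin d) (Fin d) ℝ | X.PosSemidef} =
      {X | Xᵀ = X} ∩ ⋂ x : Fin d → ℝ, {X | 0 ≤ x ⬝ᵥ (X *ᵥ x)} := by
    ext X
    simp [posSemidef_iff_dotProduct_mulVec, IsHermitian]
  rw [this]
  refine (IsClosed.inter (isClosed_eq (by fun_prop) (by fun_prop))
    (isClosed_iInter fun x => isClosed_le (by fun_prop) (by fun_prop))).measurableSet

lemma measurableSet_posDef : MeasurableSet {X : Matrix (Fin d) (Fin d) ℝ | X.PosDef} := by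
  have : {X : Matrix (Fin d) (Fin d) ℝ | X.PosDef} = {X | X.PosSemidef} ∩ {X | X.det ≠ 0} := by
    ext X
    exact ⟨fun h => ⟨h.posSemidef, h.det_pos.ne'⟩, fun h => h.1.posDef_iff_det_ne_zero.2 h.2⟩
  rw [this]
  exact measurableSet_posSemidef.inter (measurable_det (measurableSet_singleton 0).compl)

/-- The positive definite cone in the coordinates on and above the diagonal. -/
def upperCone (d : ℕ) : Set (UpperIdx d → ℝ) := {u | (symOfUpper d u).PosDef}

lemma measurableSet_upperCone : MeasurableSet (upperCone d) :=
  measurable_symOfUpper measurableSet_posDef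

lemma spdVolume_eq_map : spdVolume d = (volume.restrict (upperCone d)).map (symOfUpper d) := by
  rw [spdVolume, Measure.restrict_map measurable_symOfUpper measurableSet_posDef]
  rfl

instance : SFinite (spdVolume d) := by
  rw [spdVolume_eq_map]; infer_instance

lemma lintegral_spdVolume {f : Matrix (Fin d) (Fin d) ℝ → ℝ≥0∞} (hf : Measurable f) :
    ∫⁻ X, f X ∂(spdVolume d) = ∫⁻ u in upperCone d, f (symOfUpper d u) := by
  rw [spdVolume_eq_map, lintegral_map hf measurable_symOfUpper]

lemma ae_posDef_spdVolume : ∀ᵐ X ∂(spdVolume d), X.PosDef :=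
  ae_restrict_mem measurableSet_posDef

/-- The congruence `X ↦ B X Bᵀ` on symmetric matrices, in coordinates. -/
def congrUpper (B : Matrix (Fin d) (Fin d) ℝ) : (UpperIdx d → ℝ) →ₗ[ℝ] (UpperIdx d → ℝ) where
  toFun u := upperPart (B * symOfUpper d u * Bᵀ)
  map_add' u v := by
    have : symOfUpper d (u + v) = symOfUpper d u + symOfUpper d v := rfl
    rw [this, Matrix.mul_add, Matrix.add_mul]; rfl
  map_smul' c u := by
    have : symOfUpper d (c • u) = c • symOfUpper d u := rfl
    rw [this, Matrix.mul_smul, Matrix.smul_mul]; rfl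

lemma congrUpper_apply (B : Matrix (Fin d) (Fin d) ℝ) (u : UpperIdx d → ℝ) :
    congrUpper B u = upperPart (B * symOfUpper d u * Bᵀ) := rfl

lemma symOfUpper_congrUpper (B : Matrix (Fin d) (Fin d) ℝ) (u : UpperIdx d → ℝ) :
    symOfUpper d (congrUpper B u) = B * symOfUpper d u * Bᵀ := by
  rw [congrUpper_apply, symOfUpper_upperPart]
  simp only [IsSymm, Matrix.transpose_mul, transpose_transpose, (isSymm_symOfUpper u).eq,
    Matrix.mul_assoc]

lemma congrUpper_mul (A B : Matrix (Fin d) (Fin d) ℝ) :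
    congrUpper (A * B) = congrUpper A ∘ₗ congrUpper B := by
  refine LinearMap.ext fun u => ?_
  simp only [LinearMap.comp_apply, congrUpper_apply A, congrUpper_apply (A * B),
    symOfUpper_congrUpper, Matrix.transpose_mul, Matrix.mul_assoc]

lemma congrUpper_one : congrUpper (1 : Matrix (Fin d) (Fin d) ℝ) = LinearMap.id := by
  refine LinearMap.ext fun u => ?_
  simp [congrUpper_apply, upperPart_symOfUpper]

/-- Each index `i` is the first member of the pairs `i ≤ j` and the second member of the pairs `j ≤
i`. Together these use every `j` once and `j = i` twice, hence the power `d + 1`. -/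
lemma prod_upperIdx (D : Fin d → ℝ) :
    ∏ p : UpperIdx d, D p.1.1 * D p.1.2 = (∏ i, D i) ^ (d + 1) := by
  have h1 : ∀ f : Fin d × Fin d → ℝ,
      ∏ p : UpperIdx d, f p.1 = ∏ i, ∏ j, if i ≤ j then f (i, j) else 1 := by
    intro f
    rw [← Fintype.prod_prod_type' (fun i j => if i ≤ j then f (i, j) else 1),
      ← Finset.prod_filter]
    exact (Finset.prod_subtype (Finset.univ.filter fun q : Fin d × Fin d => q.1 ≤ q.2) (by simp)
      fun q => f q).symm
  rw [h1 fun q => D q.1 * D q.2]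
  have h2 : ∀ i j : Fin d, (if i ≤ j then D i * D j else 1) =
      (if i ≤ j then D i else 1) * (if i ≤ j then D j else 1) := by
    intro i j; split_ifs <;> simp
  simp only [h2, Finset.prod_mul_distrib]
  rw [Finset.prod_comm (f := fun i j => if i ≤ j then D j else 1), ← Finset.prod_mul_distrib,
    ← Finset.prod_pow]
  refine Finset.prod_congr rfl fun i _ => ?_
  rw [← Finset.prod_mul_distrib]
  have h3 : ∀ j : Fin d, ((if i ≤ j then D i else 1) * if j ≤ i then D i else 1) =
      D i * if j = i then D i else 1 := by
    intro j
    rcases lt_trichotomy i j with h | h | h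
    · simp [h.le, h.not_ge, h.ne']
    · simp [h]
    · simp [h.le, h.not_ge, h.ne]
  simp only [h3]
  rw [Finset.prod_mul_distrib]
  simp [pow_succ]

lemma det_congrUpper_diagonal (D : Fin d → ℝ) :
    LinearMap.det (congrUpper (diagonal D)) = (∏ i, D i) ^ (d + 1) := by
  have : congrUpper (diagonal D) =
      Matrix.toLin' (diagonal fun p : UpperIdx d => D p.1.1 * D p.1.2) := by
    refine LinearMap.ext fun u => ?_
    ext p
    have hp := congrFun (upperPart_symOfUpper u) p
    simp only [upperPart] at hp
    simp [congrUpper, upperPart, diagonal_mul, mul_diagonal, mulVec_diagonal, hp]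
    ring
  rw [this, LinearMap.det_toLin', det_diagonal, prod_upperIdx]

/-- Congruence is multiplicative in `B`, so the spectral theorem reduces a symmetric `B` to its
diagonal of eigenvalues. -/
lemma det_congrUpper {B : Matrix (Fin d) (Fin d) ℝ} (hB : B.IsSymm) :
    LinearMap.det (congrUpper B) = B.det ^ (d + 1) := by
  have hH : B.IsHermitian := by simpa [IsHermitian] using hB.eq
  have hs := hH.spectral_theorem
  rw [Unitary.conjStarAlgAut_apply] at hs
  -- The orthogonal factor is not symmetric in general; only the product of its determinant with
  -- that of its inverse is needed.
  have h1 : LinearMap.det (congrUpper (hH.eigenvectorUnitary : Matrix (Fin d) (Fin d) ℝ)) *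
      LinearMap.det (congrUpper (star hH.eigenvectorUnitary : Matrix (Fin d) (Fin d) ℝ)) = 1 := by
    rw [← LinearMap.det_comp, ← congrUpper_mul]
    simp [congrUpper_one]
  conv_lhs => rw [hs, congrUpper_mul, congrUpper_mul]
  rw [LinearMap.det_comp, LinearMap.det_comp, mul_right_comm, h1, one_mul,
    det_congrUpper_diagonal, hH.det_eq_prod_eigenvalues]
  simp

lemma posDef_conj_iff {B : Matrix (Fin d) (Fin d) ℝ} (hB : IsUnit B.det)
    (X : Matrix (Fin d) (Fin d) ℝ) : (B * X * Bᵀ).PosDef ↔ X.PosDef := by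
  have := Matrix.IsUnit.posDef_star_right_conjugate_iff (x := X) ((isUnit_iff_isUnit_det B).2 hB)
  simpa [star_eq_conjTranspose] using this

/-- Change of variables for a congruence by a symmetric matrix. -/
lemma lintegral_congr_symm {B : Matrix (Fin d) (Fin d) ℝ} (hB : B.IsSymm) (hdet : B.det ≠ 0)
    {f : Matrix (Fin d) (Fin d) ℝ → ℝ≥0∞} (hf : Measurable f) :
    ∫⁻ X, f (B * X * B) ∂(spdVolume d) =
      ENNReal.ofReal ((|B.det| ^ (d + 1))⁻¹) * ∫⁻ X, f X ∂(spdVolume d) := by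
  have hm : Measurable (congrUpper B) := (LinearMap.continuous_of_finiteDimensional _).measurable
  have hf' : Measurable fun X => f (B * X * B) :=
    hf.comp ((measurable_mul_right B).comp (measurable_mul_left B))
  have hd : LinearMap.det (congrUpper B) ≠ 0 := by
    rw [det_congrUpper hB]; exact pow_ne_zero _ hdet
  have hmap := Measure.map_linearMap_addHaar_eq_smul_addHaar
    (volume : Measure (UpperIdx d → ℝ)) hd
  have hpre : congrUpper B ⁻¹' upperCone d = upperCone d := by
    ext u
    simp only [upperCone, Set.mem_preimage, Set.mem_ofPred_eq, symOfUpper_congrUpper]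
    exact posDef_conj_iff (isUnit_iff_ne_zero.2 hdet) _
  rw [lintegral_spdVolume hf', lintegral_spdVolume hf]
  calc ∫⁻ u in upperCone d, f (B * symOfUpper d u * B)
      = ∫⁻ u in congrUpper B ⁻¹' upperCone d, f (symOfUpper d (congrUpper B u)) := by
        rw [hpre]; simp only [symOfUpper_congrUpper, hB.eq]
    _ = ∫⁻ u in upperCone d, f (symOfUpper d u) ∂(volume.map (congrUpper B)) := by
        erw [setLIntegral_map measurableSet_upperCone (hf.comp measurable_symOfUpper) hm]; rfl
    _ = _ := by
        rw [hmap, Measure.restrict_smul, lintegral_smul_measure, det_congrUpper hB, abs_inv,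
          abs_pow, smul_eq_mul]

end SymmetricMatrices

/-! ### The Jacobian of matrix inversion -/

section InversionJacobian

variable {d : ℕ}

/-- Inversion of symmetric matrices, in coordinates. -/
def invUpper (u : UpperIdx d → ℝ) : UpperIdx d → ℝ := upperPart (symOfUpper d u)⁻¹

lemma symOfUpper_invUpper (u : UpperIdx d → ℝ) :
    symOfUpper d (invUpper u) = (symOfUpper d u)⁻¹ :=
  symOfUpper_upperPart (by rw [IsSymm, transpose_nonsing_inv, (isSymm_symOfUpper u).eq])

lemma invUpper_invUpper {u : UpperIdx d → ℝ} (hu : u ∈ upperCone d) :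
    invUpper (invUpper u) = u := by
  have hd : IsUnit (symOfUpper d u).det := isUnit_iff_ne_zero.2 (PosDef.det_pos hu).ne'
  rw [invUpper, symOfUpper_invUpper, nonsing_inv_nonsing_inv _ hd, upperPart_symOfUpper]

lemma invUpper_mem {u : UpperIdx d → ℝ} (hu : u ∈ upperCone d) : invUpper u ∈ upperCone d := by
  show (symOfUpper d (invUpper u)).PosDef
  rw [symOfUpper_invUpper]
  exact PosDef.inv hu

/-- The derivative of inversion at `X` is `H ↦ -X⁻¹ H X⁻¹`. For symmetric `X` this is minus a
congruence, so its determinant is already known. -/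
lemma hasFDerivAt_invUpper {u : UpperIdx d → ℝ} (hu : u ∈ upperCone d) :
    HasFDerivAt invUpper (LinearMap.toContinuousLinearMap (-congrUpper (symOfUpper d u)⁻¹)) u := by
  -- A norm on matrices is chosen only to differentiate `Ring.inverse` at a unit; the linear maps
  -- `S` and `T` carry the result to coordinates.
  let _ : NormedRing (Matrix (Fin d) (Fin d) ℝ) := Matrix.linftyOpNormedRing
  let _ : NormedAlgebra ℝ (Matrix (Fin d) (Fin d) ℝ) := Matrix.linftyOpNormedAlgebra
  have hd : IsUnit (symOfUpper d u).det := isUnit_iff_ne_zero.2 (PosDef.det_pos hu).ne'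
  let S : (UpperIdx d → ℝ) →ₗ[ℝ] Matrix (Fin d) (Fin d) ℝ :=
    { toFun := symOfUpper d, map_add' := fun _ _ => rfl, map_smul' := fun _ _ => rfl }
  let T : Matrix (Fin d) (Fin d) ℝ →ₗ[ℝ] (UpperIdx d → ℝ) :=
    { toFun := upperPart, map_add' := fun _ _ => rfl, map_smul' := fun _ _ => rfl }
  obtain ⟨U, hU⟩ := (isUnit_iff_isUnit_det _).2 hd
  have h1 := hasFDerivAt_ringInverse (𝕜 := ℝ) U
  have hS : HasFDerivAt (fun v => S v) (LinearMap.toContinuousLinearMap S) u :=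
    (LinearMap.toContinuousLinearMap S).hasFDerivAt
  have h2 : HasFDerivAt (Ring.inverse ∘ fun v => S v) _ u :=
    HasFDerivAt.comp u (by rw [← show (U : Matrix _ _ ℝ) = S u from hU]; exact h1) hS
  have h3 := (LinearMap.toContinuousLinearMap T).hasFDerivAt.comp u h2
  have hUi : ((U⁻¹ : (Matrix (Fin d) (Fin d) ℝ)ˣ) : Matrix (Fin d) (Fin d) ℝ) =
      (symOfUpper d u)⁻¹ := by rw [← hU, coe_units_inv]
  have hsymm : ((symOfUpper d u)⁻¹)ᵀ = (symOfUpper d u)⁻¹ := by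
    rw [transpose_nonsing_inv, (isSymm_symOfUpper u).eq]
  refine (h3.congr_fderiv ?_).congr_of_eventuallyEq (Filter.Eventually.of_forall fun v => ?_)
  · refine ContinuousLinearMap.ext fun v => ?_
    rw [hUi]
    show upperPart (-((symOfUpper d u)⁻¹ * symOfUpper d v * (symOfUpper d u)⁻¹)) =
      -upperPart ((symOfUpper d u)⁻¹ * symOfUpper d v * ((symOfUpper d u)⁻¹)ᵀ)
    rw [hsymm]
    rfl
  · simp only [invUpper, nonsing_inv_eq_ringInverse]
    rfl

lemma abs_det_neg_congrUpper_inv {u : UpperIdx d → ℝ} (hu : u ∈ upperCone d) :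
    |(LinearMap.toContinuousLinearMap (-congrUpper (symOfUpper d u)⁻¹)).det| =
      ((symOfUpper d u).det ^ (d + 1))⁻¹ := by
  have hpos := PosDef.det_pos hu
  have hsymm : ((symOfUpper d u)⁻¹).IsSymm := by
    rw [IsSymm, transpose_nonsing_inv, (isSymm_symOfUpper u).eq]
  have : (-congrUpper (symOfUpper d u)⁻¹) = (-1 : ℝ) • congrUpper (symOfUpper d u)⁻¹ :=
    (neg_one_smul ℝ _).symm
  rw [ContinuousLinearMap.det, LinearMap.coe_toContinuousLinearMap, this, LinearMap.det_smul,
    det_congrUpper hsymm, abs_mul, abs_pow]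
  simp [det_nonsing_inv, abs_of_pos hpos]

/-- Change of variables for the inversion of positive definite matrices. -/
lemma lintegral_inv_spdVolume {f : Matrix (Fin d) (Fin d) ℝ → ℝ≥0∞} (hf : Measurable f) :
    ∫⁻ X, ENNReal.ofReal ((X.det ^ (d + 1))⁻¹) * f X⁻¹ ∂(spdVolume d) =
      ∫⁻ X, f X ∂(spdVolume d) := by
  have himg : invUpper '' upperCone d = upperCone d := by
    ext u
    constructor
    · rintro ⟨v, hv, rfl⟩; exact invUpper_mem hv
    · intro hu; exact ⟨_, invUpper_mem hu, invUpper_invUpper hu⟩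
  have hinj : Set.InjOn (invUpper (d := d)) (upperCone d) := by
    intro u hu v hv h
    rw [← invUpper_invUpper hu, h, invUpper_invUpper hv]
  have key := lintegral_image_eq_lintegral_abs_det_fderiv_mul volume measurableSet_upperCone
    (fun u hu => (hasFDerivAt_invUpper hu).hasFDerivWithinAt) hinj (fun u => f (symOfUpper d u))
  rw [himg] at key
  rw [lintegral_spdVolume hf, key, lintegral_spdVolume]
  · refine setLIntegral_congr_fun measurableSet_upperCone fun u hu => ?_
    simp only [abs_det_neg_congrUpper_inv hu, symOfUpper_invUpper]
  · exact (measurable_det.pow_const _).inv.ennreal_ofReal.mul (hf.comp measurable_inv)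

end InversionJacobian

/-! ### Gaussian laws with invertible covariance have densities -/

section Gaussian

variable {ι : Type*} [Fintype ι] [DecidableEq ι]

open scoped MatrixOrder in
lemma posDef_sqrt {S : Matrix ι ι ℝ} (hS : S.PosDef) :
    (CFC.sqrt S).PosDef ∧ CFC.sqrt S * CFC.sqrt S = S := by
  have h1 : CFC.sqrt S * CFC.sqrt S = S := CFC.sqrt_mul_sqrt_self _ hS.posSemidef.nonneg
  have h2 : (CFC.sqrt S).PosSemidef := (CFC.sqrt_nonneg S).posSemidef
  refine ⟨h2.posDef_iff_det_ne_zero.2 fun h => hS.det_pos.ne' ?_, h1⟩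
  rw [← h1, det_mul, h, zero_mul]

lemma dotProduct_self_eq_norm_sq {κ : Type*} [Fintype κ] (x : EuclideanSpace ℝ κ) :
    x.ofLp ⬝ᵥ x.ofLp = ‖x‖ ^ 2 := by
  rw [EuclideanSpace.real_norm_sq_eq]
  simp [dotProduct, sq]

lemma normalPDF_zero_one (x : EuclideanSpace ℝ ι) : normalPDF 0 (1 : Matrix ι ι ℝ) x =
    (Real.sqrt ((2 * Real.pi) ^ Fintype.card ι))⁻¹ * Real.exp (-(‖x‖ ^ 2) / 2) := by
  simp [normalPDF, dotProduct_self_eq_norm_sq]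

lemma normalPDF_nonneg (m : EuclideanSpace ℝ ι) (S : Matrix ι ι ℝ) (x : EuclideanSpace ℝ ι) :
    0 ≤ normalPDF m S x := by
  unfold normalPDF; positivity

lemma continuous_normalPDF (m : EuclideanSpace ℝ ι) (S : Matrix ι ι ℝ) :
    Continuous (normalPDF m S) := by
  unfold normalPDF
  fun_prop

lemma measurable_normalPDF (m : EuclideanSpace ℝ ι) (S : Matrix ι ι ℝ) :
    Measurable (normalPDF m S) := (continuous_normalPDF m S).measurable

lemma integral_fourier_normalPDF (t : EuclideanSpace ℝ ι) :
    ∫ v : EuclideanSpace ℝ ι, ((normalPDF 0 (1 : Matrix ι ι ℝ) v : ℝ) : ℂ) *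
      Complex.exp (inner ℝ v t * Complex.I) = Complex.exp (-‖t‖ ^ 2 / 2) := by
  have h := GaussianFourier.integral_cexp_neg_mul_sq_norm_add_of_euclideanSpace
    (b := (1 / 2 : ℂ)) (by norm_num) Complex.I t
  have hc : (2 * (Real.pi : ℂ)) ^ (Fintype.card ι / 2 : ℂ) =
      ((Real.sqrt ((2 * Real.pi) ^ Fintype.card ι) : ℝ) : ℂ) := by
    rw [Real.sqrt_eq_rpow, ← Real.rpow_natCast, ← Real.rpow_mul (by positivity),
      Complex.ofReal_cpow (by positivity)]
    push_cast
    congr 1; ring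
  have hne : ((Real.sqrt ((2 * Real.pi) ^ Fintype.card ι) : ℝ) : ℂ) ≠ 0 := by
    exact_mod_cast (Real.sqrt_pos.2 (by positivity)).ne'
  calc _ = ∫ v : EuclideanSpace ℝ ι, ((Real.sqrt ((2 * Real.pi) ^ Fintype.card ι) : ℝ) : ℂ)⁻¹ *
        Complex.exp (-(1 / 2 : ℂ) * ‖v‖ ^ 2 + Complex.I * inner ℝ t v) := by
        refine integral_congr_ae (Filter.Eventually.of_forall fun v => ?_)
        simp only [normalPDF_zero_one]
        push_cast
        rw [mul_assoc, ← Complex.exp_add, real_inner_comm]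
        congr 2; ring
    _ = _ := by
        rw [integral_const_mul, h, div_div_eq_mul_div, div_one, mul_comm (Real.pi : ℂ) 2, hc,
          inv_mul_cancel_left₀ hne, Complex.I_sq]
        congr 1; ring

lemma integrable_normalPDF_zero_one :
    Integrable (normalPDF (0 : EuclideanSpace ℝ ι) (1 : Matrix ι ι ℝ)) := by
  have h := GaussianFourier.integrable_cexp_neg_mul_sq_norm_add_of_euclideanSpace
    (b := (1 / 2 : ℂ)) (by norm_num) 0 (0 : EuclideanSpace ℝ ι)
  have h2 := (h.re).const_mul (Real.sqrt ((2 * Real.pi) ^ Fintype.card ι))⁻¹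
  refine h2.congr (Filter.Eventually.of_forall fun v => ?_)
  simp only [normalPDF_zero_one, zero_mul, add_zero]
  congr 1
  have : (-(1 / 2 : ℂ) * (‖v‖ : ℂ) ^ 2) = ((-‖v‖ ^ 2 / 2 : ℝ) : ℂ) := by push_cast; ring
  rw [this, ← Complex.ofReal_exp]
  simp only [RCLike.re_to_complex, Complex.ofReal_re]

/-- Both sides are finite measures with the characteristic function `exp (-‖t‖² / 2)`. -/
lemma stdGaussian_eq_withDensity : stdGaussian (EuclideanSpace ℝ ι) =
    volume.withDensity fun x => ENNReal.ofReal (normalPDF 0 (1 : Matrix ι ι ℝ) x) := by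
  have : IsFiniteMeasure ((volume : Measure (EuclideanSpace ℝ ι)).withDensity
      fun x => ENNReal.ofReal (normalPDF 0 (1 : Matrix ι ι ℝ) x)) :=
    isFiniteMeasure_withDensity_ofReal integrable_normalPDF_zero_one.2
  refine Measure.ext_of_charFun (funext fun t => ?_)
  rw [charFun_stdGaussian, charFun_apply, integral_withDensity_eq_integral_toReal_smul
    (measurable_normalPDF _ _).ennreal_ofReal (by simp), ← integral_fourier_normalPDF]
  refine integral_congr_ae (Filter.Eventually.of_forall fun v => ?_)
  simp [ENNReal.toReal_ofReal (normalPDF_nonneg _ _ _)]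

/-- Whitening: with `R R = S` the quadratic form of `S⁻¹` at `R x` is `‖x‖²`, and the Jacobian `det
R` is the square root of `det S`. -/
lemma normalPDF_comp_sqrt (m : EuclideanSpace ℝ ι) {S R : Matrix ι ι ℝ} (hR : R.PosDef)
    (hRS : R * R = S) (x : EuclideanSpace ℝ ι) :
    normalPDF 0 (1 : Matrix ι ι ℝ) x = R.det * normalPDF m S (m + toEuclideanLin R x) := by
  have hdet : IsUnit R.det := isUnit_iff_ne_zero.2 hR.det_pos.ne'
  have hRt : Rᵀ = R := by simpa [IsHermitian] using hR.isHermitian.eq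
  have h1 : (toEuclideanLin R x).ofLp ⬝ᵥ (S⁻¹ *ᵥ (toEuclideanLin R x).ofLp) =
      x.ofLp ⬝ᵥ x.ofLp := by
    rw [← hRS, Matrix.mul_inv_rev, ofLp_toLpLin, toLin'_apply, mulVec_mulVec, Matrix.mul_assoc,
      nonsing_inv_mul _ hdet, Matrix.mul_one, ← vecMul_transpose, hRt, ← dotProduct_mulVec,
      mulVec_mulVec, mul_nonsing_inv _ hdet, one_mulVec]
  simp only [normalPDF, add_sub_cancel_left, h1, sub_zero, inv_one, one_mulVec, det_one, mul_one]
  rw [← hRS, det_mul, Real.sqrt_mul (by positivity), Real.sqrt_mul_self hR.det_pos.le, mul_inv,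
    ← mul_assoc]
  congr 1
  field_simp [hR.det_pos.ne']

lemma det_toEuclideanLin (R : Matrix ι ι ℝ) : LinearMap.det (toEuclideanLin R) = R.det := by
  rw [toEuclideanLin, toLpLin_eq_toLin, LinearMap.det_toLin]

open scoped MatrixOrder in
-- The law is the image of the standard one under `x ↦ m + √S x`, and for invertible `S` this is a
-- linear change of variables.
lemma multivariateGaussian_eq_withDensity (m : EuclideanSpace ℝ ι) {S : Matrix ι ι ℝ}
    (hS : S.PosDef) : multivariateGaussian m S =
      volume.withDensity fun x => ENNReal.ofReal (normalPDF m S x) := by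
  obtain ⟨hR, hRS⟩ := posDef_sqrt hS
  set R := CFC.sqrt S with hRdef
  have hpos := hR.det_pos
  have hd : LinearMap.det (toEuclideanLin R) ≠ 0 := by rw [det_toEuclideanLin]; exact hpos.ne'
  have hTm : Measurable (toEuclideanLin R) :=
    (LinearMap.continuous_of_finiteDimensional _).measurable
  have hcoe : (fun x => m + toEuclideanCLM (𝕜 := ℝ) R x) = fun x => m + toEuclideanLin R x := rfl
  refine Measure.ext_of_lintegral _ fun f hf => ?_
  have hφ := (measurable_normalPDF m S).ennreal_ofReal
  rw [multivariateGaussian, ← hRdef, hcoe, lintegral_map hf (hTm.const_add m),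
    stdGaussian_eq_withDensity,
    lintegral_withDensity_eq_lintegral_mul _ (measurable_normalPDF _ _).ennreal_ofReal
      (g := fun x => f (m + toEuclideanLin R x)) (hf.comp (hTm.const_add m)),
    lintegral_withDensity_eq_lintegral_mul _ hφ hf]
  calc _ = ∫⁻ x, ENNReal.ofReal R.det *
        ((fun y => ENNReal.ofReal (normalPDF m S (m + y)) * f (m + y)) (toEuclideanLin R x)) := by
        refine lintegral_congr fun x => ?_
        simp only [Pi.mul_apply, normalPDF_comp_sqrt m hR hRS x,
          ENNReal.ofReal_mul hpos.le]
        rw [mul_assoc]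
    _ = ENNReal.ofReal R.det * ∫⁻ y, ENNReal.ofReal (normalPDF m S (m + y)) * f (m + y)
          ∂(volume.map (toEuclideanLin R)) := by
        have hg : Measurable fun y => ENNReal.ofReal (normalPDF m S (m + y)) * f (m + y) :=
          (hφ.mul hf).comp (measurable_const_add m)
        rw [lintegral_map hg hTm, lintegral_const_mul' _ _ ENNReal.ofReal_ne_top]
    _ = ∫⁻ y, ENNReal.ofReal (normalPDF m S (m + y)) * f (m + y) := by
        rw [Measure.map_linearMap_addHaar_eq_smul_addHaar _ hd, lintegral_smul_measure,
          det_toEuclideanLin, abs_of_pos (inv_pos.2 hpos), smul_eq_mul, ← mul_assoc,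
          ← ENNReal.ofReal_mul hpos.le, mul_inv_cancel₀ hpos.ne', ENNReal.ofReal_one, one_mul]
    _ = _ := lintegral_add_left_eq_self (fun y => ENNReal.ofReal (normalPDF m S y) * f y) m

lemma lintegral_normalPDF (m : EuclideanSpace ℝ ι) {S : Matrix ι ι ℝ} (hS : S.PosDef) :
    ∫⁻ x, ENNReal.ofReal (normalPDF m S x) = 1 := by
  have h := multivariateGaussian_eq_withDensity m hS
  have h1 : multivariateGaussian m S Set.univ = 1 := measure_univ
  rw [h, withDensity_apply _ MeasurableSet.univ] at h1
  simpa using h1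

lemma normalPDF_pos (m : EuclideanSpace ℝ ι) {S : Matrix ι ι ℝ} (hS : S.PosDef)
    (x : EuclideanSpace ℝ ι) : 0 < normalPDF m S x := by
  have := hS.det_pos
  unfold normalPDF; positivity

/-- Reweighting a Gaussian law by a ratio of Gaussian densities. -/
lemma multivariateGaussian_withDensity_ratio (m₁ m₂ : EuclideanSpace ℝ ι) {S₁ S₂ : Matrix ι ι ℝ}
    (h₁ : S₁.PosDef) (h₂ : S₂.PosDef) :
    (multivariateGaussian m₁ S₁).withDensity
      (fun x => ENNReal.ofReal (normalPDF m₂ S₂ x / normalPDF m₁ S₁ x)) =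
      multivariateGaussian m₂ S₂ := by
  rw [multivariateGaussian_eq_withDensity _ h₁, multivariateGaussian_eq_withDensity _ h₂,
    ← withDensity_mul _ (measurable_normalPDF m₁ S₁).ennreal_ofReal
      (g := fun x => ENNReal.ofReal (normalPDF m₂ S₂ x / normalPDF m₁ S₁ x))
      ((measurable_normalPDF _ _).div (measurable_normalPDF _ _)).ennreal_ofReal]
  congr 1
  funext x
  rw [Pi.mul_apply, ← ENNReal.ofReal_mul (normalPDF_nonneg _ _ _),
    mul_div_cancel₀ _ (normalPDF_pos m₁ h₁ x).ne']

/-- The Gaussian integral of a positive definite quadratic form. -/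
lemma lintegral_exp_neg_quadratic {Z : Matrix ι ι ℝ} (hZ : Z.PosDef) :
    ∫⁻ y : ι → ℝ, ENNReal.ofReal (Real.exp (-(y ⬝ᵥ (Z⁻¹ *ᵥ y)))) =
      ENNReal.ofReal (Real.sqrt (Real.pi ^ Fintype.card ι) * Real.sqrt Z.det) := by
  -- Covariance `Z / 2` cancels the factor `1/2` in the Gaussian exponent.
  have h2 : ((2 : ℝ)⁻¹ • Z).PosDef := hZ.smul (by norm_num)
  have hdet := hZ.det_pos
  have hinv : ((2 : ℝ)⁻¹ • Z)⁻¹ = (2 : ℝ) • Z⁻¹ := by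
    refine inv_eq_right_inv ?_
    rw [smul_mul_smul, mul_nonsing_inv _ (isUnit_iff_ne_zero.2 hdet.ne')]
    norm_num
  have hc : Real.sqrt ((2 * Real.pi) ^ Fintype.card ι * ((2 : ℝ)⁻¹ • Z).det) =
      Real.sqrt (Real.pi ^ Fintype.card ι) * Real.sqrt Z.det := by
    rw [← Real.sqrt_mul (by positivity), det_smul, ← mul_assoc, ← mul_pow]
    congr 3; ring
  have h := lintegral_normalPDF 0 h2
  rw [← (PiLp.volume_preserving_toLp ι).lintegral_comp_emb
    (MeasurableEquiv.toLp 2 _).measurableEmbedding] at h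
  have hpos : 0 < Real.sqrt (Real.pi ^ Fintype.card ι) * Real.sqrt Z.det := by positivity
  have h3 : ∀ y : ι → ℝ, ENNReal.ofReal (Real.exp (-(y ⬝ᵥ (Z⁻¹ *ᵥ y)))) =
      ENNReal.ofReal (Real.sqrt (Real.pi ^ Fintype.card ι) * Real.sqrt Z.det) *
        ENNReal.ofReal (normalPDF 0 ((2 : ℝ)⁻¹ • Z) (WithLp.toLp 2 y)) := by
    intro y
    rw [← ENNReal.ofReal_mul hpos.le]
    congr 1
    simp only [normalPDF, hc, hinv, sub_zero]
    rw [mul_inv_cancel_left₀ hpos.ne', smul_mulVec, dotProduct_smul, smul_eq_mul]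
    congr 1; ring
  simp_rw [h3]
  rw [lintegral_const_mul' _ _ ENNReal.ofReal_ne_top, h, mul_one]

end Gaussian

/-- A kernel that is the image of one fixed measure under a jointly measurable map is measurable in
its parameter. Additive noise is of this form. -/
lemma measurable_map_param {α β γ : Type*} [MeasurableSpace α] [MeasurableSpace β]
    [MeasurableSpace γ] (ν : Measure β) [SFinite ν] {T : α → β → γ}
    (hT : Measurable (Function.uncurry T)) : Measurable fun a => ν.map (T a) := by
  refine Measure.measurable_of_measurable_coe _ fun s hs => ?_
  have : (fun a => ν.map (T a) s) = fun a => ν (Prod.mk a ⁻¹' (Function.uncurry T ⁻¹' s)) := by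
    funext a
    rw [Measure.map_apply (f := T a) (hT.comp measurable_prodMk_left) hs]
    rfl
  rw [this]
  exact measurable_measure_prodMk_left (hT hs)

/-! ### Linear Gaussian models by characteristic functions -/

section GaussianJoint

variable {ι : Type*} [Fintype ι]

/-- The bilinear form of a matrix. -/
def quad (S : Matrix ι ι ℝ) (x y : EuclideanSpace ℝ ι) : ℝ := x.ofLp ⬝ᵥ (S *ᵥ y.ofLp)

lemma inner_eq_dotProduct (x y : EuclideanSpace ℝ ι) : inner ℝ x y = x.ofLp ⬝ᵥ y.ofLp := by
  simp [PiLp.inner_apply, dotProduct, mul_comm]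

lemma quad_add_left (S : Matrix ι ι ℝ) (x y z : EuclideanSpace ℝ ι) :
    quad S (x + y) z = quad S x z + quad S y z := by
  simp [quad, add_dotProduct]

lemma quad_add_right (S : Matrix ι ι ℝ) (x y z : EuclideanSpace ℝ ι) :
    quad S x (y + z) = quad S x y + quad S x z := by
  simp [quad, mulVec_add, dotProduct_add]

lemma quad_add (S T : Matrix ι ι ℝ) (x y : EuclideanSpace ℝ ι) :
    quad (S + T) x y = quad S x y + quad T x y := by
  simp [quad, add_mulVec, dotProduct_add]

lemma quad_sub (S T : Matrix ι ι ℝ) (x y : EuclideanSpace ℝ ι) :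
    quad (S - T) x y = quad S x y - quad T x y := by
  simp [quad, sub_mulVec, dotProduct_sub]

variable [DecidableEq ι]

lemma measurable_toEuclideanLin (F : Matrix ι ι ℝ) : Measurable (toEuclideanLin F) :=
  (LinearMap.continuous_of_finiteDimensional _).measurable

lemma multivariateGaussian_eq_map_add (m : EuclideanSpace ℝ ι) (S : Matrix ι ι ℝ) :
    multivariateGaussian m S = (multivariateGaussian 0 S).map fun e => m + e := by
  simp only [multivariateGaussian]
  rw [Measure.map_map (measurable_const_add m) (by fun_prop)]
  congr 1
  funext x
  simp

lemma inner_toEuclideanLin (F : Matrix ι ι ℝ) (x y : EuclideanSpace ℝ ι) :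
    inner ℝ (toEuclideanLin F x) y = inner ℝ x (toEuclideanLin Fᵀ y) := by
  simp only [inner_eq_dotProduct, ofLp_toLpLin, toLin'_apply]
  rw [dotProduct_comm, dotProduct_mulVec, ← mulVec_transpose, dotProduct_comm]

lemma charFun_gaussian {S : Matrix ι ι ℝ} (hS : S.PosSemidef) (m t : EuclideanSpace ℝ ι) :
    ∫ x, Complex.exp ((inner ℝ x t : ℝ) * Complex.I) ∂(multivariateGaussian m S) =
      Complex.exp ((inner ℝ m t : ℝ) * Complex.I - (quad S t t : ℝ) / 2) := by
  rw [← charFun_apply, charFun_multivariateGaussian hS, real_inner_comm]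
  rfl

lemma quad_toEuclideanLin_left (S F : Matrix ι ι ℝ) (x y : EuclideanSpace ℝ ι) :
    quad S (toEuclideanLin Fᵀ x) y = quad (F * S) x y := by
  simp only [quad, ofLp_toLpLin, toLin'_apply]
  rw [← mulVec_mulVec, dotProduct_mulVec x.ofLp F, ← mulVec_transpose]

lemma quad_toEuclideanLin_right (S F : Matrix ι ι ℝ) (x y : EuclideanSpace ℝ ι) :
    quad S x (toEuclideanLin F y) = quad (S * F) x y := by
  simp only [quad, ofLp_toLpLin, toLin'_apply, mulVec_mulVec]

/-- The sum of an affine image of a Gaussian vector and an independent Gaussian vector. -/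
lemma map_affine_add_gaussian {P D : Matrix ι ι ℝ} (hP : P.PosSemidef) (hD : D.PosSemidef)
    (F : Matrix ι ι ℝ) (c m : EuclideanSpace ℝ ι) :
    ((multivariateGaussian m P).prod (multivariateGaussian 0 D)).map
      (fun p => c + toEuclideanLin F p.1 + p.2) =
      multivariateGaussian (c + toEuclideanLin F m) (F * P * Fᵀ + D) := by
  have hm : Measurable fun p : EuclideanSpace ℝ ι × EuclideanSpace ℝ ι =>
      c + toEuclideanLin F p.1 + p.2 :=
    (((measurable_toEuclideanLin F).comp measurable_fst).const_add c).add measurable_snd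
  have hS : (F * P * Fᵀ + D).PosSemidef := by
    have := (hP.mul_mul_conjTranspose_same F).add hD
    simpa using this
  have := Measure.isProbabilityMeasure_map (μ := (multivariateGaussian m P).prod
    (multivariateGaussian 0 D)) hm.aemeasurable
  refine Measure.ext_of_charFun (funext fun t => ?_)
  rw [charFun_multivariateGaussian hS, charFun_apply, integral_map hm.aemeasurable (by fun_prop)]
  have h1 : ∀ p : EuclideanSpace ℝ ι × EuclideanSpace ℝ ι,
      Complex.exp ((inner ℝ (c + toEuclideanLin F p.1 + p.2) t : ℝ) * Complex.I) =
      Complex.exp ((inner ℝ c t : ℝ) * Complex.I) *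
        (Complex.exp ((inner ℝ p.1 (toEuclideanLin Fᵀ t) : ℝ) * Complex.I) *
        Complex.exp ((inner ℝ p.2 t : ℝ) * Complex.I)) := by
    intro p
    rw [inner_add_left, inner_add_left, inner_toEuclideanLin, ← Complex.exp_add, ← Complex.exp_add]
    push_cast
    congr 1; ring
  simp_rw [h1]
  rw [integral_const_mul, integral_prod_mul (f := fun x => Complex.exp
      ((inner ℝ x (toEuclideanLin Fᵀ t) : ℝ) * Complex.I)) (g := fun x => Complex.exp
      ((inner ℝ x t : ℝ) * Complex.I)), charFun_gaussian hP, charFun_gaussian hD,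
    ← Complex.exp_add, ← Complex.exp_add]
  have h2 : t.ofLp ⬝ᵥ (F * P * Fᵀ + D) *ᵥ t.ofLp = quad (F * P * Fᵀ + D) t t := rfl
  rw [h2, quad_add, quad_toEuclideanLin_left, quad_toEuclideanLin_right, inner_add_right,
    real_inner_comm c t, real_inner_comm (toEuclideanLin F m) t, inner_toEuclideanLin,
    inner_zero_left]
  congr 1
  push_cast
  ring

/-- The joint law of a Gaussian vector `x` and `y = F x + e`, disintegrated in both orders. -/
lemma joint_gaussian {P D F G S R : Matrix ι ι ℝ} (hP : P.PosSemidef) (hD : D.PosSemidef)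
    (hS : S.PosSemidef) (hR : R.PosSemidef) (hSe : S = F * P * Fᵀ + D) (hG : G * S = P * Fᵀ)
    (hRe : R = P - G * S * Gᵀ) (m : EuclideanSpace ℝ ι) :
    ((multivariateGaussian m P).prod (multivariateGaussian 0 D)).map
      (fun p => (p.1, toEuclideanLin F p.1 + p.2)) =
    ((multivariateGaussian (toEuclideanLin F m) S).prod (multivariateGaussian 0 R)).map
      (fun p => (m + toEuclideanLin G (p.1 - toEuclideanLin F m) + p.2, p.1)) := by
  have hm1 : Measurable fun p : EuclideanSpace ℝ ι × EuclideanSpace ℝ ι =>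
      (p.1, toEuclideanLin F p.1 + p.2) :=
    measurable_fst.prodMk (((measurable_toEuclideanLin F).comp measurable_fst).add measurable_snd)
  have hm2 : Measurable fun p : EuclideanSpace ℝ ι × EuclideanSpace ℝ ι =>
      (m + toEuclideanLin G (p.1 - toEuclideanLin F m) + p.2, p.1) :=
    ((((measurable_toEuclideanLin G).comp (measurable_fst.sub_const _)).const_add m).add
      measurable_snd).prodMk measurable_fst
  have := Measure.isProbabilityMeasure_map (μ := (multivariateGaussian m P).prod
    (multivariateGaussian 0 D)) hm1.aemeasurable
  have := Measure.isProbabilityMeasure_map (μ := (multivariateGaussian (toEuclideanLin F m) S).prod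
    (multivariateGaussian 0 R)) hm2.aemeasurable
  refine Measure.ext_of_charFunDual (funext fun L => ?_)
  -- By Riesz, a functional on the product is `⟨x, a⟩ + ⟨y, b⟩`.
  set a := (InnerProductSpace.toDual ℝ (EuclideanSpace ℝ ι)).symm
    (L.comp (ContinuousLinearMap.inl ℝ _ _)) with ha
  set b := (InnerProductSpace.toDual ℝ (EuclideanSpace ℝ ι)).symm
    (L.comp (ContinuousLinearMap.inr ℝ _ _)) with hb
  have hL : ∀ x y, L (x, y) = inner ℝ x a + inner ℝ y b := by
    intro x y
    rw [real_inner_comm, real_inner_comm b, ha, hb, InnerProductSpace.toDual_symm_apply,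
      InnerProductSpace.toDual_symm_apply, ContinuousLinearMap.comp_apply,
      ContinuousLinearMap.comp_apply, ContinuousLinearMap.inl_apply, ContinuousLinearMap.inr_apply,
      ← map_add]
    simp
  rw [charFunDual_apply, charFunDual_apply, integral_map hm1.aemeasurable (by fun_prop),
    integral_map hm2.aemeasurable (by fun_prop)]
  simp_rw [hL]
  have h1 : ∀ p : EuclideanSpace ℝ ι × EuclideanSpace ℝ ι,
      Complex.exp (((inner ℝ p.1 a + inner ℝ (toEuclideanLin F p.1 + p.2) b : ℝ) : ℂ) *
        Complex.I) =
      Complex.exp ((inner ℝ p.1 (a + toEuclideanLin Fᵀ b) : ℝ) * Complex.I) *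
        Complex.exp ((inner ℝ p.2 b : ℝ) * Complex.I) := by
    intro p
    rw [inner_add_left, inner_add_right, inner_toEuclideanLin, ← Complex.exp_add]
    push_cast
    congr 1; ring
  have h2 : ∀ p : EuclideanSpace ℝ ι × EuclideanSpace ℝ ι,
      Complex.exp (((inner ℝ (m + toEuclideanLin G (p.1 - toEuclideanLin F m) + p.2) a +
        inner ℝ p.1 b : ℝ) : ℂ) * Complex.I) =
      Complex.exp (((inner ℝ m a - inner ℝ (toEuclideanLin F m) (toEuclideanLin Gᵀ a) : ℝ) : ℂ) *
        Complex.I) *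
      (Complex.exp ((inner ℝ p.1 (toEuclideanLin Gᵀ a + b) : ℝ) * Complex.I) *
        Complex.exp ((inner ℝ p.2 a : ℝ) * Complex.I)) := by
    intro p
    rw [inner_add_left, inner_add_left, inner_add_right, inner_toEuclideanLin, inner_sub_left,
      ← Complex.exp_add, ← Complex.exp_add]
    push_cast
    congr 1; ring
  simp_rw [h1, h2]
  rw [integral_prod_mul (f := fun x => Complex.exp
      ((inner ℝ x (a + toEuclideanLin Fᵀ b) : ℝ) * Complex.I)) (g := fun x => Complex.exp
      ((inner ℝ x b : ℝ) * Complex.I)), integral_const_mul, integral_prod_mul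
      (f := fun x => Complex.exp ((inner ℝ x (toEuclideanLin Gᵀ a + b) : ℝ) * Complex.I))
      (g := fun x => Complex.exp ((inner ℝ x a : ℝ) * Complex.I)), charFun_gaussian hP,
    charFun_gaussian hD, charFun_gaussian hS, charFun_gaussian hR,
    ← Complex.exp_add, ← Complex.exp_add, ← Complex.exp_add]
  congr 1
  have hPt : Pᵀ = P := by simpa [IsHermitian] using hP.isHermitian.eq
  have hSt : Sᵀ = S := by simpa [IsHermitian] using hS.isHermitian.eq
  have hG' : S * Gᵀ = F * P := by
    have := congrArg transpose hG
    simpa [transpose_mul, hPt, hSt] using this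
  -- Both sides are the variance of `⟨x, a⟩ + ⟨y, b⟩`, computed in the two orders. The relations
  -- between `P`, `D`, `S`, `G` and `R` enter only here and in `hG'`.
  have key : quad P (a + toEuclideanLin Fᵀ b) (a + toEuclideanLin Fᵀ b) + quad D b b =
      quad S (toEuclideanLin Gᵀ a + b) (toEuclideanLin Gᵀ a + b) + quad R a a := by
    simp only [quad_add_left, quad_add_right, quad_toEuclideanLin_left, quad_toEuclideanLin_right,
      hG, hG', hRe, quad_sub]
    rw [hSe]
    simp only [quad_add, Matrix.mul_assoc]
    have hGG : G * (F * P) = P * (Fᵀ * Gᵀ) := by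
      rw [← hG', ← Matrix.mul_assoc, hG, Matrix.mul_assoc]
    rw [hGG]
    ring
  have key' : ((quad P (a + toEuclideanLin Fᵀ b) (a + toEuclideanLin Fᵀ b) : ℝ) : ℂ) =
      quad S (toEuclideanLin Gᵀ a + b) (toEuclideanLin Gᵀ a + b) + quad R a a - quad D b b := by
    rw [eq_sub_iff_add_eq]; exact_mod_cast key
  rw [key', inner_add_right, inner_add_right, inner_zero_left, inner_zero_left,
    inner_toEuclideanLin F m b]
  push_cast
  ring

end GaussianJoint

/-! ### Prediction and backward smoothing of the kinematic state -/

section Kinematics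

variable {s d : ℕ}

lemma lintegral_map_prod {α β γ : Type*} [MeasurableSpace α] [MeasurableSpace β]
    [MeasurableSpace γ] {μ : Measure α} {ν : Measure β} [SFinite ν] {T : α × β → γ}
    (hT : Measurable T) {f : γ → ℝ≥0∞} (hf : Measurable f) :
    ∫⁻ z, f z ∂((μ.prod ν).map T) = ∫⁻ a, ∫⁻ b, f (T (a, b)) ∂ν ∂μ := by
  rw [lintegral_map hf hT]
  exact lintegral_prod _ (hf.comp hT).aemeasurable

lemma sub_kronecker {l m n p : Type*} (A B : Matrix l m ℝ) (C : Matrix n p ℝ) :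
    (A - B) ⊗ₖ C = A ⊗ₖ C - B ⊗ₖ C := by
  ext
  simp [kroneckerMap_apply, sub_mul]

lemma kron_one_conj (F P : Matrix (Fin s) (Fin s) ℝ) (X : Matrix (Fin d) (Fin d) ℝ) :
    (F ⊗ₖ (1 : Matrix (Fin d) (Fin d) ℝ)) * (P ⊗ₖ X) * (F ⊗ₖ (1 : Matrix (Fin d) (Fin d) ℝ))ᵀ =
      (F * P * Fᵀ) ⊗ₖ X := by
  rw [← mul_kronecker_mul, ← kroneckerMap_transpose, ← mul_kronecker_mul]
  simp

/-- The mean and the covariances of the coordinates recover the parameters, also for singular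
covariance. -/
lemma multivariateGaussian_inj {ι : Type*} [Fintype ι] [DecidableEq ι] {m₁ m₂ : EuclideanSpace ℝ ι}
    {S₁ S₂ : Matrix ι ι ℝ} (h₁ : S₁.PosSemidef) (h₂ : S₂.PosSemidef)
    (h : multivariateGaussian m₁ S₁ = multivariateGaussian m₂ S₂) : m₁ = m₂ ∧ S₁ = S₂ := by
  constructor
  · rw [← integral_id_multivariateGaussian (μ := m₁) (S := S₁), h,
      integral_id_multivariateGaussian]
  · ext i j
    rw [← covariance_eval_multivariateGaussian (μ := m₁) h₁, h,
      covariance_eval_multivariateGaussian h₂]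

lemma measurable_kinTransition (F D : Matrix (Fin s) (Fin s) ℝ) (X : Matrix (Fin d) (Fin d) ℝ) :
    Measurable fun x => kinTransition F D x X := by
  have : (fun x => kinTransition F D x X) = fun x => (multivariateGaussian 0 (D ⊗ₖ X)).map
      fun e => toEuclideanLin (F ⊗ₖ (1 : Matrix (Fin d) (Fin d) ℝ)) x + e := by
    funext x
    rw [kinTransition, multivariateGaussian_eq_map_add]
  rw [this]
  exact measurable_map_param _
    (((measurable_toEuclideanLin _).comp measurable_fst).add measurable_snd)

lemma lintegral_kinTransition (F D : Matrix (Fin s) (Fin s) ℝ) (X : Matrix (Fin d) (Fin d) ℝ)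
    (x : Kin s d) {f : Kin s d → ℝ≥0∞} (hf : Measurable f) :
    ∫⁻ y, f y ∂(kinTransition F D x X) =
      ∫⁻ e, f (toEuclideanLin (F ⊗ₖ (1 : Matrix (Fin d) (Fin d) ℝ)) x + e)
        ∂(multivariateGaussian 0 (D ⊗ₖ X)) := by
  rw [kinTransition, multivariateGaussian_eq_map_add, lintegral_map hf (measurable_const_add _)]

/-- The prediction of the kinematic parameters. -/
lemma chapmanKolmogorov_gaussian {F D P : Matrix (Fin s) (Fin s) ℝ} (hP : P.PosSemidef)
    (hD : D.PosSemidef) (m : Kin s d) {X : Matrix (Fin d) (Fin d) ℝ} (hX : X.PosDef) :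
    (multivariateGaussian m (P ⊗ₖ X)).bind (fun x => kinTransition F D x X) =
      multivariateGaussian (toEuclideanLin (F ⊗ₖ (1 : Matrix (Fin d) (Fin d) ℝ)) m)
        ((F * P * Fᵀ + D) ⊗ₖ X) := by
  have h := map_affine_add_gaussian (hP.kronecker hX.posSemidef) (hD.kronecker hX.posSemidef)
    (F ⊗ₖ (1 : Matrix (Fin d) (Fin d) ℝ)) 0 m
  rw [kron_one_conj, ← add_kronecker, zero_add] at h
  rw [← h]
  have hm : Measurable fun p : Kin s d × Kin s d =>
      (0 : Kin s d) + toEuclideanLin (F ⊗ₖ (1 : Matrix (Fin d) (Fin d) ℝ)) p.1 + p.2 :=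
    (((measurable_toEuclideanLin _).comp measurable_fst).const_add _).add measurable_snd
  refine Measure.ext_of_lintegral _ fun f hf => ?_
  rw [Measure.lintegral_bind (measurable_kinTransition F D X).aemeasurable hf.aemeasurable,
    lintegral_map_prod hm hf]
  refine lintegral_congr fun x => ?_
  simp only [lintegral_kinTransition F D X x hf, zero_add]

/-- The prediction identity at `X = 1` already suffices: fixing one spatial index in `P' ⊗ 1`
returns the entries of `P'`. Such an index exists because `0 < d`. -/
lemma predicted_kinematics (hd : 0 < d) {F D P P' : Matrix (Fin s) (Fin s) ℝ}
    (hP : P.PosSemidef) (hP' : P'.PosSemidef)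
    (hD : D.PosSemidef) {m m' : Kin s d}
    (hCK : ∀ X : Matrix (Fin d) (Fin d) ℝ, X.PosDef → multivariateGaussian m' (P' ⊗ₖ X) =
        (multivariateGaussian m (P ⊗ₖ X)).bind (fun x => kinTransition F D x X)) :
    m' = toEuclideanLin (F ⊗ₖ (1 : Matrix (Fin d) (Fin d) ℝ)) m ∧ P' = F * P * Fᵀ + D := by
  have h := hCK 1 PosDef.one
  rw [chapmanKolmogorov_gaussian hP hD m PosDef.one] at h
  have hS : (F * P * Fᵀ + D).PosSemidef := by
    simpa using (hP.mul_mul_conjTranspose_same F).add hD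
  obtain ⟨h1, h2⟩ := multivariateGaussian_inj (hP'.kronecker PosSemidef.one)
    (hS.kronecker PosSemidef.one) h
  refine ⟨h1, ?_⟩
  ext i j
  simpa using congrFun (congrFun h2 (i, ⟨0, hd⟩)) (j, ⟨0, hd⟩)

/-- The smoothed covariance is a positive semidefinite residual plus the propagated one. -/
lemma residual_covariance {F D P S G : Matrix (Fin s) (Fin s) ℝ} (hP : P.PosSemidef)
    (hD : D.PosSemidef) (hS : S.PosDef) (hSe : S = F * P * Fᵀ + D) (hG : G = P * Fᵀ * S⁻¹) :
    G * S = P * Fᵀ ∧ (P - G * S * Gᵀ).PosSemidef := by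
  have hGS : G * S = P * Fᵀ := by
    rw [hG, Matrix.mul_assoc, nonsing_inv_mul _ (isUnit_iff_ne_zero.2 hS.det_pos.ne'),
      Matrix.mul_one]
  have hPt : Pᵀ = P := by simpa [IsHermitian] using hP.isHermitian.eq
  have hSt : Sᵀ = S := by simpa [IsHermitian] using hS.isHermitian.eq
  have hG' : S * Gᵀ = F * P := by
    have := congrArg transpose hGS
    simpa [transpose_mul, hPt, hSt] using this
  refine ⟨hGS, ?_⟩
  -- The residual is `x - G y = (1 - G F) x - G e` up to its mean; writing its covariance in terms
  -- of `P` and `D` shows that it is positive semidefinite.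
  have h1 : P - G * S * Gᵀ = (1 - G * F) * P * (1 - G * F)ᵀ + G * D * Gᵀ := by
    have hDe : D = S - F * P * Fᵀ := by rw [hSe]; abel
    have h2 : G * S * Gᵀ = G * F * P := by rw [Matrix.mul_assoc, hG', Matrix.mul_assoc]
    have h3 : G * F * P = P * (Fᵀ * Gᵀ) := by rw [← h2, hGS, Matrix.mul_assoc]
    rw [hDe]
    simp only [transpose_sub, transpose_one, transpose_mul, Matrix.mul_sub, Matrix.sub_mul,
      Matrix.mul_one, Matrix.one_mul]
    rw [h2, ← h3]
    simp only [Matrix.mul_assoc]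
    abel
  rw [h1]
  have := (hP.mul_mul_conjTranspose_same (1 - G * F)).add (hD.mul_mul_conjTranspose_same G)
  simpa using this

/-- Conditionally on the extent, the backward step maps the filtered kinematic law to the smoothed
one. -/
lemma kinematic_smoothing {F D G : Matrix (Fin s) (Fin s) ℝ} (hD : D.PosSemidef)
    {filt pred next : GIWParam s d} (hfilt : filt.P.PosSemidef) (hpred : pred.P.PosDef)
    (hnext : next.P.PosDef)
    (hm : pred.m = toEuclideanLin (F ⊗ₖ (1 : Matrix (Fin d) (Fin d) ℝ)) filt.m)
    (hP : pred.P = F * filt.P * Fᵀ + D) (hG : G = filt.P * Fᵀ * pred.P⁻¹)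
    {X : Matrix (Fin d) (Fin d) ℝ} (hX : X.PosDef) :
    (multivariateGaussian filt.m (filt.P ⊗ₖ X)).withDensity
      (fun x => kinFactor F D pred next x X) =
    multivariateGaussian
      (filt.m + toEuclideanLin (G ⊗ₖ (1 : Matrix (Fin d) (Fin d) ℝ)) (next.m - pred.m))
      ((filt.P - G * (pred.P - next.P) * Gᵀ) ⊗ₖ X) := by
  obtain ⟨hGS, hR⟩ := residual_covariance hfilt hD hpred hP hG
  set F' := F ⊗ₖ (1 : Matrix (Fin d) (Fin d) ℝ)
  set G' := G ⊗ₖ (1 : Matrix (Fin d) (Fin d) ℝ)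
  have hXs := hX.posSemidef
  have hjoint := joint_gaussian (P := filt.P ⊗ₖ X) (D := D ⊗ₖ X) (F := F') (G := G')
    (S := pred.P ⊗ₖ X) (R := (filt.P - G * pred.P * Gᵀ) ⊗ₖ X) (hfilt.kronecker hXs)
    (hD.kronecker hXs) (hpred.posSemidef.kronecker hXs) (hR.kronecker hXs)
    (by rw [kron_one_conj, ← add_kronecker, hP])
    (by rw [← kroneckerMap_transpose, ← mul_kronecker_mul, ← mul_kronecker_mul, hGS]; simp)
    (by rw [kron_one_conj, ← sub_kronecker]) filt.m
  rw [← hm] at hjoint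
  -- The backward representation of `x`, with `y` now drawn from the next smoothed law.
  have hsm := map_affine_add_gaussian (hnext.posSemidef.kronecker hXs) (hR.kronecker hXs) G'
    (filt.m - toEuclideanLin G' pred.m) next.m
  rw [kron_one_conj, ← add_kronecker] at hsm
  have e1 : filt.m - toEuclideanLin G' pred.m + toEuclideanLin G' next.m =
      filt.m + toEuclideanLin G' (next.m - pred.m) := by rw [map_sub]; abel
  have e2 : G * next.P * Gᵀ + (filt.P - G * pred.P * Gᵀ) =
      filt.P - G * (pred.P - next.P) * Gᵀ := by
    rw [Matrix.mul_sub, Matrix.sub_mul]; abel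
  rw [e1, e2] at hsm
  rw [← hsm]
  set r : Kin s d → ℝ≥0∞ := fun y =>
    ENNReal.ofReal (normalPDF next.m (next.P ⊗ₖ X) y / normalPDF pred.m (pred.P ⊗ₖ X) y) with hr
  have hrm : Measurable r :=
    ((measurable_normalPDF _ _).div (measurable_normalPDF _ _)).ennreal_ofReal
  have hk : ∀ x, kinFactor F D pred next x X =
      ∫⁻ e, r (toEuclideanLin F' x + e) ∂(multivariateGaussian 0 (D ⊗ₖ X)) := fun x =>
    lintegral_kinTransition F D X x hrm
  have hFm : Measurable fun p : Kin s d × Kin s d => toEuclideanLin F' p.1 + p.2 :=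
    ((measurable_toEuclideanLin _).comp measurable_fst).add measurable_snd
  have hkm : Measurable fun x => kinFactor F D pred next x X := by
    simp_rw [hk]
    exact Measurable.lintegral_prod_right' (hrm.comp hFm)
  have hGm : Measurable fun p : Kin s d × Kin s d =>
      filt.m + toEuclideanLin G' (p.1 - pred.m) + p.2 :=
    (((measurable_toEuclideanLin _).comp (measurable_fst.sub_const _)).const_add _).add
      measurable_snd
  have hGm' : Measurable fun p : Kin s d × Kin s d =>
      filt.m - toEuclideanLin G' pred.m + toEuclideanLin G' p.1 + p.2 :=
    (((measurable_toEuclideanLin _).comp measurable_fst).const_add _).add measurable_snd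
  refine Measure.ext_of_lintegral _ fun f hf => ?_
  have hg : Measurable fun p : Kin s d × Kin s d => r p.2 * f p.1 :=
    (hrm.comp measurable_snd).mul (hf.comp measurable_fst)
  have hh : Measurable fun y => ∫⁻ e, f (filt.m + toEuclideanLin G' (y - pred.m) + e)
      ∂(multivariateGaussian 0 ((filt.P - G * pred.P * Gᵀ) ⊗ₖ X)) :=
    Measurable.lintegral_prod_right' (hf.comp hGm)
  -- The ratio `r` is a function of `y` only. Once the joint law is disintegrated with `y` first,
  -- `r` turns the predicted law of `y` into the smoothed one and leaves the residual untouched.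
  calc _ = ∫⁻ x, ∫⁻ e, r (toEuclideanLin F' x + e) * f x ∂(multivariateGaussian 0 (D ⊗ₖ X))
        ∂(multivariateGaussian filt.m (filt.P ⊗ₖ X)) := by
        rw [lintegral_withDensity_eq_lintegral_mul _ hkm hf]
        refine lintegral_congr fun x => ?_
        rw [Pi.mul_apply, hk, ← lintegral_mul_const _ (f := fun e => r (toEuclideanLin F' x + e))
          (hrm.comp (measurable_const_add _))]
    _ = ∫⁻ p, r p.2 * f p.1 ∂(((multivariateGaussian filt.m (filt.P ⊗ₖ X)).prod
          (multivariateGaussian 0 (D ⊗ₖ X))).map fun p => (p.1, toEuclideanLin F' p.1 + p.2)) := by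
        rw [lintegral_map_prod (measurable_fst.prodMk hFm) hg]
    _ = ∫⁻ y, r y * ∫⁻ e, f (filt.m + toEuclideanLin G' (y - pred.m) + e)
          ∂(multivariateGaussian 0 ((filt.P - G * pred.P * Gᵀ) ⊗ₖ X))
          ∂(multivariateGaussian pred.m (pred.P ⊗ₖ X)) := by
        rw [hjoint, lintegral_map_prod (hGm.prodMk measurable_fst) hg]
        refine lintegral_congr fun y => ?_
        exact lintegral_const_mul (r y)
          (f := fun e => f (filt.m + toEuclideanLin G' (y - pred.m) + e))
          (hf.comp (measurable_const_add _))
    _ = ∫⁻ y, ∫⁻ e, f (filt.m + toEuclideanLin G' (y - pred.m) + e)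
          ∂(multivariateGaussian 0 ((filt.P - G * pred.P * Gᵀ) ⊗ₖ X))
          ∂(multivariateGaussian next.m (next.P ⊗ₖ X)) := by
        rw [← multivariateGaussian_withDensity_ratio pred.m next.m (hpred.kronecker hX)
          (hnext.kronecker hX), lintegral_withDensity_eq_lintegral_mul _ hrm hh]
        rfl
    _ = _ := by
        rw [lintegral_map_prod hGm' hf]
        refine lintegral_congr fun y => lintegral_congr fun e => ?_
        congr 1
        rw [map_sub]; abel

end Kinematics

/-! ### Removing the first row and column by Schur complements -/

section SchurRecursion

variable {d : ℕ}

/-- The symmetric matrix obtained from `Z` by adding a first row and column. -/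
def bordered (x : ℝ) (y : Fin d → ℝ) (Z : Matrix (Fin d) (Fin d) ℝ) :
    Matrix (Fin (d + 1)) (Fin (d + 1)) ℝ :=
  Matrix.of fun i j => Fin.cases (Fin.cases x y j)
    (fun i' => Fin.cases (y i') (fun j' => Z i' j') j) i

@[simp] lemma bordered_zero_zero (x : ℝ) (y : Fin d → ℝ) (Z : Matrix (Fin d) (Fin d) ℝ) :
    bordered x y Z 0 0 = x := rfl

@[simp] lemma bordered_zero_succ (x : ℝ) (y : Fin d → ℝ) (Z : Matrix (Fin d) (Fin d) ℝ)
    (j : Fin d) : bordered x y Z 0 j.succ = y j := rfl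

@[simp] lemma bordered_succ_zero (x : ℝ) (y : Fin d → ℝ) (Z : Matrix (Fin d) (Fin d) ℝ)
    (i : Fin d) : bordered x y Z i.succ 0 = y i := rfl

@[simp] lemma bordered_succ_succ (x : ℝ) (y : Fin d → ℝ) (Z : Matrix (Fin d) (Fin d) ℝ)
    (i j : Fin d) : bordered x y Z i.succ j.succ = Z i j := rfl

lemma bordered_submatrix (x : ℝ) (y : Fin d → ℝ) (Z : Matrix (Fin d) (Fin d) ℝ) :
    (bordered x y Z).submatrix Fin.succ Fin.succ = Z := rfl

lemma trace_bordered (x : ℝ) (y : Fin d → ℝ) (Z : Matrix (Fin d) (Fin d) ℝ) :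
    (bordered x y Z).trace = x + Z.trace := by
  simp [Matrix.trace, Fin.sum_univ_succ]

/-- The splitting of the index set of `Fin (d + 1)`. -/
def borderEquiv (d : ℕ) : Fin (d + 1) ≃ Unit ⊕ Fin d :=
  (finSuccEquiv d).trans ((Equiv.optionEquivSumPUnit (Fin d)).trans (Equiv.sumComm _ _))

lemma bordered_eq_submatrix (x : ℝ) (y : Fin d → ℝ) (Z : Matrix (Fin d) (Fin d) ℝ) :
    bordered x y Z = (fromBlocks (Matrix.of fun _ _ : Unit => x) (Matrix.of fun _ j => y j)
      (Matrix.of fun i _ => y i) Z).submatrix (borderEquiv d) (borderEquiv d) := by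
  ext i j
  refine Fin.cases ?_ (fun i' => ?_) i <;> refine Fin.cases ?_ (fun j' => ?_) j <;>
    simp only [borderEquiv, bordered, submatrix_apply, Equiv.trans_apply, finSuccEquiv_zero,
      finSuccEquiv_succ, Equiv.optionEquivSumPUnit_none, Equiv.optionEquivSumPUnit_some,
      Equiv.sumComm_apply, Sum.swap_inl, Sum.swap_inr] <;> rfl

lemma det_bordered (x : ℝ) (y : Fin d → ℝ) {Z : Matrix (Fin d) (Fin d) ℝ} (hZ : Z.PosDef) :
    (bordered x y Z).det = Z.det * (x - y ⬝ᵥ (Z⁻¹ *ᵥ y)) := by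
  have hdet : IsUnit Z.det := isUnit_iff_ne_zero.2 hZ.det_pos.ne'
  let _ := Z.invertibleOfIsUnitDet hdet
  rw [bordered_eq_submatrix, det_submatrix_equiv_self, det_fromBlocks₂₂,
    det_unique (n := Unit)]
  congr 1
  simp [Matrix.mul_apply, dotProduct, mulVec, invOf_eq_nonsing_inv, Finset.sum_mul,
    Finset.mul_sum]
  rw [Finset.sum_comm]
  simp only [mul_assoc]

/-- Positivity is that of `Z` together with that of its Schur complement. Conversely, the block
criterion yields semidefiniteness, and the nonzero determinant makes it definite. -/
lemma posDef_bordered_iff (x : ℝ) (y : Fin d → ℝ) (Z : Matrix (Fin d) (Fin d) ℝ) :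
    (bordered x y Z).PosDef ↔ Z.PosDef ∧ y ⬝ᵥ (Z⁻¹ *ᵥ y) < x := by
  constructor
  · intro h
    have hZ : Z.PosDef := by
      rw [← bordered_submatrix x y Z]
      exact h.submatrix (Fin.succ_injective d)
    refine ⟨hZ, ?_⟩
    have := h.det_pos
    rw [det_bordered x y hZ] at this
    linarith [(mul_pos_iff_of_pos_left hZ.det_pos).1 this]
  · rintro ⟨hZ, hx⟩
    have hdet : IsUnit Z.det := isUnit_iff_ne_zero.2 hZ.det_pos.ne'
    let _ := Z.invertibleOfIsUnitDet hdet
    refine PosSemidef.posDef_iff_det_ne_zero ?_ |>.2 ?_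
    · rw [bordered_eq_submatrix]
      refine PosSemidef.submatrix ?_ _
      have h2 := PosDef.fromBlocks₂₂ (Matrix.of fun _ _ : Unit => x)
        (Matrix.of fun (_ : Unit) j => y j) hZ
      have h3 : (Matrix.of fun (_ : Unit) j => y j : Matrix Unit (Fin d) ℝ)ᴴ =
          Matrix.of fun i _ => y i := by
        ext; simp
      rw [h3] at h2
      rw [h2]
      have h4 : ((Matrix.of fun _ _ : Unit => x) - (Matrix.of fun (_ : Unit) j => y j) * Z⁻¹ *
          (Matrix.of fun i _ => y i)) =
          diagonal fun _ : Unit => x - y ⬝ᵥ (Z⁻¹ *ᵥ y) := by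
        ext
        simp [Matrix.mul_apply, dotProduct, mulVec, Finset.sum_mul, Finset.mul_sum]
        rw [Finset.sum_comm]
        simp only [mul_assoc]
      rw [h4]
      exact PosSemidef.diagonal fun _ => by simpa using hx.le
    · rw [det_bordered x y hZ]
      exact mul_ne_zero hZ.det_pos.ne' (by linarith)

/-- By the cofactor formula the entry is `det Z` divided by the full determinant, that is, the
reciprocal of the Schur complement. -/
lemma inv_bordered_zero_zero (x : ℝ) (y : Fin d → ℝ) {Z : Matrix (Fin d) (Fin d) ℝ}
    (hZ : Z.PosDef) : (bordered x y Z)⁻¹ 0 0 = (x - y ⬝ᵥ (Z⁻¹ *ᵥ y))⁻¹ := by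
  rw [Matrix.inv_def, Matrix.smul_apply, adjugate_fin_succ_eq_det_submatrix]
  have : (bordered x y Z).submatrix (Fin.succAbove 0) (Fin.succAbove 0) = Z := by
    simp only [Fin.succAbove_zero, bordered_submatrix]
  rw [this, det_bordered x y hZ]
  simp [hZ.det_pos.ne']

/-- Coordinates of a bordered symmetric matrix. -/
def borderUpper (p : (UpperIdx d → ℝ) × ((Fin d → ℝ) × ℝ)) : UpperIdx (d + 1) → ℝ :=
  upperPart (bordered p.2.2 p.2.1 (symOfUpper d p.1))

lemma symOfUpper_borderUpper (p : (UpperIdx d → ℝ) × ((Fin d → ℝ) × ℝ)) :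
    symOfUpper (d + 1) (borderUpper p) = bordered p.2.2 p.2.1 (symOfUpper d p.1) := by
  refine symOfUpper_upperPart ?_
  ext i j
  refine Fin.cases ?_ (fun i' => ?_) i <;> refine Fin.cases ?_ (fun j' => ?_) j <;>
    simp [(isSymm_symOfUpper p.1).apply]

lemma measurable_bordered : Measurable fun p : Matrix (Fin d) (Fin d) ℝ × ((Fin d → ℝ) × ℝ) =>
    bordered p.2.2 p.2.1 p.1 := by
  refine measurable_matrix_iff.2 fun i j => ?_
  refine Fin.cases ?_ (fun i' => ?_) i <;> refine Fin.cases ?_ (fun j' => ?_) j <;>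
    simp only [bordered_zero_zero, bordered_zero_succ, bordered_succ_zero, bordered_succ_succ]
  · exact measurable_snd.snd
  · exact (measurable_pi_apply j').comp measurable_snd.fst
  · exact (measurable_pi_apply i').comp measurable_snd.fst
  · exact (measurable_entry i' j').comp measurable_fst

/-- The index set above the diagonal, split into the first row and the rest. -/
def upperIdxSucc (d : ℕ) : UpperIdx d ⊕ (Fin d ⊕ Unit) → UpperIdx (d + 1)
  | .inl p => ⟨(p.1.1.succ, p.1.2.succ), Fin.succ_le_succ_iff.2 p.2⟩
  | .inr (.inl j) => ⟨(0, j.succ), Fin.zero_le _⟩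
  | .inr (.inr _) => ⟨(0, 0), le_rfl⟩

lemma upperIdxSucc_bijective (d : ℕ) : Function.Bijective (upperIdxSucc d) := by
  constructor
  · rintro (p | j | _) (q | k | _) h <;> simp_all [upperIdxSucc, Fin.ext_iff]
    exact Subtype.ext (Prod.ext (Fin.ext h.1) (Fin.ext h.2))
  · rintro ⟨⟨i, j⟩, hij⟩
    revert hij
    refine Fin.cases ?_ (fun i' => ?_) i <;> refine Fin.cases ?_ (fun j' => ?_) j <;> intro hij
    · exact ⟨.inr (.inr ()), rfl⟩
    · exact ⟨.inr (.inl j'), rfl⟩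
    · exact absurd hij (by simp)
    · exact ⟨.inl ⟨(i', j'), Fin.succ_le_succ_iff.1 hij⟩, rfl⟩

/-- Bordering only relabels the free coordinates along `upperIdxSucc`, so boxes keep their volume.
-/
lemma measurePreserving_borderUpper : MeasurePreserving (borderUpper (d := d)) := by
  have hm : Measurable (borderUpper (d := d)) :=
    measurable_upperPart.comp (measurable_bordered.comp
      ((measurable_symOfUpper.comp measurable_fst).prodMk measurable_snd))
  refine ⟨hm, (Measure.pi_eq fun s hs => ?_).symm⟩
  have hval : ∀ p : (UpperIdx d → ℝ) × ((Fin d → ℝ) × ℝ), ∀ k,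
      borderUpper p (upperIdxSucc d k) = Sum.elim p.1 (Sum.elim p.2.1 fun _ => p.2.2) k := by
    rintro p (q | j | _)
    · exact congrFun (upperPart_symOfUpper p.1) q
    · rfl
    · rfl
  have hpre : borderUpper ⁻¹' (Set.univ.pi s) =
      (Set.univ.pi fun q => s (upperIdxSucc d (.inl q))) ×ˢ
        ((Set.univ.pi fun j => s (upperIdxSucc d (.inr (.inl j)))) ×ˢ
          s (upperIdxSucc d (.inr (.inr ())))) := by
    ext p
    simp only [Set.mem_preimage, Set.mem_pi, Set.mem_univ, forall_true_left, Set.mem_prod]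
    rw [(upperIdxSucc_bijective d).surjective.forall]
    simp only [hval, Sum.forall, Sum.elim_inl, Sum.elim_inr]
    exact and_congr_right fun _ => and_congr_right fun _ => ⟨fun h => h (), fun h _ => h⟩
  rw [Measure.map_apply hm (MeasurableSet.univ_pi hs), hpre, Measure.volume_eq_prod,
    Measure.prod_prod, Measure.volume_eq_prod, Measure.prod_prod, volume_pi, volume_pi,
    Measure.pi_pi, Measure.pi_pi,
    ← (upperIdxSucc_bijective d).prod_comp fun i => volume (s i)]
  simp [Fintype.prod_sum_type]

/-- Integration over positive definite matrices of size `d + 1` by Schur complements. -/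
lemma lintegral_spdVolume_succ {f : Matrix (Fin (d + 1)) (Fin (d + 1)) ℝ → ℝ≥0∞}
    (hf : Measurable f) :
    ∫⁻ X, f X ∂(spdVolume (d + 1)) =
      ∫⁻ Z, (∫⁻ y : Fin d → ℝ, ∫⁻ u in Set.Ioi (0 : ℝ),
        f (bordered (u + y ⬝ᵥ (Z⁻¹ *ᵥ y)) y Z)) ∂(spdVolume d) := by
  have hq : Measurable fun p : Matrix (Fin d) (Fin d) ℝ × (Fin d → ℝ) =>
      p.2 ⬝ᵥ (p.1⁻¹ *ᵥ p.2) := by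
    simp only [dotProduct, mulVec]
    refine Finset.measurable_sum _ fun i _ => ((measurable_pi_apply i).comp measurable_snd).mul
      (Finset.measurable_sum _ fun j _ => Measurable.mul ?_
        ((measurable_pi_apply j).comp measurable_snd))
    exact (measurable_entry i j).comp (measurable_inv.comp measurable_fst)
  have hb : Measurable fun p : (Matrix (Fin d) (Fin d) ℝ × (Fin d → ℝ)) × ℝ =>
      f (bordered (p.2 + p.1.2 ⬝ᵥ (p.1.1⁻¹ *ᵥ p.1.2)) p.1.2 p.1.1) :=
    hf.comp (measurable_bordered.comp (measurable_fst.fst.prodMk (measurable_fst.snd.prodMk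
      (measurable_snd.add (hq.comp measurable_fst)))))
  have hm : Measurable fun Z : Matrix (Fin d) (Fin d) ℝ => ∫⁻ y : Fin d → ℝ,
      ∫⁻ u in Set.Ioi (0 : ℝ), f (bordered (u + y ⬝ᵥ (Z⁻¹ *ᵥ y)) y Z) :=
    Measurable.lintegral_prod_right' (f := fun p : Matrix (Fin d) (Fin d) ℝ × (Fin d → ℝ) =>
      ∫⁻ u in Set.Ioi (0 : ℝ), f (bordered (u + p.2 ⬝ᵥ (p.1⁻¹ *ᵥ p.2)) p.2 p.1))
      (Measurable.lintegral_prod_right' hb)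
  have hfs : Measurable ((upperCone (d + 1)).indicator fun u => f (symOfUpper (d + 1) u)) :=
    (hf.comp measurable_symOfUpper).indicator measurableSet_upperCone
  have hg : Measurable fun p : (UpperIdx d → ℝ) × ((Fin d → ℝ) × ℝ) =>
      (upperCone (d + 1)).indicator (fun u => f (symOfUpper (d + 1) u)) (borderUpper p) :=
    hfs.comp measurePreserving_borderUpper.measurable
  have hgz : ∀ z, Measurable fun q : (Fin d → ℝ) × ℝ =>
      (upperCone (d + 1)).indicator (fun u => f (symOfUpper (d + 1) u)) (borderUpper (z, q)) :=
    fun z => hg.comp measurable_prodMk_left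
  rw [lintegral_spdVolume hf, lintegral_spdVolume hm,
    ← lintegral_indicator measurableSet_upperCone, ← lintegral_indicator measurableSet_upperCone,
    ← measurePreserving_borderUpper.lintegral_comp hfs, Measure.volume_eq_prod,
    lintegral_prod _ hg.aemeasurable]
  refine lintegral_congr fun z => ?_
  rw [Measure.volume_eq_prod, lintegral_prod _ (hgz z).aemeasurable]
  have hmem : ∀ y x, borderUpper (z, (y, x)) ∈ upperCone (d + 1) ↔
      z ∈ upperCone d ∧ y ⬝ᵥ ((symOfUpper d z)⁻¹ *ᵥ y) < x := fun y x => by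
    simp only [upperCone, Set.mem_ofPred_eq, symOfUpper_borderUpper]
    exact posDef_bordered_iff _ _ _
  by_cases hz : z ∈ upperCone d
  · rw [Set.indicator_of_mem hz]
    refine lintegral_congr fun y => ?_
    -- Translating the corner entry by `q` makes the Schur complement the new variable `u`, and the
    -- cone condition becomes `0 < u`.
    set q := y ⬝ᵥ ((symOfUpper d z)⁻¹ *ᵥ y)
    rw [← lintegral_indicator measurableSet_Ioi,
      ← lintegral_add_right_eq_self (fun x => (upperCone (d + 1)).indicator
        (fun u => f (symOfUpper (d + 1) u)) (borderUpper (z, (y, x)))) q]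
    refine lintegral_congr fun u => ?_
    by_cases hu : 0 < u
    · rw [Set.indicator_of_mem ((hmem _ _).2 ⟨hz, by linarith⟩),
        Set.indicator_of_mem (Set.mem_Ioi.2 hu), symOfUpper_borderUpper]
    · rw [Set.indicator_of_notMem fun h => hu (by linarith [((hmem _ _).1 h).2]),
        Set.indicator_of_notMem (by simpa using hu)]
  · rw [Set.indicator_of_notMem hz]
    have h0 : ∀ y x, (upperCone (d + 1)).indicator (fun u => f (symOfUpper (d + 1) u))
        (borderUpper (z, (y, x))) = 0 := fun y x =>
      Set.indicator_of_notMem (fun h => hz ((hmem _ _).1 h).1) _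
    simp only [h0, lintegral_zero]

end SchurRecursion

/-! ### The multivariate gamma integral and two of its diagonal moments -/

section MultivariateGamma

variable {d : ℕ}

/-- The integrand of the multivariate gamma function. -/
def gammaDensity (d : ℕ) (a : ℝ) (X : Matrix (Fin d) (Fin d) ℝ) : ℝ :=
  X.det ^ (a - ((d : ℝ) + 1) / 2) * Real.exp (-X.trace)

lemma measurable_gammaDensity (a : ℝ) : Measurable (gammaDensity d a) :=
  (measurable_det.pow_const _).mul (measurable_trace.neg.exp)

lemma gammaDensity_pos (a : ℝ) {X : Matrix (Fin d) (Fin d) ℝ} (hX : X.PosDef) :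
    0 < gammaDensity d a X := by
  have := hX.det_pos
  unfold gammaDensity; positivity

/-- The determinant is `u det Z` and the trace is `u + yᵀ Z⁻¹ y + tr Z`, so the weight splits into a
gamma, a Gaussian and a matrix factor. The power of `det Z` is `1/2` short of the one in
`gammaDensity d a`. -/
lemma gammaDensity_bordered (a : ℝ) {u : ℝ} (hu : 0 < u) (y : Fin d → ℝ)
    {Z : Matrix (Fin d) (Fin d) ℝ} (hZ : Z.PosDef) :
    gammaDensity (d + 1) a (bordered (u + y ⬝ᵥ (Z⁻¹ *ᵥ y)) y Z) =
      (u ^ (a - ((d : ℝ) + 2) / 2) * Real.exp (-u)) * (Real.exp (-(y ⬝ᵥ (Z⁻¹ *ᵥ y))) *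
        (Z.det ^ (a - ((d : ℝ) + 2) / 2) * Real.exp (-Z.trace))) := by
  have h1 : a - (((d + 1 : ℕ) : ℝ) + 1) / 2 = a - ((d : ℝ) + 2) / 2 := by push_cast; ring
  rw [gammaDensity, h1, det_bordered _ _ hZ, trace_bordered, add_sub_cancel_right,
    Real.mul_rpow hZ.det_pos.le hu.le, neg_add, neg_add, Real.exp_add, Real.exp_add]
  ring

/-- Reduction of a weighted gamma integral by one dimension. -/
lemma lintegral_gammaDensity_succ (a : ℝ) {k : Matrix (Fin (d + 1)) (Fin (d + 1)) ℝ → ℝ≥0∞}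
    (hk : Measurable k) {h : ℝ → ℝ≥0∞} (hh : Measurable h)
    {g : Matrix (Fin d) (Fin d) ℝ → ℝ≥0∞} (hg : Measurable g)
    (hkgh : ∀ u, 0 < u → ∀ (y : Fin d → ℝ) (Z : Matrix (Fin d) (Fin d) ℝ), Z.PosDef →
      k (bordered (u + y ⬝ᵥ (Z⁻¹ *ᵥ y)) y Z) = h u * g Z) :
    ∫⁻ X, k X * ENNReal.ofReal (gammaDensity (d + 1) a X) ∂(spdVolume (d + 1)) =
      (∫⁻ u in Set.Ioi (0 : ℝ), h u *
        ENNReal.ofReal (u ^ (a - ((d : ℝ) + 2) / 2) * Real.exp (-u))) *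
      ENNReal.ofReal (Real.sqrt (Real.pi ^ d)) *
      ∫⁻ Z, g Z * ENNReal.ofReal (gammaDensity d a Z) ∂(spdVolume d) := by
  set I := ∫⁻ u in Set.Ioi (0 : ℝ), h u *
        ENNReal.ofReal (u ^ (a - ((d : ℝ) + 2) / 2) * Real.exp (-u)) with hI
  have hm1 : Measurable fun u : ℝ => h u *
      ENNReal.ofReal (u ^ (a - ((d : ℝ) + 2) / 2) * Real.exp (-u)) :=
    hh.mul (((measurable_id.pow_const _).mul measurable_id.neg.exp).ennreal_ofReal)
  have hm2 : Measurable fun X => k X * ENNReal.ofReal (gammaDensity (d + 1) a X) :=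
    hk.mul (measurable_gammaDensity a).ennreal_ofReal
  have hm3 : Measurable fun Z => g Z * ENNReal.ofReal (gammaDensity d a Z) :=
    hg.mul (measurable_gammaDensity a).ennreal_ofReal
  rw [lintegral_spdVolume_succ hm2, ← lintegral_const_mul _ hm3]
  refine lintegral_congr_ae ?_
  filter_upwards [ae_posDef_spdVolume] with Z hZ
  have hpos := hZ.det_pos
  set c : ℝ := Z.det ^ (a - ((d : ℝ) + 2) / 2) * Real.exp (-Z.trace) with hc
  have hc0 : 0 ≤ c := by positivity
  have h1 : ∀ y : Fin d → ℝ, (∫⁻ u in Set.Ioi (0 : ℝ), k (bordered (u + y ⬝ᵥ (Z⁻¹ *ᵥ y)) y Z) *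
      ENNReal.ofReal (gammaDensity (d + 1) a (bordered (u + y ⬝ᵥ (Z⁻¹ *ᵥ y)) y Z))) =
      I * g Z * ENNReal.ofReal c * ENNReal.ofReal (Real.exp (-(y ⬝ᵥ (Z⁻¹ *ᵥ y)))) := by
    intro y
    rw [hI, mul_assoc, mul_assoc, ← lintegral_mul_const _ hm1]
    refine setLIntegral_congr_fun measurableSet_Ioi fun u hu => ?_
    have hu' : 0 < u := hu
    rw [hkgh u hu' y Z hZ, gammaDensity_bordered a hu' y hZ, ← hc,
      ENNReal.ofReal_mul (by positivity),
      ENNReal.ofReal_mul (Real.exp_nonneg (-(y ⬝ᵥ (Z⁻¹ *ᵥ y))))]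
    ring
  simp_rw [h1]
  -- The Gaussian integral over `y` supplies `√(det Z)`, exactly the missing half power; hence the
  -- parameter `a` is the same in both dimensions.
  have h2 : gammaDensity d a Z = c * Real.sqrt Z.det := by
    rw [gammaDensity, hc, Real.sqrt_eq_rpow, mul_right_comm, ← Real.rpow_add hpos]
    congr 2; ring
  rw [lintegral_const_mul _ (by fun_prop), lintegral_exp_neg_quadratic hZ, Fintype.card_fin,
    ENNReal.ofReal_mul (Real.sqrt_nonneg (Real.pi ^ d)), h2, ENNReal.ofReal_mul hc0]
  ring

lemma lintegral_rpow_mul_exp_neg {b : ℝ} (hb : -1 < b) :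
    ∫⁻ u in Set.Ioi (0 : ℝ), ENNReal.ofReal (u ^ b * Real.exp (-u)) =
      ENNReal.ofReal (Real.Gamma (b + 1)) := by
  have hb' : 0 < b + 1 := by linarith
  have hi := Real.GammaIntegral_convergent hb'
  have hc : ∀ u : ℝ, Real.exp (-u) * u ^ (b + 1 - 1) = u ^ b * Real.exp (-u) := fun u => by
    rw [add_sub_cancel_right, mul_comm]
  simp_rw [hc] at hi
  rw [Real.Gamma_eq_integral hb']
  simp_rw [hc]
  rw [ofReal_integral_eq_lintegral_ofReal hi]
  filter_upwards [ae_restrict_mem measurableSet_Ioi] with u hu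
  have : 0 < u := hu
  positivity

/-- There is one empty matrix and the empty product of Lebesgue measures has mass one: the start of
the recursion. -/
lemma lintegral_spdVolume_zero {f : Matrix (Fin 0) (Fin 0) ℝ → ℝ≥0∞} (hf : Measurable f) :
    ∫⁻ X, f X ∂(spdVolume 0) = f 1 := by
  have hc : upperCone 0 = Set.univ := by
    refine Set.eq_univ_of_forall fun u => ?_
    show (symOfUpper 0 u).PosDef
    rw [Subsingleton.elim (symOfUpper 0 u) 1]
    exact PosDef.one
  rw [lintegral_spdVolume hf, hc, Measure.restrict_univ]
  have h1 : ∀ u, f (symOfUpper 0 u) = f 1 := fun u => congrArg f (Subsingleton.elim _ _)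
  simp [h1, volume_pi]

/-- The multivariate gamma integral is positive and finite. -/
lemma exists_lintegral_gammaDensity (d : ℕ) {a : ℝ} (ha : ((d : ℝ) - 1) / 2 < a) :
    ∃ c : ℝ, 0 < c ∧ ∫⁻ X, ENNReal.ofReal (gammaDensity d a X) ∂(spdVolume d) =
      ENNReal.ofReal c := by
  induction d with
  | zero =>
    refine ⟨1, one_pos, ?_⟩
    rw [lintegral_spdVolume_zero (measurable_gammaDensity a).ennreal_ofReal]
    simp [gammaDensity]
  | succ d ih =>
    push_cast at ha
    obtain ⟨c, hc, hce⟩ := ih (by linarith)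
    have h := lintegral_gammaDensity_succ (d := d) a (k := fun _ => 1) measurable_const
      (h := fun _ => 1) measurable_const (g := fun _ => 1) measurable_const
      (fun _ _ _ _ _ => (one_mul 1).symm)
    simp only [one_mul] at h
    have hb : -1 < a - ((d : ℝ) + 2) / 2 := by linarith
    have hΓ : 0 < Real.Gamma (a - ((d : ℝ) + 2) / 2 + 1) := Real.Gamma_pos_of_pos (by linarith)
    refine ⟨Real.Gamma (a - ((d : ℝ) + 2) / 2 + 1) * Real.sqrt (Real.pi ^ d) * c,
      by positivity, ?_⟩
    rw [h, lintegral_rpow_mul_exp_neg hb, hce, ← ENNReal.ofReal_mul hΓ.le,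
      ← ENNReal.ofReal_mul (by positivity)]

lemma integrable_gammaDensity {a : ℝ} (ha : ((d : ℝ) - 1) / 2 < a) :
    Integrable (gammaDensity d a) (spdVolume d) := by
  obtain ⟨c, _, hce⟩ := exists_lintegral_gammaDensity d ha
  refine ⟨(measurable_gammaDensity a).aestronglyMeasurable, ?_⟩
  rw [hasFiniteIntegral_iff_ofReal, hce]
  · exact ENNReal.ofReal_lt_top
  · filter_upwards [ae_posDef_spdVolume] with X hX using (gammaDensity_pos a hX).le

lemma lintegral_gammaDensity {a : ℝ} (ha : ((d : ℝ) - 1) / 2 < a) :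
    ∫⁻ X, ENNReal.ofReal (gammaDensity d a X) ∂(spdVolume d) = ENNReal.ofReal (multiGamma d a) :=
  (ofReal_integral_eq_lintegral_ofReal (integrable_gammaDensity ha) (by
    filter_upwards [ae_posDef_spdVolume] with X hX using (gammaDensity_pos a hX).le)).symm

lemma multiGamma_pos {a : ℝ} (ha : ((d : ℝ) - 1) / 2 < a) : 0 < multiGamma d a := by
  obtain ⟨c, hc, hce⟩ := exists_lintegral_gammaDensity d ha
  rw [lintegral_gammaDensity ha] at hce
  by_contra h
  rw [ENNReal.ofReal_of_nonpos (not_lt.1 h)] at hce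
  exact absurd hce.symm (by simpa using hc)

lemma measurable_inv_entry (i j : Fin d) :
    Measurable fun X : Matrix (Fin d) (Fin d) ℝ => X⁻¹ i j :=
  (measurable_entry i j).comp measurable_inv

/-- The last diagonal entry survives the removal of the first row and column, so numerator and
normalisation acquire the same factor at each step. In size one, `Γ(a + 1) = a Γ(a)` gives the
value. -/
lemma lintegral_diag_gammaDensity_last (d : ℕ) {a : ℝ} (ha : (d : ℝ) / 2 < a) :
    ∫⁻ X, ENNReal.ofReal (X (Fin.last d) (Fin.last d)) *
      ENNReal.ofReal (gammaDensity (d + 1) a X) ∂(spdVolume (d + 1)) =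
      ENNReal.ofReal a * ENNReal.ofReal (multiGamma (d + 1) a) := by
  induction d with
  | zero =>
    have ha0 : 0 < a := by simpa using ha
    have hf := (measurable_gammaDensity (d := 0) a).ennreal_ofReal
    have h1 := lintegral_gammaDensity_succ (d := 0) a (k := fun X => ENNReal.ofReal (X 0 0))
      (measurable_entry _ _).ennreal_ofReal (h := fun u => ENNReal.ofReal u)
      measurable_id.ennreal_ofReal (g := fun _ => 1) measurable_const
      (fun u _ y Z _ => by simp)
    have h2 := lintegral_gammaDensity_succ (d := 0) a (k := fun _ => 1) measurable_const
      (h := fun _ => 1) measurable_const (g := fun _ => 1) measurable_const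
      (fun _ _ _ _ _ => (one_mul 1).symm)
    have h3 : ∫⁻ u in Set.Ioi (0 : ℝ), ENNReal.ofReal u *
        ENNReal.ofReal (u ^ (a - ((0 : ℕ) + 2 : ℝ) / 2) * Real.exp (-u)) =
        ENNReal.ofReal a * ∫⁻ u in Set.Ioi (0 : ℝ), 1 *
        ENNReal.ofReal (u ^ (a - ((0 : ℕ) + 2 : ℝ) / 2) * Real.exp (-u)) := by
      simp only [one_mul]
      have e1 : a - ((0 : ℕ) + 2 : ℝ) / 2 = a - 1 := by norm_num
      rw [e1, lintegral_rpow_mul_exp_neg (by linarith), sub_add_cancel,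
        ← ENNReal.ofReal_mul ha0.le, ← Real.Gamma_add_one ha0.ne',
        ← lintegral_rpow_mul_exp_neg (by linarith)]
      refine setLIntegral_congr_fun measurableSet_Ioi fun u hu => ?_
      have hu' : 0 < u := hu
      rw [← ENNReal.ofReal_mul hu'.le, ← mul_assoc,
        ← Real.rpow_one_add' hu'.le (by simpa using ha0.ne')]
      congr 3; ring
    rw [← lintegral_gammaDensity (by simpa using ha0)]
    simp only [one_mul] at h1 h2 h3
    rw [h2, show (Fin.last 0) = (0 : Fin 1) from rfl, h1, h3]
    simp only [mul_assoc]
  | succ d ih =>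
    have ha' : (d : ℝ) / 2 < a := by push_cast at ha; linarith
    have h1 := lintegral_gammaDensity_succ (d := d + 1) a
      (k := fun X => ENNReal.ofReal (X (Fin.last (d + 1)) (Fin.last (d + 1))))
      (measurable_entry _ _).ennreal_ofReal (h := fun _ => 1) measurable_const
      (g := fun Z => ENNReal.ofReal (Z (Fin.last d) (Fin.last d)))
      (measurable_entry _ _).ennreal_ofReal
      (fun u _ y Z _ => by rw [← Fin.succ_last, bordered_succ_succ, one_mul])
    have h2 := lintegral_gammaDensity_succ (d := d + 1) a (k := fun _ => 1) measurable_const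
      (h := fun _ => 1) measurable_const (g := fun _ => 1) measurable_const
      (fun _ _ _ _ _ => (one_mul 1).symm)
    rw [h1, ih ha', ← lintegral_gammaDensity (d := d + 1 + 1) (by push_cast at ha ⊢; linarith)]
    simp only [one_mul] at h2 ⊢
    rw [h2, ← lintegral_gammaDensity (d := d + 1) (by push_cast at ha ⊢; linarith)]
    ring

/-- The corner of the inverse is `1 / u`, with `u` separated from `y` and `Z`. One reduction step
suffices, and `Γ(b) / Γ(b + 1) = 1 / b`. -/
lemma lintegral_inv_diag_gammaDensity_zero {a : ℝ} (ha : ((d : ℝ) + 2) / 2 < a) :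
    ∫⁻ X, ENNReal.ofReal (X⁻¹ 0 0) *
      ENNReal.ofReal (gammaDensity (d + 1) a X) ∂(spdVolume (d + 1)) =
      ENNReal.ofReal (a - ((d : ℝ) + 2) / 2)⁻¹ * ENNReal.ofReal (multiGamma (d + 1) a) := by
  set b := a - ((d : ℝ) + 2) / 2 with hb
  have hb0 : 0 < b := by linarith
  have h1 := lintegral_gammaDensity_succ (d := d) a (k := fun X => ENNReal.ofReal (X⁻¹ 0 0))
    (measurable_inv_entry _ _).ennreal_ofReal (h := fun u => ENNReal.ofReal u⁻¹)
    measurable_id.inv.ennreal_ofReal (g := fun _ => 1) measurable_const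
    (fun u _ y Z hZ => by rw [inv_bordered_zero_zero _ _ hZ, add_sub_cancel_right, mul_one])
  have h2 := lintegral_gammaDensity_succ (d := d) a (k := fun _ => 1) measurable_const
    (h := fun _ => 1) measurable_const (g := fun _ => 1) measurable_const
    (fun _ _ _ _ _ => (one_mul 1).symm)
  have h3 : ∫⁻ u in Set.Ioi (0 : ℝ), ENNReal.ofReal u⁻¹ *
      ENNReal.ofReal (u ^ b * Real.exp (-u)) =
      ENNReal.ofReal b⁻¹ * ∫⁻ u in Set.Ioi (0 : ℝ), ENNReal.ofReal (u ^ b * Real.exp (-u)) := by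
    rw [lintegral_rpow_mul_exp_neg (by linarith), Real.Gamma_add_one hb0.ne',
      ← ENNReal.ofReal_mul (by positivity), inv_mul_cancel_left₀ hb0.ne']
    have e1 : b = (b - 1) + 1 := by ring
    conv_rhs => rw [e1]
    rw [← lintegral_rpow_mul_exp_neg (by linarith)]
    refine setLIntegral_congr_fun measurableSet_Ioi fun u hu => ?_
    have hu' : 0 < u := hu
    rw [← ENNReal.ofReal_mul (by positivity), ← mul_assoc, Real.rpow_sub_one hu'.ne']
    congr 2
    field_simp
  rw [← lintegral_gammaDensity (by push_cast; linarith)]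
  simp only [one_mul, ← hb] at h1 h2
  rw [h2, h1, h3]
  simp only [mul_assoc]

end MultivariateGamma

/-! ### Mean and inverse mean of the standard Wishart law -/

section StandardWishart

variable {d : ℕ}

/-- Test the quadratic form on `e_i + e_j` and `e_i - e_j`. Integrability of off-diagonal entries
thereby follows from that of the diagonal. -/
lemma two_mul_abs_entry_le {X : Matrix (Fin d) (Fin d) ℝ} (hX : X.PosSemidef) (i j : Fin d) :
    2 * |X i j| ≤ X i i + X j j := by
  have hs : X j i = X i j := by simpa using (hX.isHermitian.apply i j)
  have h1 := hX.dotProduct_mulVec_nonneg (Pi.single i 1 + Pi.single j 1)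
  have h2 := hX.dotProduct_mulVec_nonneg (Pi.single i 1 - Pi.single j 1)
  simp [mulVec_add, mulVec_sub, add_dotProduct, sub_dotProduct, dotProduct_add, dotProduct_sub,
    hs] at h1 h2
  rcases abs_cases (X i j) with h | h <;> linarith

lemma measurable_congr_mul (B C : Matrix (Fin d) (Fin d) ℝ) :
    Measurable fun X : Matrix (Fin d) (Fin d) ℝ => B * X * C :=
  (measurable_mul_right C).comp (measurable_mul_left B)

/-- The second order structure of a measure that is invariant under symmetric involutions. -/
lemma isotropic_moments {μ : Measure (Matrix (Fin d) (Fin d) ℝ)}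
    (hμ : ∀ B : Matrix (Fin d) (Fin d) ℝ, B.IsSymm → B * B = 1 →
      μ.map (fun X => B * X * B) = μ)
    {T : Matrix (Fin d) (Fin d) ℝ → Matrix (Fin d) (Fin d) ℝ} (hTm : Measurable T)
    (hT : ∀ B : Matrix (Fin d) (Fin d) ℝ, B * B = 1 → ∀ X, T (B * X * B) = B * T X * B)
    (hpos : ∀ᵐ X ∂μ, (T X).PosDef) (l : Fin d) {c : ℝ} (hc : 0 ≤ c)
    (hl : ∫⁻ X, ENNReal.ofReal (T X l l) ∂μ = ENNReal.ofReal c) (i j : Fin d) :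
    Integrable (fun X => T X i j) μ ∧
      ∫ X, T X i j ∂μ = (c • (1 : Matrix (Fin d) (Fin d) ℝ)) i j := by
  have hm : ∀ i j, Measurable fun X => T X i j := fun i j => (measurable_entry i j).comp hTm
  -- Conjugation by the transposition of `l` and `k` is a symmetric involution exchanging the two
  -- diagonal entries.
  have hdiag : ∀ k, ∫⁻ X, ENNReal.ofReal (T X k k) ∂μ = ENNReal.ofReal c := by
    intro k
    set σ := Equiv.swap l k
    have hB1 : (σ.permMatrix ℝ).IsSymm := by
      rw [IsSymm, transpose_permMatrix, Equiv.swap_inv]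
    have hB2 : σ.permMatrix ℝ * σ.permMatrix ℝ = 1 := by
      rw [← permMatrix_mul, Equiv.swap_mul_self, permMatrix_one]
    rw [← hl, ← hμ _ hB1 hB2, lintegral_map (hm k k).ennreal_ofReal (measurable_congr_mul _ _),
      hμ _ hB1 hB2]
    refine lintegral_congr fun X => ?_
    rw [hT _ hB2, Equiv.Perm.permMatrix, PEquiv.toMatrix_toPEquiv_mul,
      PEquiv.mul_toMatrix_toPEquiv]
    simp [σ]
  have hdi : ∀ k, Integrable (fun X => T X k k) μ ∧ ∫ X, T X k k ∂μ = c := by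
    intro k
    have h0 : 0 ≤ᵐ[μ] fun X => T X k k := by
      filter_upwards [hpos] with X hX using hX.posSemidef.diag_nonneg
    have hi : Integrable (fun X => T X k k) μ := by
      refine ⟨(hm k k).aestronglyMeasurable, ?_⟩
      rw [hasFiniteIntegral_iff_ofReal h0, hdiag]
      exact ENNReal.ofReal_lt_top
    refine ⟨hi, ?_⟩
    have := ofReal_integral_eq_lintegral_ofReal hi h0
    rw [hdiag] at this
    exact (ENNReal.ofReal_eq_ofReal_iff (integral_nonneg_of_ae h0) hc).1 this
  by_cases hij : i = j
  · subst hij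
    simpa using hdi i
  · have hi : Integrable (fun X => T X i j) μ := by
      refine ((hdi i).1.add (hdi j).1).mono (hm i j).aestronglyMeasurable ?_
      filter_upwards [hpos] with X hX
      have h1 := two_mul_abs_entry_le hX.posSemidef i j
      have h2 := abs_nonneg (T X i j)
      rw [Real.norm_eq_abs, Real.norm_eq_abs]
      exact le_trans (by simp only [Pi.add_apply]; linarith) (le_abs_self _)
    refine ⟨hi, ?_⟩
    -- Flipping the sign of coordinate `i` negates the entry `(i, j)`, so its expectation equals its
    -- own negative.
    set B : Matrix (Fin d) (Fin d) ℝ := diagonal (Function.update 1 i (-1)) with hB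
    have hB1 : B.IsSymm := by simp [hB, IsSymm]
    have hB2 : B * B = 1 := by
      rw [hB, diagonal_mul_diagonal, ← diagonal_one]
      congr 1; funext k
      by_cases hk : k = i
      · subst hk; simp
      · simp [hk]
    have h1 : ∫ X, T X i j ∂μ = ∫ X, -T X i j ∂μ := by
      conv_lhs => rw [← hμ B hB1 hB2]
      rw [integral_map (measurable_congr_mul _ _).aemeasurable (hm i j).aestronglyMeasurable]
      refine integral_congr_ae (Filter.Eventually.of_forall fun X => ?_)
      simp only [hT B hB2]
      simp [hB, mul_diagonal, diagonal_mul, Ne.symm hij]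
    rw [integral_neg] at h1
    rw [Matrix.smul_apply, one_apply_ne hij, smul_zero]
    linarith

/-- The law with density proportional to `det(X)^(a - (d+1)/2) exp(-tr X)`. -/
def stdWishart (d : ℕ) (a : ℝ) : Measure (Matrix (Fin d) (Fin d) ℝ) :=
  (spdVolume d).withDensity fun X => ENNReal.ofReal ((multiGamma d a)⁻¹ * gammaDensity d a X)

lemma measurable_stdWishart_density (a : ℝ) : Measurable fun X : Matrix (Fin d) (Fin d) ℝ =>
    ENNReal.ofReal ((multiGamma d a)⁻¹ * gammaDensity d a X) :=
  ((measurable_gammaDensity a).const_mul _).ennreal_ofReal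

lemma lintegral_stdWishart {a : ℝ} (ha : ((d : ℝ) - 1) / 2 < a)
    {f : Matrix (Fin d) (Fin d) ℝ → ℝ≥0∞} (hf : Measurable f) :
    ∫⁻ X, f X ∂(stdWishart d a) = ENNReal.ofReal (multiGamma d a)⁻¹ *
      ∫⁻ X, f X * ENNReal.ofReal (gammaDensity d a X) ∂(spdVolume d) := by
  have hm : Measurable fun X => f X * ENNReal.ofReal (gammaDensity d a X) :=
    hf.mul (measurable_gammaDensity a).ennreal_ofReal
  rw [stdWishart, lintegral_withDensity_eq_lintegral_mul _ (measurable_stdWishart_density a) hf,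
    ← lintegral_const_mul _ hm]
  refine lintegral_congr fun X => ?_
  rw [Pi.mul_apply, ENNReal.ofReal_mul (inv_nonneg.2 (multiGamma_pos ha).le)]
  ring

lemma ae_posDef_withDensity (f : Matrix (Fin d) (Fin d) ℝ → ℝ≥0∞) :
    ∀ᵐ X ∂((spdVolume d).withDensity f), X.PosDef :=
  (withDensity_absolutelyContinuous _ _).ae_le ae_posDef_spdVolume

lemma isProbabilityMeasure_stdWishart {a : ℝ} (ha : ((d : ℝ) - 1) / 2 < a) :
    IsProbabilityMeasure (stdWishart d a) := by
  refine ⟨?_⟩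
  have := lintegral_stdWishart ha (f := fun _ => 1) measurable_const
  simp only [one_mul, lintegral_const] at this
  rw [this, lintegral_gammaDensity ha, ← ENNReal.ofReal_mul (inv_nonneg.2 (multiGamma_pos ha).le),
    inv_mul_cancel₀ (multiGamma_pos ha).ne', ENNReal.ofReal_one]

/-- A symmetric involution has determinant `±1`, so it preserves Lebesgue measure as well as the
determinant and the trace of `X`, on which the density depends. -/
lemma map_congr_stdWishart {a : ℝ} (ha : ((d : ℝ) - 1) / 2 < a) {B : Matrix (Fin d) (Fin d) ℝ}
    (hB : B.IsSymm) (hBB : B * B = 1) :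
    (stdWishart d a).map (fun X => B * X * B) = stdWishart d a := by
  have hdet : B.det * B.det = 1 := by rw [← det_mul, hBB, det_one]
  have habs : |B.det| = 1 := by
    have : |B.det| * |B.det| = 1 := by rw [← abs_mul, hdet, abs_one]
    nlinarith [abs_nonneg B.det]
  have hne : B.det ≠ 0 := fun h => by simp [h] at hdet
  refine Measure.ext_of_lintegral _ fun f hf => ?_
  have hm : Measurable fun X => f X * ENNReal.ofReal (gammaDensity d a X) :=
    hf.mul (measurable_gammaDensity a).ennreal_ofReal
  rw [lintegral_map hf (measurable_congr_mul _ _),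
    lintegral_stdWishart ha (f := fun X => f (B * X * B)) (hf.comp (measurable_congr_mul _ _)),
    lintegral_stdWishart ha hf]
  congr 1
  have h := lintegral_congr_symm hB hne hm
  rw [habs, one_pow, inv_one, ENNReal.ofReal_one, one_mul] at h
  rw [← h]
  refine lintegral_congr fun X => ?_
  have h1 : gammaDensity d a (B * X * B) = gammaDensity d a X := by
    rw [gammaDensity, gammaDensity, det_mul, det_mul, mul_right_comm, hdet, one_mul,
      trace_mul_cycle, hBB, Matrix.one_mul]
  rw [h1]

/-- The measure `μ` lives on positive definite matrices, and has mean `E` and inverse mean `N`. -/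
structure HasMatMoments (μ : Measure (Matrix (Fin d) (Fin d) ℝ))
    (E N : Matrix (Fin d) (Fin d) ℝ) : Prop where
  ae_posDef : ∀ᵐ X ∂μ, X.PosDef
  integrable_entry : ∀ i j, Integrable (fun X => X i j) μ
  integral_entry : ∀ i j, ∫ X, X i j ∂μ = E i j
  integrable_inv : ∀ i j, Integrable (fun X => X⁻¹ i j) μ
  integral_inv : ∀ i j, ∫ X, X⁻¹ i j ∂μ = N i j

/-- By isotropy one diagonal entry fixes each expectation: the last one for `X`, the first one for
`X⁻¹`, as these are the entries accessible to the Schur recursion. -/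
lemma hasMatMoments_stdWishart {a : ℝ} (ha : ((d : ℝ) + 1) / 2 < a) :
    HasMatMoments (stdWishart d a) (a • 1) ((a - ((d : ℝ) + 1) / 2)⁻¹ • 1) := by
  have ha' : ((d : ℝ) - 1) / 2 < a := by linarith
  have ha0 : 0 < a := lt_trans (by positivity) ha
  have hpd : ∀ᵐ X ∂(stdWishart d a), X.PosDef := ae_posDef_withDensity _
  have hpi : ∀ᵐ X ∂(stdWishart d a), (X⁻¹).PosDef := by
    filter_upwards [hpd] with X hX using hX.inv
  have hTi : ∀ B : Matrix (Fin d) (Fin d) ℝ, B * B = 1 → ∀ X : Matrix (Fin d) (Fin d) ℝ,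
      (B * X * B)⁻¹ = B * X⁻¹ * B := by
    intro B hB X
    rw [Matrix.mul_inv_rev, Matrix.mul_inv_rev, inv_eq_right_inv hB, Matrix.mul_assoc]
  have hcancel : ∀ c : ℝ, ENNReal.ofReal (multiGamma d a)⁻¹ *
      (ENNReal.ofReal c * ENNReal.ofReal (multiGamma d a)) = ENNReal.ofReal c := by
    intro c
    rw [mul_left_comm, ← ENNReal.ofReal_mul (inv_nonneg.2 (multiGamma_pos ha').le),
      inv_mul_cancel₀ (multiGamma_pos ha').ne', ENNReal.ofReal_one, mul_one]
  cases d with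
  | zero => exact ⟨hpd, fun i => i.elim0, fun i => i.elim0, fun i => i.elim0, fun i => i.elim0⟩
  | succ d =>
    have h1 := isotropic_moments (fun B hB hBB => map_congr_stdWishart ha' hB hBB)
      (T := fun X => X) measurable_id (fun _ _ _ => rfl) hpd (Fin.last d) ha0.le (by
        rw [lintegral_stdWishart ha' (f := fun X => ENNReal.ofReal (X (Fin.last d) (Fin.last d)))
          (measurable_entry _ _).ennreal_ofReal,
          lintegral_diag_gammaDensity_last d (by push_cast at ha; linarith), hcancel])
    have h2 := isotropic_moments (fun B hB hBB => map_congr_stdWishart ha' hB hBB)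
      measurable_inv hTi hpi 0 (c := (a - (((d + 1 : ℕ) : ℝ) + 1) / 2)⁻¹)
      (inv_nonneg.2 (by linarith)) (by
        have e : a - (((d + 1 : ℕ) : ℝ) + 1) / 2 = a - ((d : ℝ) + 2) / 2 := by push_cast; ring
        rw [lintegral_stdWishart ha' (measurable_inv_entry _ _).ennreal_ofReal,
          lintegral_inv_diag_gammaDensity_zero (by push_cast at ha; linarith), hcancel, e])
    exact ⟨hpd, fun i j => (h1 i j).1, fun i j => (h1 i j).2, fun i j => (h2 i j).1,
      fun i j => (h2 i j).2⟩

lemma integrable_mul_mul_entry {μ : Measure (Matrix (Fin d) (Fin d) ℝ)}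
    {T : Matrix (Fin d) (Fin d) ℝ → Matrix (Fin d) (Fin d) ℝ} {E : Matrix (Fin d) (Fin d) ℝ}
    (h1 : ∀ i j, Integrable (fun X => T X i j) μ) (h2 : ∀ i j, ∫ X, T X i j ∂μ = E i j)
    (B C : Matrix (Fin d) (Fin d) ℝ) (i j : Fin d) :
    Integrable (fun X => (B * T X * C) i j) μ ∧ ∫ X, (B * T X * C) i j ∂μ = (B * E * C) i j := by
  have hi : ∀ k l, Integrable (fun X => B i l * T X l k * C k j) μ := fun k l =>
    ((h1 l k).const_mul _).mul_const _
  simp only [Matrix.mul_apply, Finset.sum_mul]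
  refine ⟨integrable_finsetSum _ fun k _ => integrable_finsetSum _ fun l _ => hi k l, ?_⟩
  rw [integral_finsetSum _ fun k _ => integrable_finsetSum _ fun l _ => hi k l]
  refine Finset.sum_congr rfl fun k _ => ?_
  rw [integral_finsetSum _ fun l _ => hi k l]
  refine Finset.sum_congr rfl fun l _ => ?_
  rw [integral_mul_const, integral_const_mul, h2]

lemma HasMatMoments.map_congr {μ : Measure (Matrix (Fin d) (Fin d) ℝ)}
    {E N : Matrix (Fin d) (Fin d) ℝ} (h : HasMatMoments μ E N) {B : Matrix (Fin d) (Fin d) ℝ}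
    (hB : IsUnit B.det) :
    HasMatMoments (μ.map fun X => B * X * Bᵀ) (B * E * Bᵀ) ((Bᵀ)⁻¹ * N * B⁻¹) := by
  have hm : Measurable fun X : Matrix (Fin d) (Fin d) ℝ => B * X * Bᵀ := measurable_congr_mul _ _
  have hinv : ∀ X : Matrix (Fin d) (Fin d) ℝ, (B * X * Bᵀ)⁻¹ = (Bᵀ)⁻¹ * X⁻¹ * B⁻¹ := fun X => by
    rw [Matrix.mul_inv_rev, Matrix.mul_inv_rev, Matrix.mul_assoc]
  have h1 := integrable_mul_mul_entry (T := fun X => X) h.integrable_entry h.integral_entry B Bᵀ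
  have h2 := integrable_mul_mul_entry (T := fun X => X⁻¹) h.integrable_inv h.integral_inv
    (Bᵀ)⁻¹ B⁻¹
  refine ⟨?_, fun i j => ?_, fun i j => ?_, fun i j => ?_, fun i j => ?_⟩
  · rw [ae_map_iff hm.aemeasurable measurableSet_posDef]
    filter_upwards [h.ae_posDef] with X hX using (posDef_conj_iff hB X).2 hX
  · exact (integrable_map_measure (measurable_entry i j).aestronglyMeasurable
      hm.aemeasurable).2 (h1 i j).1
  · rw [integral_map hm.aemeasurable (measurable_entry i j).aestronglyMeasurable]
    exact (h1 i j).2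
  · refine (integrable_map_measure (measurable_inv_entry i j).aestronglyMeasurable
      hm.aemeasurable).2 ?_
    simpa only [Function.comp_def, hinv] using (h2 i j).1
  · rw [integral_map hm.aemeasurable (measurable_inv_entry i j).aestronglyMeasurable]
    simp only [hinv]
    exact (h2 i j).2

lemma HasMatMoments.map_inv {μ : Measure (Matrix (Fin d) (Fin d) ℝ)}
    {E N : Matrix (Fin d) (Fin d) ℝ} (h : HasMatMoments μ E N) :
    HasMatMoments (μ.map fun X => X⁻¹) N E := by
  have hii : ∀ᵐ X ∂μ, X⁻¹⁻¹ = X := by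
    filter_upwards [h.ae_posDef] with X hX
    exact nonsing_inv_nonsing_inv _ (isUnit_iff_ne_zero.2 hX.det_pos.ne')
  refine ⟨?_, fun i j => ?_, fun i j => ?_, fun i j => ?_, fun i j => ?_⟩
  · rw [ae_map_iff measurable_inv.aemeasurable measurableSet_posDef]
    filter_upwards [h.ae_posDef] with X hX using hX.inv
  · exact (integrable_map_measure (measurable_entry i j).aestronglyMeasurable
      measurable_inv.aemeasurable).2 (h.integrable_inv i j)
  · rw [integral_map measurable_inv.aemeasurable (measurable_entry i j).aestronglyMeasurable]
    exact h.integral_inv i j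
  · refine (integrable_map_measure (measurable_inv_entry i j).aestronglyMeasurable
      measurable_inv.aemeasurable).2 ((h.integrable_entry i j).congr ?_)
    filter_upwards [hii] with X hX
    simp [hX]
  · rw [integral_map measurable_inv.aemeasurable (measurable_inv_entry i j).aestronglyMeasurable,
      ← h.integral_entry i j]
    refine integral_congr_ae ?_
    filter_upwards [hii] with X hX
    simp [hX]

end StandardWishart

/-! ### Wishart and inverse Wishart laws and their moments -/

section WishartLaws

variable {d : ℕ}

lemma measurable_wishartPDF (v : ℝ) (V : Matrix (Fin d) (Fin d) ℝ) :
    Measurable (wishartPDF v V) :=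
  ((measurable_det.pow_const _).const_mul _).mul
    ((measurable_trace.comp (measurable_mul_left _)).neg.div_const _).exp

lemma measurable_invWishartPDF (v : ℝ) (V : Matrix (Fin d) (Fin d) ℝ) :
    Measurable (invWishartPDF v V) :=
  ((measurable_det.pow_const _).const_mul _).mul
    ((measurable_trace.comp ((measurable_mul_left _).comp measurable_inv)).neg.div_const _).exp

lemma wishartPDF_pos {v : ℝ} (hv : (d : ℝ) - 1 < v) {V X : Matrix (Fin d) (Fin d) ℝ}
    (hV : V.PosDef) (hX : X.PosDef) : 0 < wishartPDF v V X := by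
  have h1 := hV.det_pos
  have h2 := hX.det_pos
  have h3 := multiGamma_pos (d := d) (a := v / 2) (by linarith)
  unfold wishartPDF; positivity

lemma invWishartPDF_pos {v : ℝ} (hv : 2 * (d : ℝ) < v) {V X : Matrix (Fin d) (Fin d) ℝ}
    (hV : V.PosDef) (hX : X.PosDef) : 0 < invWishartPDF v V X := by
  have h1 := hV.det_pos
  have h2 := hX.det_pos
  have h3 := multiGamma_pos (d := d) (a := (v - d - 1) / 2) (by linarith)
  unfold invWishartPDF; positivity

/-- The Wishart law. -/
def wishartMeasure (v : ℝ) (V : Matrix (Fin d) (Fin d) ℝ) : Measure (Matrix (Fin d) (Fin d) ℝ) :=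
  (spdVolume d).withDensity fun X => ENNReal.ofReal (wishartPDF v V X)

/-- The inverse Wishart law. -/
def invWishartMeasure (v : ℝ) (V : Matrix (Fin d) (Fin d) ℝ) :
    Measure (Matrix (Fin d) (Fin d) ℝ) :=
  (spdVolume d).withDensity fun X => ENNReal.ofReal (invWishartPDF v V X)

/-- With `B² = 2 V` the exponent becomes `-tr Y`, and the Jacobian `det B ^ (d + 1)` completes the
determinant power to the normalising constant `2 ^ (v d / 2) det V ^ (v / 2)`. -/
lemma wishartPDF_congr {v : ℝ} {V B : Matrix (Fin d) (Fin d) ℝ} (hV : V.PosDef) (hB : B.PosDef)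
    (hBV : B * B = (2 : ℝ) • V) {Y : Matrix (Fin d) (Fin d) ℝ} (hY : Y.PosDef) :
    B.det ^ (d + 1) * wishartPDF v V (B * Y * B) =
      (multiGamma d (v / 2))⁻¹ * gammaDensity d (v / 2) Y := by
  have hb := hB.det_pos
  have hy := hY.det_pos
  have hv := hV.det_pos
  have hdet : B.det * B.det = 2 ^ d * V.det := by
    rw [← det_mul, hBV, det_smul, Fintype.card_fin]
  have htr : -(V⁻¹ * (B * Y * B)).trace / 2 = -Y.trace := by
    have h1 : V⁻¹ * (B * Y * B) = (V⁻¹ * B) * Y * B := by simp only [Matrix.mul_assoc]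
    have h2 : B * (V⁻¹ * B) = (2 : ℝ) • 1 := by
      have h3 : (B * (V⁻¹ * B)) * B = ((2 : ℝ) • (1 : Matrix (Fin d) (Fin d) ℝ)) * B := by
        rw [Matrix.mul_assoc, Matrix.mul_assoc, hBV, Matrix.mul_smul,
          nonsing_inv_mul _ (isUnit_iff_ne_zero.2 hv.ne')]
        simp
      exact ((isUnit_iff_isUnit_det B).2 (isUnit_iff_ne_zero.2 hb.ne')).mul_right_cancel h3
    rw [h1, trace_mul_comm, ← Matrix.mul_assoc, h2, Matrix.smul_mul, Matrix.one_mul, trace_smul,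
      smul_eq_mul]
    ring
  have hpow : B.det ^ (d + 1) * (B.det * B.det) ^ ((v - d - 1) / 2) =
      (2 : ℝ) ^ (v * d / 2) * V.det ^ (v / 2) := by
    have e1 : B.det ^ (d + 1) = (B.det * B.det) ^ (((d : ℝ) + 1) / 2) := by
      rw [← sq, ← Real.rpow_natCast B.det 2, ← Real.rpow_mul hb.le, ← Real.rpow_natCast]
      congr 1; push_cast; ring
    rw [e1, ← Real.rpow_add (by positivity), hdet, Real.mul_rpow (by positivity) hv.le,
      ← Real.rpow_natCast, ← Real.rpow_mul (by norm_num)]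
    congr 2 <;> ring
  rw [wishartPDF, htr, gammaDensity, det_mul, det_mul, mul_right_comm B.det,
    Real.mul_rpow (by positivity) hy.le]
  have e2 : (v - d - 1) / 2 = v / 2 - ((d : ℝ) + 1) / 2 := by ring
  calc _ = (B.det ^ (d + 1) * (B.det * B.det) ^ ((v - d - 1) / 2)) *
        ((2 : ℝ) ^ (v * d / 2) * V.det ^ (v / 2))⁻¹ * ((multiGamma d (v / 2))⁻¹ *
        (Y.det ^ ((v - d - 1) / 2) * Real.exp (-Y.trace))) := by
        rw [mul_inv, mul_inv, mul_inv]; ring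
    _ = _ := by
        rw [hpow, mul_inv_cancel₀ (by positivity), one_mul, e2]

open scoped MatrixOrder in
lemma wishartMeasure_eq_map (v : ℝ) {V : Matrix (Fin d) (Fin d) ℝ}
    (hV : V.PosDef) : ∃ B : Matrix (Fin d) (Fin d) ℝ, B.PosDef ∧ B * B = (2 : ℝ) • V ∧
      wishartMeasure v V = (stdWishart d (v / 2)).map fun X => B * X * B := by
  obtain ⟨hB, hBV⟩ := posDef_sqrt (hV.smul (by norm_num : (0 : ℝ) < 2))
  set B := CFC.sqrt ((2 : ℝ) • V)
  refine ⟨B, hB, hBV, ?_⟩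
  have hsymm : B.IsSymm := (by simpa [IsHermitian] using hB.isHermitian.eq : Bᵀ = B)
  have hb := hB.det_pos
  refine Measure.ext_of_lintegral _ fun f hf => ?_
  have hw := (measurable_wishartPDF v V).ennreal_ofReal
  have hfw : Measurable fun X => ENNReal.ofReal (wishartPDF v V X) * f X := hw.mul hf
  have hfB : Measurable fun X => f (B * X * B) := hf.comp (measurable_congr_mul B B)
  have hfwB : Measurable fun X => ENNReal.ofReal (wishartPDF v V (B * X * B)) * f (B * X * B) :=
    hfw.comp (measurable_congr_mul B B)
  have h := lintegral_congr_symm hsymm hb.ne' hfw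
  rw [lintegral_map hf (measurable_congr_mul _ _), wishartMeasure, stdWishart,
    lintegral_withDensity_eq_lintegral_mul _ hw hf,
    lintegral_withDensity_eq_lintegral_mul _ (measurable_stdWishart_density _) hfB]
  have h2 : ∫⁻ X, ENNReal.ofReal (wishartPDF v V X) * f X ∂(spdVolume d) =
      ENNReal.ofReal (B.det ^ (d + 1)) *
      ∫⁻ X, ENNReal.ofReal (wishartPDF v V (B * X * B)) * f (B * X * B) ∂(spdVolume d) := by
    rw [h, abs_of_pos hb, ← mul_assoc, ← ENNReal.ofReal_mul (by positivity),
      mul_inv_cancel₀ (by positivity), ENNReal.ofReal_one, one_mul]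
  simp only [Pi.mul_apply]
  rw [h2, ← lintegral_const_mul _ hfwB]
  refine lintegral_congr_ae ?_
  filter_upwards [ae_posDef_spdVolume] with X hX
  rw [← mul_assoc, ← ENNReal.ofReal_mul (by positivity), wishartPDF_congr hV hB hBV hX]

lemma isProbabilityMeasure_wishart {v : ℝ} (hv : (d : ℝ) - 1 < v) {V : Matrix (Fin d) (Fin d) ℝ}
    (hV : V.PosDef) : IsProbabilityMeasure (wishartMeasure v V) := by
  obtain ⟨B, -, -, h⟩ := wishartMeasure_eq_map v hV
  have := isProbabilityMeasure_stdWishart (d := d) (a := v / 2) (by linarith)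
  rw [h]
  exact Measure.isProbabilityMeasure_map (measurable_congr_mul _ _).aemeasurable

lemma hasMatMoments_wishart {v : ℝ} (hv : (d : ℝ) + 1 < v) {V : Matrix (Fin d) (Fin d) ℝ}
    (hV : V.PosDef) : HasMatMoments (wishartMeasure v V) (v • V) ((v - d - 1)⁻¹ • V⁻¹) := by
  obtain ⟨B, hB, hBV, h⟩ := wishartMeasure_eq_map v hV
  have hsymm : Bᵀ = B := by simpa [IsHermitian] using hB.isHermitian.eq
  have hu : IsUnit B.det := isUnit_iff_ne_zero.2 hB.det_pos.ne'
  have hm := (hasMatMoments_stdWishart (d := d) (a := v / 2) (by linarith)).map_congr hu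
  rw [hsymm] at hm
  rw [h]
  have e1 : B * ((v / 2) • 1) * B = v • V := by
    rw [Matrix.mul_smul, Matrix.smul_mul, Matrix.mul_one, hBV, smul_smul]
    congr 1; ring
  have e2 : B⁻¹ * ((v / 2 - ((d : ℝ) + 1) / 2)⁻¹ • 1) * B⁻¹ = (v - d - 1)⁻¹ • V⁻¹ := by
    have h2V : ((2 : ℝ) • V)⁻¹ = (2 : ℝ)⁻¹ • V⁻¹ := by
      refine inv_eq_right_inv ?_
      rw [smul_mul_smul, mul_nonsing_inv _ (isUnit_iff_ne_zero.2 hV.det_pos.ne')]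
      norm_num
    rw [Matrix.mul_smul, Matrix.smul_mul, Matrix.mul_one, ← Matrix.mul_inv_rev, hBV, h2V,
      smul_smul, ← mul_inv]
    congr 2; ring
  rwa [e1, e2] at hm

/-- The Jacobian of inversion shifts the exponent of `det X` and leaves a Wishart density with `v -
d - 1` degrees of freedom. Its range `d - 1 < v - d - 1` is the condition `2 d < v`. -/
lemma invWishartPDF_inv {v : ℝ} {V X : Matrix (Fin d) (Fin d) ℝ} (hV : V.PosDef)
    (hX : X.PosDef) : (X.det ^ (d + 1))⁻¹ * invWishartPDF v V X⁻¹ =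
      wishartPDF (v - d - 1) V⁻¹ X := by
  have hx := hX.det_pos
  have hv := hV.det_pos
  have hXu : IsUnit X.det := isUnit_iff_ne_zero.2 hx.ne'
  have hVu : IsUnit V.det := isUnit_iff_ne_zero.2 hv.ne'
  rw [invWishartPDF, wishartPDF, nonsing_inv_nonsing_inv _ hXu, nonsing_inv_nonsing_inv _ hVu,
    det_nonsing_inv, det_nonsing_inv, Ring.inverse_eq_inv',
    Real.inv_rpow hx.le, Real.inv_rpow hv.le, Real.rpow_neg hx.le, inv_inv]
  have e : (X.det ^ (d + 1))⁻¹ * X.det ^ (v / 2) = X.det ^ ((v - d - 1 - d - 1) / 2) := by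
    rw [← Real.rpow_natCast, ← Real.rpow_neg hx.le, ← Real.rpow_add hx]
    congr 1; push_cast; ring
  rw [← e, mul_inv, inv_inv, div_eq_mul_inv]
  ring

lemma invWishartMeasure_eq_map (v : ℝ) {V : Matrix (Fin d) (Fin d) ℝ} (hV : V.PosDef) :
    invWishartMeasure v V = (wishartMeasure (v - d - 1) V⁻¹).map fun X => X⁻¹ := by
  refine Measure.ext_of_lintegral _ fun f hf => ?_
  have hw := (measurable_invWishartPDF v V).ennreal_ofReal
  have hw' := (measurable_wishartPDF (v - d - 1) V⁻¹).ennreal_ofReal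
  have hfw : Measurable fun X => ENNReal.ofReal (invWishartPDF v V X) * f X := hw.mul hf
  have hfi : Measurable fun X => f X⁻¹ := hf.comp measurable_inv
  rw [lintegral_map hf measurable_inv, wishartMeasure, invWishartMeasure,
    lintegral_withDensity_eq_lintegral_mul _ hw hf,
    lintegral_withDensity_eq_lintegral_mul _ hw' hfi]
  simp only [Pi.mul_apply]
  rw [← lintegral_inv_spdVolume hfw]
  refine lintegral_congr_ae ?_
  filter_upwards [ae_posDef_spdVolume] with X hX
  have := hX.det_pos
  rw [← mul_assoc, ← ENNReal.ofReal_mul (by positivity), invWishartPDF_inv hV hX]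

lemma isProbabilityMeasure_invWishart {v : ℝ} (hv : 2 * (d : ℝ) < v)
    {V : Matrix (Fin d) (Fin d) ℝ} (hV : V.PosDef) :
    IsProbabilityMeasure (invWishartMeasure v V) := by
  have := isProbabilityMeasure_wishart (d := d) (v := v - d - 1) (by linarith) hV.inv
  rw [invWishartMeasure_eq_map v hV]
  exact Measure.isProbabilityMeasure_map measurable_inv.aemeasurable

/-- Inversion exchanges mean and inverse mean of the Wishart law with `v - d - 1` degrees of
freedom. -/
lemma hasMatMoments_invWishart {v : ℝ} (hv : 2 * (d : ℝ) + 2 < v) {V : Matrix (Fin d) (Fin d) ℝ}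
    (hV : V.PosDef) : HasMatMoments (invWishartMeasure v V) ((v - 2 * d - 2)⁻¹ • V)
      ((v - d - 1) • V⁻¹) := by
  have h := (hasMatMoments_wishart (d := d) (v := v - d - 1) (by linarith) hV.inv).map_inv
  rw [nonsing_inv_nonsing_inv _ (isUnit_iff_ne_zero.2 hV.det_pos.ne'),
    show v - d - 1 - d - 1 = v - 2 * d - 2 by ring] at h
  rwa [invWishartMeasure_eq_map v hV]

/-- `p` is, up to the positive total mass `c`, the density of a law with mean `E` and inverse mean
`N`. -/
structure HasScaledMoments (p : Matrix (Fin d) (Fin d) ℝ → ℝ) (c : ℝ)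
    (E N : Matrix (Fin d) (Fin d) ℝ) : Prop where
  integrable : Integrable p (spdVolume d)
  mass : ∫ X, p X ∂(spdVolume d) = c
  integrable_entry : ∀ i j, Integrable (fun X => X i j * p X) (spdVolume d)
  integral_entry : ∀ i j, ∫ X, X i j * p X ∂(spdVolume d) = c * E i j
  integrable_inv : ∀ i j, Integrable (fun X => X⁻¹ i j * p X) (spdVolume d)
  integral_inv : ∀ i j, ∫ X, X⁻¹ i j * p X ∂(spdVolume d) = c * N i j

lemma integral_withDensity_ofReal {p g : Matrix (Fin d) (Fin d) ℝ → ℝ} (hp : Measurable p)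
    (hp0 : ∀ X, X.PosDef → 0 ≤ p X) :
    (Integrable g ((spdVolume d).withDensity fun X => ENNReal.ofReal (p X)) ↔
      Integrable (fun X => g X * p X) (spdVolume d)) ∧
    ∫ X, g X ∂((spdVolume d).withDensity fun X => ENNReal.ofReal (p X)) =
      ∫ X, g X * p X ∂(spdVolume d) := by
  have hae : ∀ᵐ X ∂(spdVolume d), (ENNReal.ofReal (p X)).toReal • g X = g X * p X := by
    filter_upwards [ae_posDef_spdVolume] with X hX
    rw [ENNReal.toReal_ofReal (hp0 X hX), smul_eq_mul, mul_comm]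
  constructor
  · rw [integrable_withDensity_iff_integrable_smul' hp.ennreal_ofReal (by simp)]
    exact integrable_congr hae
  · rw [integral_withDensity_eq_integral_toReal_smul hp.ennreal_ofReal (by simp)]
    exact integral_congr_ae hae

lemma HasMatMoments.scaled {p : Matrix (Fin d) (Fin d) ℝ → ℝ} (hp : Measurable p)
    (hp0 : ∀ X, X.PosDef → 0 ≤ p X) {E N : Matrix (Fin d) (Fin d) ℝ}
    [IsProbabilityMeasure ((spdVolume d).withDensity fun X => ENNReal.ofReal (p X))]
    (h : HasMatMoments ((spdVolume d).withDensity fun X => ENNReal.ofReal (p X)) E N) :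
    HasScaledMoments p 1 E N := by
  have h1 := fun g => integral_withDensity_ofReal (g := g) hp hp0
  refine ⟨?_, ?_, fun i j => (h1 _).1.1 (h.integrable_entry i j), fun i j => ?_,
    fun i j => (h1 _).1.1 (h.integrable_inv i j), fun i j => ?_⟩
  · simpa using (h1 fun _ => 1).1.1 (integrable_const 1)
  · simpa using (h1 fun _ => 1).2.symm
  · rw [← (h1 fun X => X i j).2, h.integral_entry, one_mul]
  · rw [← (h1 fun X => X⁻¹ i j).2, h.integral_inv, one_mul]

lemma HasScaledMoments.const_mul {p : Matrix (Fin d) (Fin d) ℝ → ℝ} {c : ℝ}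
    {E N : Matrix (Fin d) (Fin d) ℝ} (h : HasScaledMoments p c E N) (k : ℝ) :
    HasScaledMoments (fun X => k * p X) (k * c) E N := by
  have e : ∀ g : ℝ, ∀ x : ℝ, g * (k * x) = k * (g * x) := fun g x => by ring
  refine ⟨h.integrable.const_mul k, ?_, fun i j => ?_, fun i j => ?_, fun i j => ?_,
    fun i j => ?_⟩
  · rw [integral_const_mul, h.mass]
  · simpa only [e] using (h.integrable_entry i j).const_mul k
  · simp only [e]; rw [integral_const_mul, h.integral_entry, mul_assoc]
  · simpa only [e] using (h.integrable_inv i j).const_mul k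
  · simp only [e]; rw [integral_const_mul, h.integral_inv, mul_assoc]

lemma HasScaledMoments.congr {p q : Matrix (Fin d) (Fin d) ℝ → ℝ} {c : ℝ}
    {E N : Matrix (Fin d) (Fin d) ℝ} (h : HasScaledMoments p c E N)
    (hpq : ∀ X, X.PosDef → p X = q X) : HasScaledMoments q c E N := by
  have e : ∀ g : Matrix (Fin d) (Fin d) ℝ → ℝ,
      (fun X => g X * p X) =ᵐ[spdVolume d] fun X => g X * q X := fun g => by
    filter_upwards [ae_posDef_spdVolume] with X hX
    rw [hpq X hX]
  have e1 : p =ᵐ[spdVolume d] q := by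
    filter_upwards [ae_posDef_spdVolume] with X hX using hpq X hX
  exact ⟨h.integrable.congr e1, (integral_congr_ae e1).symm.trans h.mass,
    fun i j => (h.integrable_entry i j).congr (e _),
    fun i j => (integral_congr_ae (e _)).symm.trans (h.integral_entry i j),
    fun i j => (h.integrable_inv i j).congr (e _),
    fun i j => (integral_congr_ae (e _)).symm.trans (h.integral_inv i j)⟩

lemma hasScaledMoments_wishart {v : ℝ} (hv : (d : ℝ) + 1 < v) {V : Matrix (Fin d) (Fin d) ℝ}
    (hV : V.PosDef) : HasScaledMoments (wishartPDF v V) 1 (v • V) ((v - d - 1)⁻¹ • V⁻¹) := by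
  have : IsProbabilityMeasure
      ((spdVolume d).withDensity fun X => ENNReal.ofReal (wishartPDF v V X)) :=
    isProbabilityMeasure_wishart (by linarith) hV
  exact HasMatMoments.scaled (measurable_wishartPDF v V)
    (fun X hX => (wishartPDF_pos (by linarith) hV hX).le) (hasMatMoments_wishart hv hV)

lemma hasScaledMoments_invWishart {v : ℝ} (hv : 2 * (d : ℝ) + 2 < v)
    {V : Matrix (Fin d) (Fin d) ℝ} (hV : V.PosDef) :
    HasScaledMoments (invWishartPDF v V) 1 ((v - 2 * d - 2)⁻¹ • V) ((v - d - 1) • V⁻¹) := by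
  have : IsProbabilityMeasure
      ((spdVolume d).withDensity fun X => ENNReal.ofReal (invWishartPDF v V X)) :=
    isProbabilityMeasure_invWishart (by linarith) hV
  exact HasMatMoments.scaled (measurable_invWishartPDF v V)
    (fun X hX => (invWishartPDF_pos (by linarith) hV hX).le) (hasMatMoments_invWishart hv hV)

lemma integrable_invWishartPDF {v : ℝ} (hv : 2 * (d : ℝ) < v) {V : Matrix (Fin d) (Fin d) ℝ}
    (hV : V.PosDef) : Integrable (invWishartPDF v V) (spdVolume d) := by
  have := isProbabilityMeasure_invWishart hv hV
  have h1 := integral_withDensity_ofReal (g := fun _ => 1) (measurable_invWishartPDF v V)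
    (fun X hX => (invWishartPDF_pos hv hV hX).le)
  simpa using h1.1.1 (integrable_const (μ := invWishartMeasure v V) (1 : ℝ))

end WishartLaws

/-! ### Uniqueness of moment matching and moments of mixtures -/

section MomentMatching

variable {d : ℕ}

/-- Once the moments of `p` are known in closed form, matching `p` is a condition on `q` alone. -/
lemma sameMoments_iff {p q : Matrix (Fin d) (Fin d) ℝ → ℝ} {c : ℝ}
    {E N : Matrix (Fin d) (Fin d) ℝ} (h : HasScaledMoments p c E N) (hc : 0 < c) :
    SameMoments p q ↔ HasScaledMoments q c E N := by
  constructor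
  · intro hs
    exact ⟨hs.integrable_right, hs.mass_eq.symm.trans h.mass, hs.mean_right,
      fun i j => (hs.mean_eq i j).symm.trans (h.integral_entry i j), hs.inv_mean_right,
      fun i j => (hs.inv_mean_eq i j).symm.trans (h.integral_inv i j)⟩
  · intro hq
    exact ⟨h.integrable, hq.integrable, by rwa [h.mass], h.mass.trans hq.mass.symm,
      h.integrable_entry, hq.integrable_entry,
      fun i j => (h.integral_entry i j).trans (hq.integral_entry i j).symm,
      h.integrable_inv, hq.integrable_inv,
      fun i j => (h.integral_inv i j).trans (hq.integral_inv i j).symm⟩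

lemma HasScaledMoments.unique {p : Matrix (Fin d) (Fin d) ℝ → ℝ} {c c₀ : ℝ}
    {E N E₀ N₀ : Matrix (Fin d) (Fin d) ℝ} (h : HasScaledMoments p c E N)
    (h₀ : HasScaledMoments p c₀ E₀ N₀) (hc : 0 < c₀) : c = c₀ ∧ E = E₀ ∧ N = N₀ := by
  have e := h.mass.symm.trans h₀.mass
  subst e
  refine ⟨rfl, ?_, ?_⟩
  · ext i j
    exact mul_left_cancel₀ hc.ne' ((h.integral_entry i j).symm.trans (h₀.integral_entry i j))
  · ext i j
    exact mul_left_cancel₀ hc.ne' ((h.integral_inv i j).symm.trans (h₀.integral_inv i j))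

/-- Multiplying mean by inverse mean eliminates the matrix parameter and leaves a scalar equation
for the degrees of freedom. For `d = 0` it would be empty. -/
lemma mul_eq_mul_of_smul_eq (hd : 0 < d) {a b a₀ b₀ : ℝ} {V V₀ : Matrix (Fin d) (Fin d) ℝ}
    (hV : V.PosDef) (hV₀ : V₀.PosDef) (h1 : a • V = a₀ • V₀) (h2 : b • V⁻¹ = b₀ • V₀⁻¹) :
    a * b = a₀ * b₀ := by
  have h : (a • V) * (b • V⁻¹) = (a₀ • V₀) * (b₀ • V₀⁻¹) := by rw [h1, h2]
  rw [smul_mul_smul, smul_mul_smul, mul_nonsing_inv _ (isUnit_iff_ne_zero.2 hV.det_pos.ne'),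
    mul_nonsing_inv _ (isUnit_iff_ne_zero.2 hV₀.det_pos.ne')] at h
  simpa using congrFun (congrFun h ⟨0, hd⟩) ⟨0, hd⟩

/-- A scaled Wishart density is determined by its mass, mean and inverse mean. -/
lemma wishart_unique (hd : 0 < d) {c w c₀ w₀ : ℝ} {W W₀ : Matrix (Fin d) (Fin d) ℝ}
    (hw : (d : ℝ) + 1 < w) (hw₀ : (d : ℝ) + 1 < w₀) (hW : W.PosDef) (hW₀ : W₀.PosDef)
    (hc : 0 < c₀) (h : HasScaledMoments (fun X => c * wishartPDF w W X) c₀ (w₀ • W₀)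
      ((w₀ - d - 1)⁻¹ • W₀⁻¹)) : c = c₀ ∧ w = w₀ ∧ W = W₀ := by
  obtain ⟨h1, h2, h3⟩ := ((hasScaledMoments_wishart hw hW).const_mul c).unique h hc
  have hd' : (0 : ℝ) < (d : ℝ) + 1 := by positivity
  have h4 := mul_eq_mul_of_smul_eq hd hW hW₀ h2 h3
  -- The scalar `w / (w - d - 1)` is injective in `w`: cross-multiplication leaves `(d + 1) w = (d +
  -- 1) w₀`.
  have h5 : w = w₀ := by
    have e1 : w - d - 1 ≠ 0 := by linarith
    have e2 : w₀ - d - 1 ≠ 0 := by linarith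
    field_simp at h4
    refine mul_left_cancel₀ hd'.ne' ?_
    linarith
  subst h5
  exact ⟨by linarith, rfl, smul_right_injective _ (by linarith : w ≠ 0) h2⟩

/-- A scaled inverse Wishart density is determined by its mass, mean and inverse mean. -/
lemma invWishart_unique (hd : 0 < d) {c w c₀ w₀ : ℝ} {W W₀ : Matrix (Fin d) (Fin d) ℝ}
    (hw : 2 * (d : ℝ) + 2 < w) (hw₀ : 2 * (d : ℝ) + 2 < w₀) (hW : W.PosDef) (hW₀ : W₀.PosDef)
    (hc : 0 < c₀) (h : HasScaledMoments (fun X => c * invWishartPDF w W X) c₀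
      ((w₀ - 2 * d - 2)⁻¹ • W₀) ((w₀ - d - 1) • W₀⁻¹)) : c = c₀ ∧ w = w₀ ∧ W = W₀ := by
  obtain ⟨h1, h2, h3⟩ := ((hasScaledMoments_invWishart hw hW).const_mul c).unique h hc
  have hd' : (0 : ℝ) < (d : ℝ) + 1 := by positivity
  have h4 := mul_eq_mul_of_smul_eq hd hW hW₀ h2 h3
  have e1 : w - 2 * d - 2 ≠ 0 := by linarith
  -- Likewise, equality of the values of `(w - d - 1) / (w - 2 d - 2)` reduces to `(d + 1) w = (d +
  -- 1) w₀`.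
  have h5 : w = w₀ := by
    have e2 : w₀ - 2 * d - 2 ≠ 0 := by linarith
    field_simp at h4
    refine mul_left_cancel₀ hd'.ne' ?_
    linarith
  subst h5
  exact ⟨by linarith, rfl, smul_right_injective _ (inv_ne_zero e1) h2⟩

lemma ae_posDef_prod : ∀ᵐ p ∂((spdVolume d).prod (spdVolume d)), p.1.PosDef ∧ p.2.PosDef := by
  filter_upwards [Measure.quasiMeasurePreserving_fst.ae ae_posDef_spdVolume,
    Measure.quasiMeasurePreserving_snd.ae ae_posDef_spdVolume] with p h1 h2 using ⟨h1, h2⟩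

/-- Expectations under a mixture whose components have conjugated expectations. -/
lemma mixture_expectation {k : Matrix (Fin d) (Fin d) ℝ → Matrix (Fin d) (Fin d) ℝ → ℝ}
    {q : Matrix (Fin d) (Fin d) ℝ → ℝ} (hk : Measurable (Function.uncurry k)) (hq : Measurable q)
    (hk0 : ∀ X Y, X.PosDef → Y.PosDef → 0 ≤ k X Y) (hq0 : ∀ Y, Y.PosDef → 0 ≤ q Y)
    {T : Matrix (Fin d) (Fin d) ℝ → Matrix (Fin d) (Fin d) ℝ} (hT : Measurable T)
    (hTpos : ∀ X, X.PosDef → (T X).PosDef) {B C E : Matrix (Fin d) (Fin d) ℝ}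
    (h1 : ∀ Y, Y.PosDef → ∀ i j, Integrable (fun X => T X i j * k X Y) (spdVolume d))
    (h2 : ∀ Y, Y.PosDef → ∀ i j, ∫ X, T X i j * k X Y ∂(spdVolume d) = (B * T Y * C) i j)
    (h3 : ∀ i j, Integrable (fun Y => T Y i j * q Y) (spdVolume d))
    (h4 : ∀ i j, ∫ Y, T Y i j * q Y ∂(spdVolume d) = E i j) (i j : Fin d) :
    Integrable (fun X => T X i j * ∫ Y, k X Y * q Y ∂(spdVolume d)) (spdVolume d) ∧
    ∫ X, T X i j * ∫ Y, k X Y * q Y ∂(spdVolume d) ∂(spdVolume d) = (B * E * C) i j := by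
  have h5 := integrable_mul_mul_entry (μ := spdVolume d) (T := fun Y => q Y • T Y) (E := E)
    (fun i j => by simpa [mul_comm] using h3 i j) (fun i j => by simpa [mul_comm] using h4 i j) B C
  have e5 : ∀ Y i j, (B * (q Y • T Y) * C) i j = (B * T Y * C) i j * q Y := fun Y i j => by
    rw [Matrix.mul_smul, Matrix.smul_mul, Matrix.smul_apply, smul_eq_mul, mul_comm]
  simp only [e5] at h5
  have hm : ∀ i j, AEStronglyMeasurable
      (fun p : Matrix (Fin d) (Fin d) ℝ × Matrix (Fin d) (Fin d) ℝ =>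
        T p.1 i j * (k p.1 p.2 * q p.2))
      ((spdVolume d).prod (spdVolume d)) := fun i j =>
    (((measurable_entry i j).comp (hT.comp measurable_fst)).mul
      (hk.mul (hq.comp measurable_snd))).aestronglyMeasurable
  -- Diagonal entries are nonnegative, so joint integrability can be read off from the iterated
  -- integral, whose inner part is known. The other entries are dominated by these.
  have hdiag : ∀ i, Integrable
      (fun p : Matrix (Fin d) (Fin d) ℝ × Matrix (Fin d) (Fin d) ℝ =>
        T p.1 i i * (k p.1 p.2 * q p.2))
      ((spdVolume d).prod (spdVolume d)) := by
    intro i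
    rw [integrable_prod_iff' (hm i i)]
    constructor
    · filter_upwards [ae_posDef_spdVolume] with Y hY
      simpa only [mul_assoc] using (h1 Y hY i i).mul_const (q Y)
    · refine (h5 i i).1.congr ?_
      filter_upwards [ae_posDef_spdVolume] with Y hY
      rw [← h2 Y hY i i, ← integral_mul_const]
      refine integral_congr_ae ?_
      filter_upwards [ae_posDef_spdVolume] with X hX
      rw [Real.norm_of_nonneg, mul_assoc]
      exact mul_nonneg (hTpos X hX).diag_pos.le (mul_nonneg (hk0 X Y hX hY) (hq0 Y hY))
  have hint : Integrable
      (fun p : Matrix (Fin d) (Fin d) ℝ × Matrix (Fin d) (Fin d) ℝ =>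
        T p.1 i j * (k p.1 p.2 * q p.2))
      ((spdVolume d).prod (spdVolume d)) := by
    refine ((hdiag i).add (hdiag j)).mono' (hm i j) ?_
    filter_upwards [ae_posDef_prod] with p hp
    have ha := two_mul_abs_entry_le (hTpos _ hp.1).posSemidef i j
    have hb := mul_nonneg (hk0 _ _ hp.1 hp.2) (hq0 _ hp.2)
    rw [Real.norm_eq_abs, abs_mul, abs_of_nonneg hb, Pi.add_apply, ← add_mul]
    exact mul_le_mul_of_nonneg_right (by linarith [abs_nonneg (T p.1 i j)]) hb
  constructor
  · have := hint.integral_prod_left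
    simpa only [integral_const_mul] using this
  · have hswap := integral_integral_swap (f := fun X Y => T X i j * (k X Y * q Y)) hint
    simp only [integral_const_mul] at hswap
    rw [hswap, ← (h5 i j).2]
    refine integral_congr_ae ?_
    filter_upwards [ae_posDef_spdVolume] with Y hY
    rw [← h2 Y hY i j, ← integral_mul_const]
    simp only [mul_assoc]

/-- The law of total expectation: since the component means are linear in `Y` and the inverse means
linear in `Y⁻¹`, the two moments of `q` determine those of the mixture. -/
lemma HasScaledMoments.mixture (hd : 0 < d)
    {k : Matrix (Fin d) (Fin d) ℝ → Matrix (Fin d) (Fin d) ℝ → ℝ}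
    {q : Matrix (Fin d) (Fin d) ℝ → ℝ} (hk : Measurable (Function.uncurry k)) (hq : Measurable q)
    (hk0 : ∀ X Y, X.PosDef → Y.PosDef → 0 ≤ k X Y) (hq0 : ∀ Y, Y.PosDef → 0 ≤ q Y)
    {B C B' C' E N : Matrix (Fin d) (Fin d) ℝ}
    (h : ∀ Y, Y.PosDef → HasScaledMoments (fun X => k X Y) 1 (B * Y * C) (B' * Y⁻¹ * C'))
    (hqm : HasScaledMoments q 1 E N) :
    HasScaledMoments (fun X => ∫ Y, k X Y * q Y ∂(spdVolume d)) 1 (B * E * C) (B' * N * C') := by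
  -- The total mass is a diagonal entry of the expectation of the constant matrix `1`.
  have h0 := mixture_expectation hk hq hk0 hq0 (T := fun _ => 1) (B := 1) (C := 1) (E := 1)
    measurable_const (fun _ _ => PosDef.one)
    (fun Y hY i j => (h Y hY).integrable.const_mul _)
    (fun Y hY i j => by rw [integral_const_mul, (h Y hY).mass]; simp)
    (fun i j => hqm.integrable.const_mul _)
    (fun i j => by rw [integral_const_mul, hqm.mass, mul_one]) ⟨0, hd⟩ ⟨0, hd⟩
  have h1 := mixture_expectation hk hq hk0 hq0 (T := fun X => X) (B := B) (C := C) (E := E)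
    measurable_id (fun _ hX => hX)
    (fun Y hY => (h Y hY).integrable_entry)
    (fun Y hY i j => by rw [(h Y hY).integral_entry, one_mul])
    hqm.integrable_entry (fun i j => by rw [hqm.integral_entry, one_mul])
  have h2 := mixture_expectation hk hq hk0 hq0 (T := fun X => X⁻¹) (B := B') (C := C') (E := N)
    measurable_inv (fun _ hX => hX.inv)
    (fun Y hY => (h Y hY).integrable_inv)
    (fun Y hY i j => by rw [(h Y hY).integral_inv, one_mul])
    hqm.integrable_inv (fun i j => by rw [hqm.integral_inv, one_mul])
  simp only [one_apply_eq, one_mul, mul_one] at h0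
  exact ⟨h0.1, h0.2, fun i j => (h1 i j).1, fun i j => by rw [(h1 i j).2, one_mul],
    fun i j => (h2 i j).1, fun i j => by rw [(h2 i j).2, one_mul]⟩

end MomentMatching

/-! ### The two moment matchings of the extent -/

section ExtentMatching

variable {d : ℕ}

lemma posDef_conj_inv {A Y : Matrix (Fin d) (Fin d) ℝ} (hA : IsUnit A.det) (hY : Y.PosDef) :
    (A⁻¹ * Y * (A⁻¹)ᵀ).PosDef :=
  (posDef_conj_iff (isUnit_nonsing_inv_det A hA) Y).2 hY

lemma inv_conj_inv {A Y : Matrix (Fin d) (Fin d) ℝ} (hA : IsUnit A.det) :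
    (A⁻¹ * Y * (A⁻¹)ᵀ)⁻¹ = Aᵀ * Y⁻¹ * A := by
  rw [Matrix.mul_inv_rev, Matrix.mul_inv_rev, nonsing_inv_nonsing_inv _ hA, transpose_nonsing_inv,
    nonsing_inv_nonsing_inv _ (by rwa [det_transpose]), Matrix.mul_assoc]

lemma inv_smul_of_posDef {t : ℝ} (ht : t ≠ 0) {V : Matrix (Fin d) (Fin d) ℝ} (hV : V.PosDef) :
    (t • V)⁻¹ = t⁻¹ • V⁻¹ := by
  refine inv_eq_right_inv ?_
  rw [smul_mul_smul, mul_nonsing_inv _ (isUnit_iff_ne_zero.2 hV.det_pos.ne'), mul_inv_cancel₀ ht,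
    one_smul]

/-- As a function of the current extent, the transition density is a scaled inverse Wishart
density. -/
lemma extTransition_eq {A : Matrix (Fin d) (Fin d) ℝ} (hA : IsUnit A.det) {n : ℝ}
    (hn : 2 * (d : ℝ) < n) : ∃ C : ℝ, 0 < C ∧
      ∀ X Y : Matrix (Fin d) (Fin d) ℝ, X.PosDef → Y.PosDef →
        extTransition A n X Y = C * invWishartPDF n (n • (A⁻¹ * Y * (A⁻¹)ᵀ)) X := by
  have hn0 : 0 < n := lt_of_le_of_lt (by positivity) hn
  have hA0 : A.det ≠ 0 := hA.ne_zero
  -- The map `X ↦ n⁻¹ A X Aᵀ` multiplies determinants by `k`, and `Y ↦ n A⁻¹ Y A⁻ᵀ` by `k⁻¹`.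
  set k : ℝ := (n⁻¹) ^ d * (A.det * A.det) with hk
  have hk0 : 0 < k := by have := mul_self_pos.2 hA0; positivity
  have hG1 := multiGamma_pos (d := d) (a := n / 2) (by linarith)
  have hG2 := multiGamma_pos (d := d) (a := (n - d - 1) / 2) (by linarith)
  -- The quotient of the two normalisations. The power `(n - d - 1) / 2` of `det Y` is the same on
  -- both sides, so the constant does not depend on `Y`.
  refine ⟨((2 : ℝ) ^ (n * d / 2) * multiGamma d (n / 2) * k ^ (n / 2))⁻¹ /
    ((k⁻¹) ^ ((n - d - 1) / 2) / ((2 : ℝ) ^ ((n - d - 1) * d / 2) *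
      multiGamma d ((n - d - 1) / 2))), by positivity, fun X Y hX hY => ?_⟩
  have hx := hX.det_pos
  have hy := hY.det_pos
  have hS : (A * X * Aᵀ).PosDef := (posDef_conj_iff hA X).2 hX
  have hdet1 : (n⁻¹ • (A * X * Aᵀ)).det = k * X.det := by
    rw [det_smul, Fintype.card_fin, det_mul, det_mul, det_transpose, hk]; ring
  have hdet2 : (n • (A⁻¹ * Y * (A⁻¹)ᵀ)).det = k⁻¹ * Y.det := by
    rw [det_smul, Fintype.card_fin, det_mul, det_mul, det_transpose, det_nonsing_inv,
      Ring.inverse_eq_inv', hk, mul_inv, mul_inv, inv_pow, inv_inv]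
    ring
  have htr : (n⁻¹ • (A * X * Aᵀ))⁻¹ * Y = n • ((A⁻¹)ᵀ * X⁻¹ * A⁻¹ * Y) := by
    rw [inv_smul_of_posDef (inv_ne_zero hn0.ne') hS, inv_inv, Matrix.mul_inv_rev,
      Matrix.mul_inv_rev, transpose_nonsing_inv, Matrix.smul_mul, Matrix.mul_assoc (Aᵀ)⁻¹]
    simp only [Matrix.mul_assoc]
  have htr2 : ((n⁻¹ • (A * X * Aᵀ))⁻¹ * Y).trace = ((n • (A⁻¹ * Y * (A⁻¹)ᵀ)) * X⁻¹).trace := by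
    rw [htr, Matrix.smul_mul, trace_smul, trace_smul]
    congr 1
    rw [Matrix.mul_assoc, trace_mul_comm]
    simp only [Matrix.mul_assoc]
  rw [extTransition, wishartPDF, invWishartPDF, hdet1, hdet2, htr2, Real.mul_rpow hk0.le hx.le,
    Real.mul_rpow (inv_nonneg.2 hk0.le) hy.le, Real.rpow_neg hx.le]
  have := Real.rpow_pos_of_pos hx (n / 2)
  have := Real.rpow_pos_of_pos hk0 (n / 2)
  have := Real.rpow_pos_of_pos (inv_pos.2 hk0) ((n - d - 1) / 2)
  field_simp

lemma invWishartPDF_mul_trace {V U X : Matrix (Fin d) (Fin d) ℝ} :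
    Real.exp (-(V * X⁻¹).trace / 2) * Real.exp (-(U * X⁻¹).trace / 2) =
      Real.exp (-((V + U) * X⁻¹).trace / 2) := by
  rw [← Real.exp_add, Matrix.add_mul, trace_add]
  congr 1; ring

/-- A product of inverse Wishart densities is a scaled inverse Wishart density. -/
lemma invWishartPDF_mul {v u : ℝ} (hv : 2 * (d : ℝ) < v) (hu : 2 * (d : ℝ) < u)
    {V U : Matrix (Fin d) (Fin d) ℝ} (hV : V.PosDef) (hU : U.PosDef) : ∃ C : ℝ, 0 < C ∧
      ∀ X : Matrix (Fin d) (Fin d) ℝ, X.PosDef →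
        invWishartPDF v V X * invWishartPDF u U X = C * invWishartPDF (v + u) (V + U) X := by
  have h1 := hV.det_pos
  have h2 := hU.det_pos
  have h3 := (hV.add hU).det_pos
  have hG1 := multiGamma_pos (d := d) (a := (v - d - 1) / 2) (by linarith)
  have hG2 := multiGamma_pos (d := d) (a := (u - d - 1) / 2) (by linarith)
  have hd0 : (0 : ℝ) ≤ d := by positivity
  have hG3 := multiGamma_pos (d := d) (a := (v + u - d - 1) / 2) (by linarith)
  set a := V.det ^ ((v - d - 1) / 2) /
      ((2 : ℝ) ^ ((v - d - 1) * d / 2) * multiGamma d ((v - d - 1) / 2)) with ha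
  set b := U.det ^ ((u - d - 1) / 2) /
      ((2 : ℝ) ^ ((u - d - 1) * d / 2) * multiGamma d ((u - d - 1) / 2)) with hb
  set c := (V + U).det ^ ((v + u - d - 1) / 2) /
      ((2 : ℝ) ^ ((v + u - d - 1) * d / 2) * multiGamma d ((v + u - d - 1) / 2)) with hc
  have hc0 : 0 < c := by positivity
  refine ⟨a * b / c, by positivity, fun X hX => ?_⟩
  have e : X.det ^ (-((v + u) / 2)) = X.det ^ (-(v / 2)) * X.det ^ (-(u / 2)) := by
    rw [← Real.rpow_add hX.det_pos]; congr 1; ring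
  rw [invWishartPDF, invWishartPDF, invWishartPDF, ← ha, ← hb, ← hc, ← invWishartPDF_mul_trace, e]
  field_simp

/-- A quotient of inverse Wishart densities is a scaled inverse Wishart density. -/
lemma invWishartPDF_div {v u : ℝ} (hv : 2 * (d : ℝ) < v) (hu : 2 * (d : ℝ) < u - v)
    {V U : Matrix (Fin d) (Fin d) ℝ} (hV : V.PosDef) (hU : (U - V).PosDef) : ∃ C : ℝ, 0 < C ∧
      ∀ X : Matrix (Fin d) (Fin d) ℝ, X.PosDef →
        invWishartPDF u U X / invWishartPDF v V X = C * invWishartPDF (u - v) (U - V) X := by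
  obtain ⟨C, hC, h⟩ := invWishartPDF_mul hv hu hV hU
  refine ⟨C⁻¹, inv_pos.2 hC, fun X hX => ?_⟩
  have h1 := h X hX
  have h2 := invWishartPDF_pos hv hV hX
  rw [add_sub_cancel, add_sub_cancel] at h1
  rw [div_eq_iff h2.ne', inv_mul_eq_div, div_mul_eq_mul_div, eq_div_iff hC.ne']
  linarith

/-- The Wishart parameters with the moments of `X ↦ W(Y; n, A X Aᵀ / n)`. -/
lemma isWishartApprox_extTransition_iff (hd : 0 < d) {A : Matrix (Fin d) (Fin d) ℝ}
    (hA : IsUnit A.det) {n : ℝ} (hn : 2 * (d : ℝ) + 2 < n) : ∃ C : ℝ, 0 < C ∧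
      ∀ Y : Matrix (Fin d) (Fin d) ℝ, Y.PosDef → ∀ c w W,
        (IsWishartApprox (fun X => extTransition A n X Y) c w W ↔ c = C ∧ w = n - d - 1 ∧
          W = (n / ((n - d - 1) * (n - 2 * d - 2))) • (A⁻¹ * Y * (A⁻¹)ᵀ)) := by
  obtain ⟨C, hC, h⟩ := extTransition_eq hA (n := n) (by linarith)
  have hd0 : (0 : ℝ) ≤ d := by positivity
  have hn0 : 0 < n := by linarith
  have hn1 : 0 < n - d - 1 := by linarith
  have hn2 : 0 < n - 2 * d - 2 := by linarith
  refine ⟨C, hC, fun Y hY c w W => ?_⟩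
  have hB := posDef_conj_inv hA hY
  have hW : ((n / ((n - d - 1) * (n - 2 * d - 2))) • (A⁻¹ * Y * (A⁻¹)ᵀ)).PosDef :=
    hB.smul (by positivity)
  set B := A⁻¹ * Y * (A⁻¹)ᵀ
  -- The mean is `n / (n - 2d - 2) B` and the inverse mean `(n - d - 1) / n B⁻¹`. For a Wishart law
  -- this requires `w / (w - d - 1) = (n - d - 1) / (n - 2d - 2)`, so `w = n - d - 1`; the mean then
  -- fixes the scale.
  have hm : HasScaledMoments (fun X => extTransition A n X Y) C
      ((n - d - 1) • ((n / ((n - d - 1) * (n - 2 * d - 2))) • B))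
      ((n - d - 1 - d - 1)⁻¹ • ((n / ((n - d - 1) * (n - 2 * d - 2))) • B)⁻¹) := by
    have h1 := ((hasScaledMoments_invWishart hn (hB.smul hn0)).const_mul C).congr
      (q := fun X => extTransition A n X Y) fun X hX => (h X Y hX hY).symm
    have e1 : (n - 2 * d - 2)⁻¹ • n • B =
        (n - d - 1) • ((n / ((n - d - 1) * (n - 2 * d - 2))) • B) := by
      rw [smul_smul, smul_smul]; congr 1; field_simp
    have e2 : (n - d - 1) • (n • B)⁻¹ =
        (n - d - 1 - d - 1)⁻¹ • ((n / ((n - d - 1) * (n - 2 * d - 2))) • B)⁻¹ := by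
      rw [inv_smul_of_posDef hn0.ne' hB, inv_smul_of_posDef (by positivity) hB, smul_smul,
        smul_smul, show n - d - 1 - d - 1 = n - 2 * d - 2 by ring]
      have : n - d * 2 - 2 ≠ 0 := by linarith
      congr 1; field_simp
    rwa [e1, e2, mul_one] at h1
  constructor
  · rintro ⟨h1, h2, h3⟩
    exact wishart_unique hd h1 (by linarith) h2 hW hC ((sameMoments_iff hm hC).1 h3)
  · rintro ⟨rfl, rfl, rfl⟩
    refine ⟨by linarith, hW, (sameMoments_iff hm hC).2 ?_⟩
    simpa using (hasScaledMoments_wishart (v := n - d - 1) (by linarith) hW).const_mul c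

lemma measurable_wishartPDF_param (v : ℝ) {α : Type*} [MeasurableSpace α]
    {V X : α → Matrix (Fin d) (Fin d) ℝ} (hV : Measurable V) (hX : Measurable X) :
    Measurable fun a => wishartPDF v (V a) (X a) := by
  have htr : Measurable fun a => ((V a)⁻¹ * X a).trace := by
    simp only [trace, diag_apply, Matrix.mul_apply]
    exact Finset.measurable_sum _ fun i _ => Finset.measurable_sum _ fun j _ =>
      ((measurable_inv_entry i j).comp hV).mul ((measurable_entry j i).comp hX)
  unfold wishartPDF
  exact (((((measurable_det.comp hV).pow_const _).const_mul _).inv).mul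
    ((measurable_det.comp hX).pow_const _)).mul (htr.neg.div_const _).exp

/-- The moments of the extent integral with a Wishart transition density. -/
lemma hasScaledMoments_wishart_mixture (hd : 0 < d) {A : Matrix (Fin d) (Fin d) ℝ}
    (hA : IsUnit A.det) {w t u : ℝ} (hw : (d : ℝ) + 1 < w) (ht : 0 < t) (hu : 2 * (d : ℝ) + 2 < u)
    {U : Matrix (Fin d) (Fin d) ℝ} (hU : U.PosDef) :
    HasScaledMoments (fun X => ∫ Y, wishartPDF w (t • (A⁻¹ * Y * (A⁻¹)ᵀ)) X *
        invWishartPDF u U Y ∂(spdVolume d)) 1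
      ((w * t * (u - 2 * d - 2)⁻¹) • (A⁻¹ * U * (A⁻¹)ᵀ))
      (((w - d - 1)⁻¹ * t⁻¹ * (u - d - 1)) • (A⁻¹ * U * (A⁻¹)ᵀ)⁻¹) := by
  have hpos : ∀ Y : Matrix (Fin d) (Fin d) ℝ, Y.PosDef → (t • (A⁻¹ * Y * (A⁻¹)ᵀ)).PosDef :=
    fun Y hY => (posDef_conj_inv hA hY).smul ht
  have hm : Measurable fun Y : Matrix (Fin d) (Fin d) ℝ => t • (A⁻¹ * Y * (A⁻¹)ᵀ) := by
    have := measurable_congr_mul (d := d) (t • A⁻¹) (A⁻¹)ᵀ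
    simpa only [Matrix.smul_mul] using this
  have h := HasScaledMoments.mixture hd
    (k := fun X Y => wishartPDF w (t • (A⁻¹ * Y * (A⁻¹)ᵀ)) X) (q := invWishartPDF u U)
    (measurable_wishartPDF_param w (hm.comp measurable_snd) measurable_fst)
    (measurable_invWishartPDF u U)
    (fun X Y hX hY => (wishartPDF_pos (by linarith) (hpos Y hY) hX).le)
    (fun Y hY => (invWishartPDF_pos (by linarith) hU hY).le)
    (B := (w * t) • A⁻¹) (C := (A⁻¹)ᵀ) (B' := ((w - d - 1)⁻¹ * t⁻¹) • Aᵀ) (C' := A)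
    (fun Y hY => by
      have h1 := hasScaledMoments_wishart hw (hpos Y hY)
      rw [inv_smul_of_posDef ht.ne' (posDef_conj_inv hA hY), inv_conj_inv hA, smul_smul,
        smul_smul] at h1
      simpa only [Matrix.smul_mul] using h1)
    (hasScaledMoments_invWishart hu hU)
  rw [inv_conj_inv hA]
  simpa only [Matrix.smul_mul, Matrix.mul_smul, smul_smul, mul_comm, mul_left_comm] using h

/-- The extent integral with the Wishart approximation of the transition density, and its
inverse Wishart approximation. -/
lemma isInvWishartApprox_extFactor_iff {s : ℕ} (hd : 0 < d) {A : Matrix (Fin d) (Fin d) ℝ}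
    (hA : IsUnit A.det) {n : ℝ} (hn : 2 * (d : ℝ) + 2 < n) {pred next : GIWParam s d}
    (hpred : pred.Valid) (hv : 2 * (d : ℝ) + 2 < next.v - pred.v)
    (hV : (next.V - pred.V).PosDef) {η : ℝ}
    (hη : η = 1 + (next.v - pred.v - 3 * ((d : ℝ) + 1)) / n) {C : ℝ} (hC : 0 < C) :
    0 < η ∧ 2 * (d : ℝ) + 2 < η⁻¹ * (next.v - pred.v - 2 * ((d : ℝ) + 1) ^ 2 / n) ∧
    ∃ K : ℝ, 0 < K ∧ ∀ (c w : Matrix (Fin d) (Fin d) ℝ → ℝ)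
      (W : Matrix (Fin d) (Fin d) ℝ → Matrix (Fin d) (Fin d) ℝ),
      (∀ Y, Y.PosDef → c Y = C ∧ w Y = n - d - 1 ∧
        W Y = (n / ((n - d - 1) * (n - 2 * d - 2))) • (A⁻¹ * Y * (A⁻¹)ᵀ)) → ∀ c' w' W',
      (IsInvWishartApprox (extFactor pred next fun X Y => c Y * wishartPDF (w Y) (W Y) X) c' w' W' ↔
        c' = K ∧ w' = η⁻¹ * (next.v - pred.v - 2 * ((d : ℝ) + 1) ^ 2 / n) ∧
          W' = η⁻¹ • (A⁻¹ * (next.V - pred.V) * (A⁻¹)ᵀ)) := by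
  obtain ⟨K, hK, hq⟩ := invWishartPDF_div (u := next.v) hpred.lt_v (by linarith) hpred.V_posDef hV
  set u := next.v - pred.v with hu
  set U := next.V - pred.V with hU
  have hd0 : (0 : ℝ) ≤ d := by positivity
  have hn0 : 0 < n := by linarith
  have hn1 : 0 < n - d - 1 := by linarith
  have hn2 : 0 < n - 2 * d - 2 := by linarith
  have hu2 : 0 < u - 2 * d - 2 := by linarith
  have hu1 : 0 < u - d - 1 := by linarith
  have hηn : η * n = n + u - 3 * (d + 1) := by rw [hη]; field_simp; ring
  have hη0 : 0 < η := by
    have : 0 < η * n := by rw [hηn]; linarith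
    exact pos_of_mul_pos_left this hn0.le
  set w₀ := η⁻¹ * (u - 2 * ((d : ℝ) + 1) ^ 2 / n) with hw₀
  have hw₀n : w₀ * (η * n) = u * n - 2 * (d + 1) ^ 2 := by rw [hw₀]; field_simp
  -- The products on the right of `e1` and `e2` come from the mixture moments. Their difference is
  -- `(d + 1) (n + u - 3 (d + 1)) = (d + 1) η n`, matching the gap `d + 1` on the left: this is the
  -- origin of `η`.
  have e1 : (w₀ - 2 * d - 2) * (η * n) = (n - 2 * d - 2) * (u - 2 * d - 2) := by
    rw [sub_mul, sub_mul, hw₀n, hηn]; ring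
  have e2 : (w₀ - d - 1) * (η * n) = (n - d - 1) * (u - d - 1) := by
    rw [sub_mul, sub_mul, hw₀n, hηn]; ring
  have hw2 : 0 < w₀ - 2 * d - 2 := by
    have : 0 < (w₀ - 2 * d - 2) * (η * n) := by rw [e1]; positivity
    exact pos_of_mul_pos_left this (by positivity)
  -- `C` is the mass of the transition density in `X`, and `K` that of the quotient of inverse
  -- Wishart densities.
  refine ⟨hη0, by linarith, C * K, by positivity, fun c w W h c' w' W' => ?_⟩
  have hB := posDef_conj_inv hA hV
  have hW : (η⁻¹ • (A⁻¹ * U * (A⁻¹)ᵀ)).PosDef := hB.smul (by positivity)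
  set t := n / ((n - d - 1) * (n - 2 * d - 2)) with ht
  have hm : HasScaledMoments (extFactor pred next fun X Y => c Y * wishartPDF (w Y) (W Y) X) (C * K)
      ((w₀ - 2 * d - 2)⁻¹ • (η⁻¹ • (A⁻¹ * U * (A⁻¹)ᵀ)))
      ((w₀ - d - 1) • (η⁻¹ • (A⁻¹ * U * (A⁻¹)ᵀ))⁻¹) := by
    have h1 := ((hasScaledMoments_wishart_mixture hd hA (w := n - d - 1) (t := t) (u := u)
      (by linarith) (by positivity) hv hV).const_mul (C * K)).congr
      (q := extFactor pred next fun X Y => c Y * wishartPDF (w Y) (W Y) X) fun X hX => by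
        rw [extFactor, ← integral_const_mul]
        refine integral_congr_ae ?_
        filter_upwards [ae_posDef_spdVolume] with Y hY
        obtain ⟨hc, hw, hW⟩ := h Y hY
        rw [hq Y hY, hc, hw, hW]
        ring
    have e3 : (w₀ - 2 * d - 2)⁻¹ • (η⁻¹ • (A⁻¹ * U * (A⁻¹)ᵀ)) =
        ((n - d - 1) * t * (u - 2 * d - 2)⁻¹) • (A⁻¹ * U * (A⁻¹)ᵀ) := by
      rw [smul_smul]
      congr 1
      rw [ht]
      field_simp
      linarith
    have e4 : (w₀ - d - 1) • (η⁻¹ • (A⁻¹ * U * (A⁻¹)ᵀ))⁻¹ =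
        ((n - d - 1 - d - 1)⁻¹ * t⁻¹ * (u - d - 1)) • (A⁻¹ * U * (A⁻¹)ᵀ)⁻¹ := by
      rw [inv_smul_of_posDef (by positivity) hB, smul_smul, inv_inv,
        show n - d - 1 - d - 1 = n - 2 * d - 2 by ring]
      have : n - d * 2 - 2 ≠ 0 := by linarith
      congr 1
      rw [ht]
      field_simp
      linarith
    rw [e3, e4]
    rwa [mul_one] at h1
  constructor
  · rintro ⟨h1, h2, h3⟩
    exact invWishart_unique hd h1 (by linarith) h2 hW (by positivity)
      ((sameMoments_iff hm (by positivity)).1 h3)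
  · rintro ⟨rfl, rfl, rfl⟩
    refine ⟨by linarith, hW, (sameMoments_iff hm (by positivity)).2 ?_⟩
    simpa using (hasScaledMoments_invWishart (v := w₀) (by linarith) hW).const_mul (C * K)

end ExtentMatching

/-! ### Factorisation of the backward integral -/

section Factorisation

variable {s d : ℕ}

open scoped MatrixOrder in
lemma trace_mul_nonneg_of_posSemidef {V X : Matrix (Fin d) (Fin d) ℝ} (hV : V.PosSemidef)
    (hX : X.PosSemidef) : 0 ≤ (V * X).trace := by
  have h1 : CFC.sqrt V * CFC.sqrt V = V := CFC.sqrt_mul_sqrt_self _ hV.nonneg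
  have h2 : (CFC.sqrt V).PosSemidef := (CFC.sqrt_nonneg V).posSemidef
  have h3 := (hX.mul_mul_conjTranspose_same (CFC.sqrt V)).trace_nonneg
  rwa [h2.isHermitian.eq, trace_mul_comm, ← Matrix.mul_assoc, h1] at h3

/-- Both exponentials are at most one. For `det X ≥ 1` the inverse Wishart factor is bounded; for
`det X ≤ 1` the Wishart factor is, since its exponent is nonnegative. Integrability of the exact
extent integrand follows without evaluating it. -/
lemma wishartPDF_mul_invWishartPDF_le {v u : ℝ} (hv : (d : ℝ) + 1 ≤ v) (hu : 2 * (d : ℝ) < u)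
    {V U : Matrix (Fin d) (Fin d) ℝ} (hV : V.PosDef) (hU : U.PosDef) : ∃ a b : ℝ,
      ∀ X : Matrix (Fin d) (Fin d) ℝ, X.PosDef → wishartPDF v V X * invWishartPDF u U X ≤
        a * wishartPDF v V X + b * invWishartPDF u U X := by
  have h1 := hV.det_pos
  have h2 := hU.det_pos
  have hG1 := multiGamma_pos (d := d) (a := v / 2) (by linarith)
  have hG2 := multiGamma_pos (d := d) (a := (u - d - 1) / 2) (by linarith)
  set a := ((2 : ℝ) ^ (v * d / 2) * multiGamma d (v / 2) * V.det ^ (v / 2))⁻¹ with ha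
  set b := U.det ^ ((u - d - 1) / 2) /
      ((2 : ℝ) ^ ((u - d - 1) * d / 2) * multiGamma d ((u - d - 1) / 2)) with hb
  refine ⟨b, a, fun X hX => ?_⟩
  have ha0 : 0 < a := by positivity
  have hb0 : 0 < b := by positivity
  have hx := hX.det_pos
  have t1 := trace_mul_nonneg_of_posSemidef hV.inv.posSemidef hX.posSemidef
  have t2 := trace_mul_nonneg_of_posSemidef hU.posSemidef hX.inv.posSemidef
  rw [wishartPDF, invWishartPDF, ← ha, ← hb]
  set p := X.det ^ ((v - d - 1) / 2)
  set q := X.det ^ (-(u / 2))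
  set e := Real.exp (-(V⁻¹ * X).trace / 2)
  set f := Real.exp (-(U * X⁻¹).trace / 2)
  have hp : 0 < p := Real.rpow_pos_of_pos hx _
  have hq : 0 < q := Real.rpow_pos_of_pos hx _
  have he : 0 < e := Real.exp_pos _
  have hf : 0 < f := Real.exp_pos _
  have he1 : e ≤ 1 := Real.exp_le_one_iff.2 (by linarith)
  have hf1 : f ≤ 1 := Real.exp_le_one_iff.2 (by linarith)
  have key : (p * e) * (q * f) ≤ p * e + q * f := by
    have hd0 : (0 : ℝ) ≤ d := by positivity
    rcases le_total 1 X.det with h | h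
    · have hq1 : q ≤ 1 := Real.rpow_le_one_of_one_le_of_nonpos h (by linarith)
      have : q * f ≤ 1 := mul_le_one₀ hq1 hf.le hf1
      nlinarith [mul_pos hp he, mul_pos hq hf]
    · have hp1 : p ≤ 1 := Real.rpow_le_one hx.le h (by linarith)
      have : p * e ≤ 1 := mul_le_one₀ hp1 he.le he1
      nlinarith [mul_pos hp he, mul_pos hq hf]
  calc a * p * e * (b * q * f) = (a * b) * ((p * e) * (q * f)) := by ring
    _ ≤ (a * b) * (p * e + q * f) := mul_le_mul_of_nonneg_left key (by positivity)
    _ = _ := by ring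

lemma integrable_wishartPDF {v : ℝ} (hv : (d : ℝ) - 1 < v) {V : Matrix (Fin d) (Fin d) ℝ}
    (hV : V.PosDef) : Integrable (wishartPDF v V) (spdVolume d) := by
  have := isProbabilityMeasure_wishart hv hV
  have h1 := integral_withDensity_ofReal (g := fun _ => 1) (measurable_wishartPDF v V)
    (fun X hX => (wishartPDF_pos hv hV hX).le)
  simpa using h1.1.1 (integrable_const (μ := wishartMeasure v V) (1 : ℝ))

lemma integrable_extTransition_mul {A : Matrix (Fin d) (Fin d) ℝ} (hA : IsUnit A.det) {n : ℝ}
    (hn : 2 * (d : ℝ) + 2 < n) {pred next : GIWParam s d}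
    (hpred : pred.Valid) (hv : 2 * (d : ℝ) + 2 < next.v - pred.v)
    (hV : (next.V - pred.V).PosDef) {X : Matrix (Fin d) (Fin d) ℝ} (hX : X.PosDef) :
    Integrable (fun Y => extTransition A n X Y *
      (invWishartPDF next.v next.V Y / invWishartPDF pred.v pred.V Y)) (spdVolume d) := by
  have hd0 : (0 : ℝ) ≤ d := by positivity
  obtain ⟨K, hK, hq⟩ := invWishartPDF_div (u := next.v) hpred.lt_v (by linarith) hpred.V_posDef hV
  have hS : (n⁻¹ • (A * X * Aᵀ)).PosDef :=
    ((posDef_conj_iff hA X).2 hX).smul (inv_pos.2 (by linarith))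
  obtain ⟨a, b, h⟩ := wishartPDF_mul_invWishartPDF_le (v := n) (u := next.v - pred.v)
    (by linarith) (by linarith) hS hV
  have h1 := integrable_wishartPDF (v := n) (by linarith) hS
  have h2 := integrable_invWishartPDF (v := next.v - pred.v) (by linarith) hV
  have h3 : Integrable (fun Y => wishartPDF n (n⁻¹ • (A * X * Aᵀ)) Y *
      invWishartPDF (next.v - pred.v) (next.V - pred.V) Y) (spdVolume d) := by
    refine ((h1.const_mul a).add (h2.const_mul b)).mono'
      ((measurable_wishartPDF _ _).mul (measurable_invWishartPDF _ _)).aestronglyMeasurable ?_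
    filter_upwards [ae_posDef_spdVolume] with Y hY
    rw [Real.norm_of_nonneg (mul_nonneg (wishartPDF_pos (by linarith) hS hY).le
      (invWishartPDF_pos (by linarith) hV hY).le)]
    exact h Y hY
  refine (h3.const_mul K).congr ?_
  filter_upwards [ae_posDef_spdVolume] with Y hY
  rw [hq Y hY, extTransition]
  ring

/-- With the kinematics conditioned on the current extent, the backward integral is the product
of the kinematic integral and the extent integral. -/
lemma backwardFactor_const_eq (F D : Matrix (Fin s) (Fin s) ℝ) {A : Matrix (Fin d) (Fin d) ℝ}
    (hA : IsUnit A.det) {n : ℝ} (hn : 2 * (d : ℝ) + 2 < n) {pred next : GIWParam s d}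
    (hpred : pred.Valid) (hnext : next.Valid) (hv : 2 * (d : ℝ) + 2 < next.v - pred.v)
    (hV : (next.V - pred.V).PosDef) (x : Kin s d) {X : Matrix (Fin d) (Fin d) ℝ}
    (hX : X.PosDef) :
    backwardFactor F D A n pred next (fun _ => X) x X =
      kinFactor F D pred next x X *
        ENNReal.ofReal (extFactor pred next (extTransition A n) X) := by
  have hd0 : (0 : ℝ) ≤ d := by positivity
  have hS : (n⁻¹ • (A * X * Aᵀ)).PosDef :=
    ((posDef_conj_iff hA X).2 hX).smul (inv_pos.2 (by linarith))
  have hpos : ∀ Y : Matrix (Fin d) (Fin d) ℝ, Y.PosDef → 0 ≤ extTransition A n X Y *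
      (invWishartPDF next.v next.V Y / invWishartPDF pred.v pred.V Y) := fun Y hY =>
    mul_nonneg (wishartPDF_pos (by linarith) hS hY).le
      (div_nonneg (invWishartPDF_pos hnext.lt_v hnext.V_posDef hY).le
        (invWishartPDF_pos hpred.lt_v hpred.V_posDef hY).le)
  have hm : Measurable fun Y => ENNReal.ofReal (extTransition A n X Y *
      (invWishartPDF next.v next.V Y / invWishartPDF pred.v pred.V Y)) :=
    ((measurable_wishartPDF _ _).mul
      ((measurable_invWishartPDF _ _).div (measurable_invWishartPDF _ _))).ennreal_ofReal
  have hmN : Measurable fun y => ENNReal.ofReal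
      (normalPDF next.m (next.P ⊗ₖ X) y / normalPDF pred.m (pred.P ⊗ₖ X) y) :=
    ((measurable_normalPDF _ _).div (measurable_normalPDF _ _)).ennreal_ofReal
  -- The Bochner integral in `extFactor` defaults to zero for non-integrable functions, so
  -- integrability is essential here.
  rw [extFactor, ofReal_integral_eq_lintegral_ofReal
    (integrable_extTransition_mul hA hn hpred hv hV hX)
    (by filter_upwards [ae_posDef_spdVolume] with Y hY using hpos Y hY), mul_comm,
    ← lintegral_mul_const _ hm, backwardFactor]
  refine lintegral_congr_ae ?_
  filter_upwards [ae_posDef_spdVolume] with Y hY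
  rw [kinFactor, ← lintegral_const_mul _ hmN]
  refine lintegral_congr fun y => ?_
  rw [← ENNReal.ofReal_mul (hpos Y hY), mul_div_mul_comm]
  congr 1
  ring

end Factorisation

/-! ### Integration against conditional Gaussian inverse Wishart laws -/

section CondGIW

variable {s d : ℕ}

lemma lintegral_map_withDensity {α β : Type*} [MeasurableSpace α] [MeasurableSpace β]
    {μ : Measure α} {w : α → ℝ≥0∞} (hw : Measurable w) {T : α → β} (hT : Measurable T)
    {f : β → ℝ≥0∞} (hf : Measurable f) :
    ∫⁻ b, f b ∂((μ.withDensity w).map T) = ∫⁻ a, w a * f (T a) ∂μ := by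
  rw [lintegral_map hf hT]
  exact lintegral_withDensity_eq_lintegral_mul _ hw (hf.comp hT)

lemma measurable_normalPDF_param {ι α : Type*} [Fintype ι] [DecidableEq ι] [MeasurableSpace α]
    (m : EuclideanSpace ℝ ι) {S : α → Matrix ι ι ℝ} {x : α → EuclideanSpace ℝ ι}
    (hdet : Measurable fun a => (S a).det) (hinv : ∀ i j, Measurable fun a => (S a)⁻¹ i j)
    (hx : Measurable x) : Measurable fun a => normalPDF m (S a) (x a) := by
  have hxi : ∀ i, Measurable fun a => (x a - m).ofLp i := fun i => by
    have h : Measurable fun y : EuclideanSpace ℝ ι => (y - m).ofLp i :=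
      Continuous.measurable (by fun_prop)
    exact h.comp hx
  have hq : Measurable fun a => (x a - m).ofLp ⬝ᵥ ((S a)⁻¹ *ᵥ (x a - m).ofLp) := by
    simp only [dotProduct, mulVec]
    exact Finset.measurable_sum _ fun i _ => (hxi i).mul
      (Finset.measurable_sum _ fun j _ => (hinv i j).mul (hxi j))
  unfold normalPDF
  exact ((hdet.const_mul _).sqrt.inv).mul (hq.neg.div_const _).exp

lemma measurable_normalPDF_kronecker {α : Type*} [MeasurableSpace α] (m : Kin s d)
    (P : Matrix (Fin s) (Fin s) ℝ) {X : α → Matrix (Fin d) (Fin d) ℝ} {x : α → Kin s d}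
    (hX : Measurable X) (hx : Measurable x) :
    Measurable fun a => normalPDF m (P ⊗ₖ X a) (x a) := by
  refine measurable_normalPDF_param m ?_ (fun i j => ?_) hx
  · simp only [det_kronecker]
    exact ((measurable_det.comp hX).pow_const _).const_mul _
  · simp only [inv_kronecker, kroneckerMap_apply]
    exact ((measurable_inv_entry _ _).comp hX).const_mul _

/-- The law of an affine image of a Gaussian vector with a Kronecker covariance matrix. -/
lemma map_gaussian_kronecker {P R : Matrix (Fin s) (Fin s) ℝ} (hR : R * Rᵀ = P) (m : Kin s d)
    {X : Matrix (Fin d) (Fin d) ℝ} (hX : X.PosDef) :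
    multivariateGaussian m (P ⊗ₖ X) =
      (multivariateGaussian 0 ((1 : Matrix (Fin s) (Fin s) ℝ) ⊗ₖ X)).map
        fun z => m + toEuclideanLin (R ⊗ₖ (1 : Matrix (Fin d) (Fin d) ℝ)) z := by
  have h := map_affine_add_gaussian
    ((PosSemidef.one (n := Fin s) (R := ℝ)).kronecker hX.posSemidef)
    (PosSemidef.zero (n := Fin s × Fin d) (R := ℝ)) (R ⊗ₖ (1 : Matrix (Fin d) (Fin d) ℝ)) m 0
  rw [kron_one_conj, Matrix.mul_one, hR, map_zero, add_zero, add_zero] at h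
  rw [← h]
  have hL := measurable_toEuclideanLin (R ⊗ₖ (1 : Matrix (Fin d) (Fin d) ℝ))
  refine Measure.ext_of_lintegral _ fun f hf => ?_
  have hT : Measurable fun p : Kin s d × Kin s d =>
      m + toEuclideanLin (R ⊗ₖ (1 : Matrix (Fin d) (Fin d) ℝ)) p.1 + p.2 :=
    ((hL.comp measurable_fst).const_add m).add measurable_snd
  rw [lintegral_map_prod hT hf, lintegral_map hf (hL.const_add m)]
  refine lintegral_congr fun a => ?_
  -- Gaussian noise of covariance zero is a point mass.
  have h0 : multivariateGaussian (0 : Kin s d) (0 : Matrix (Fin s × Fin d) (Fin s × Fin d) ℝ) =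
      Measure.dirac 0 := by
    simp [multivariateGaussian]
  have hfa : Measurable fun b =>
      f (m + toEuclideanLin (R ⊗ₖ (1 : Matrix (Fin d) (Fin d) ℝ)) a + b) :=
    hf.comp (measurable_const_add _)
  rw [h0, lintegral_dirac' _ hfa]
  simp

open scoped MatrixOrder in
-- For singular `P` there is no density in `x`. Writing `x = m + (√P ⊗ 1) z` with `z ~ N(0, 1 ⊗ X)`
-- puts the dependence on `X` into a genuine density and keeps the linear map fixed.
lemma lintegral_gaussian_kronecker {P : Matrix (Fin s) (Fin s) ℝ} (hP : P.PosSemidef)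
    (m : Kin s d) {X : Matrix (Fin d) (Fin d) ℝ} (hX : X.PosDef) {f : Kin s d → ℝ≥0∞}
    (hf : Measurable f) :
    ∫⁻ x, f x ∂(multivariateGaussian m (P ⊗ₖ X)) =
      ∫⁻ z : Kin s d, ENNReal.ofReal (normalPDF 0 ((1 : Matrix (Fin s) (Fin s) ℝ) ⊗ₖ X) z) *
        f (m + toEuclideanLin (CFC.sqrt P ⊗ₖ (1 : Matrix (Fin d) (Fin d) ℝ)) z) := by
  have h1 : CFC.sqrt P * (CFC.sqrt P)ᵀ = P := by
    have h2 : (CFC.sqrt P).PosSemidef := (CFC.sqrt_nonneg P).posSemidef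
    have h3 : (CFC.sqrt P)ᵀ = CFC.sqrt P := by simpa [IsHermitian] using h2.isHermitian.eq
    rw [h3]
    exact CFC.sqrt_mul_sqrt_self _ hP.nonneg
  have hL := (measurable_toEuclideanLin (CFC.sqrt P ⊗ₖ (1 : Matrix (Fin d) (Fin d) ℝ))).const_add m
  have hfL : Measurable fun z =>
      f (m + toEuclideanLin (CFC.sqrt P ⊗ₖ (1 : Matrix (Fin d) (Fin d) ℝ)) z) :=
    hf.comp hL
  rw [map_gaussian_kronecker h1 m hX, lintegral_map hf hL,
    multivariateGaussian_eq_withDensity 0 (PosDef.one.kronecker hX),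
    lintegral_withDensity_eq_lintegral_mul _ (measurable_normalPDF _ _).ennreal_ofReal hfL]
  rfl

open scoped MatrixOrder in
-- Integration against `Measure.bind` needs a measurable kernel. On positive definite `X` the kernel
-- is the image of a density jointly measurable in `X` and `z`; the other `X` form a null set.
lemma aemeasurable_condGIW_kernel {q : GIWParam s d} (hq : q.P.PosSemidef)
    (g : Matrix (Fin d) (Fin d) ℝ → ℝ≥0∞) :
    AEMeasurable (fun X => (multivariateGaussian q.m (q.P ⊗ₖ X)).map fun x => (x, X))
      ((spdVolume d).withDensity g) := by
  have hrep : ∀ X : Matrix (Fin d) (Fin d) ℝ, X.PosDef → ∀ f : Kin s d → ℝ≥0∞, Measurable f →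
      _ := fun X hX f hf => lintegral_gaussian_kronecker hq q.m hX hf
  have hL := measurable_toEuclideanLin (CFC.sqrt q.P ⊗ₖ (1 : Matrix (Fin d) (Fin d) ℝ))
  generalize toEuclideanLin (CFC.sqrt q.P ⊗ₖ (1 : Matrix (Fin d) (Fin d) ℝ)) = L at hL hrep
  have hT : Measurable fun p : Matrix (Fin d) (Fin d) ℝ × Kin s d => (q.m + L p.2, p.1) :=
    ((hL.comp measurable_snd).const_add _).prodMk measurable_fst
  have hTX : ∀ X : Matrix (Fin d) (Fin d) ℝ, Measurable fun z : Kin s d => (q.m + L z, X) :=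
    fun X => hT.comp (measurable_prodMk_left (x := X))
  have hw : Measurable fun p : Matrix (Fin d) (Fin d) ℝ × Kin s d =>
      ENNReal.ofReal (normalPDF 0 ((1 : Matrix (Fin s) (Fin s) ℝ) ⊗ₖ p.1) p.2) :=
    (measurable_normalPDF_kronecker 0 1 measurable_fst measurable_snd).ennreal_ofReal
  refine ⟨fun X => ((volume : Measure (Kin s d)).withDensity fun z =>
    ENNReal.ofReal (normalPDF 0 ((1 : Matrix (Fin s) (Fin s) ℝ) ⊗ₖ X) z)).map fun z =>
      (q.m + L z, X), ?_, ?_⟩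
  · refine Measure.measurable_of_measurable_coe _ fun t ht => ?_
    have hi : Measurable (t.indicator (1 : Kin s d × Matrix (Fin d) (Fin d) ℝ → ℝ≥0∞)) :=
      measurable_one.indicator ht
    simp only [← lintegral_indicator_one ht]
    generalize t.indicator (1 : Kin s d × Matrix (Fin d) (Fin d) ℝ → ℝ≥0∞) = f at hi
    simp only [fun X => lintegral_map_withDensity (μ := (volume : Measure (Kin s d)))
      (measurable_normalPDF 0 ((1 : Matrix (Fin s) (Fin s) ℝ) ⊗ₖ X)).ennreal_ofReal (hTX X) hi]
    exact (hw.mul (hi.comp hT)).lintegral_prod_right'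
  · filter_upwards [ae_posDef_withDensity g] with X hX
    refine Measure.ext_of_lintegral _ fun f hf => ?_
    rw [lintegral_map hf measurable_prodMk_right, hrep X hX
      (fun x => f (x, X)) (hf.comp measurable_prodMk_right),
      lintegral_map_withDensity (measurable_normalPDF _ _).ennreal_ofReal (hTX X) hf]

lemma lintegral_condGIW_withDensity {q : GIWParam s d} (hq : q.P.PosSemidef)
    {f : Kin s d × Matrix (Fin d) (Fin d) ℝ → ℝ≥0∞} (hf : Measurable f) :
    ∫⁻ ξ, f ξ ∂(condGIW q) = ∫⁻ X, ∫⁻ x, f (x, X) ∂(multivariateGaussian q.m (q.P ⊗ₖ X))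
      ∂(invWishartMeasure q.v q.V) := by
  rw [condGIW, Measure.lintegral_bind (aemeasurable_condGIW_kernel hq _) hf.aemeasurable]
  refine lintegral_congr fun X => ?_
  rw [lintegral_map hf measurable_prodMk_right]

lemma aemeasurable_inner_condGIW {q : GIWParam s d} (hq : q.P.PosSemidef)
    {f : Kin s d × Matrix (Fin d) (Fin d) ℝ → ℝ≥0∞} (hf : Measurable f)
    (g : Matrix (Fin d) (Fin d) ℝ → ℝ≥0∞) :
    AEMeasurable (fun X => ∫⁻ x, f (x, X) ∂(multivariateGaussian q.m (q.P ⊗ₖ X)))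
      ((spdVolume d).withDensity g) := by
  have h := (Measure.measurable_lintegral hf).comp_aemeasurable (aemeasurable_condGIW_kernel hq g)
  refine h.congr (Filter.Eventually.of_forall fun X => ?_)
  simp only [Function.comp_apply]
  rw [lintegral_map hf measurable_prodMk_right]

lemma isProbabilityMeasure_condGIW {q : GIWParam s d} (hq : q.Valid) :
    IsProbabilityMeasure (condGIW q) := by
  have := isProbabilityMeasure_invWishart hq.lt_v hq.V_posDef
  refine ⟨?_⟩
  have h := lintegral_condGIW_withDensity hq.P_posSemidef (f := fun _ => 1) measurable_const
  simpa using h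

lemma ae_posDef_condGIW {q : GIWParam s d} (hq : q.P.PosSemidef) :
    ∀ᵐ ξ ∂(condGIW q), ξ.2.PosDef := by
  have ht : MeasurableSet {ξ : Kin s d × Matrix (Fin d) (Fin d) ℝ | ξ.2.PosDef}ᶜ :=
    (measurable_snd measurableSet_posDef).compl
  rw [ae_iff]
  have e : {ξ : Kin s d × Matrix (Fin d) (Fin d) ℝ | ¬ ξ.2.PosDef} =
    {ξ : Kin s d × Matrix (Fin d) (Fin d) ℝ | ξ.2.PosDef}ᶜ := rfl
  rw [e, ← lintegral_indicator_one ht,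
    lintegral_condGIW_withDensity hq (measurable_one.indicator ht)]
  refine lintegral_eq_zero_of_ae_eq_zero ?_
  filter_upwards [ae_posDef_withDensity _] with X hX
  simp [hX]

end CondGIW

/-! ### The smoothing step on the joint law -/

section Smoothing

variable {s d : ℕ}

open scoped MatrixOrder in
-- The transition measure may be singular and varies with `X`. Over the positive definite cone it is
-- rewritten with Lebesgue measure and a jointly measurable integrand, which makes the kinematic
-- integral measurable in the state.
lemma exists_measurable_kinFactor (F : Matrix (Fin s) (Fin s) ℝ) {D : Matrix (Fin s) (Fin s) ℝ}
    (hD : D.PosSemidef) (pred next : GIWParam s d) :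
    ∃ g : Kin s d × Matrix (Fin d) (Fin d) ℝ → ℝ≥0∞, Measurable g ∧
      ∀ x X, X.PosDef → kinFactor F D pred next x X = g (x, X) := by
  have hrep : ∀ (m : Kin s d) (X : Matrix (Fin d) (Fin d) ℝ), X.PosDef → ∀ f : Kin s d → ℝ≥0∞,
    Measurable f → _ := fun m X hX f hf => lintegral_gaussian_kronecker hD m hX hf
  have hL := measurable_toEuclideanLin (CFC.sqrt D ⊗ₖ (1 : Matrix (Fin d) (Fin d) ℝ))
  generalize toEuclideanLin (CFC.sqrt D ⊗ₖ (1 : Matrix (Fin d) (Fin d) ℝ)) = L at hL hrep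
  have hF := measurable_toEuclideanLin (F ⊗ₖ (1 : Matrix (Fin d) (Fin d) ℝ))
  refine ⟨fun ξ => ∫⁻ z : Kin s d,
    ENNReal.ofReal (normalPDF 0 ((1 : Matrix (Fin s) (Fin s) ℝ) ⊗ₖ ξ.2) z) * ENNReal.ofReal
      (normalPDF next.m (next.P ⊗ₖ ξ.2)
          (toEuclideanLin (F ⊗ₖ (1 : Matrix (Fin d) (Fin d) ℝ)) ξ.1 + L z) /
        normalPDF pred.m (pred.P ⊗ₖ ξ.2)
          (toEuclideanLin (F ⊗ₖ (1 : Matrix (Fin d) (Fin d) ℝ)) ξ.1 + L z)), ?_, ?_⟩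
  · have hX : Measurable fun p : (Kin s d × Matrix (Fin d) (Fin d) ℝ) × Kin s d => p.1.2 :=
      measurable_snd.comp measurable_fst
    have hx : Measurable fun p : (Kin s d × Matrix (Fin d) (Fin d) ℝ) × Kin s d =>
        toEuclideanLin (F ⊗ₖ (1 : Matrix (Fin d) (Fin d) ℝ)) p.1.1 + L p.2 :=
      (hF.comp (measurable_fst.comp measurable_fst)).add (hL.comp measurable_snd)
    exact ((measurable_normalPDF_kronecker 0 1 hX measurable_snd).ennreal_ofReal.mul
      ((measurable_normalPDF_kronecker _ _ hX hx).div
        (measurable_normalPDF_kronecker _ _ hX hx)).ennreal_ofReal).lintegral_prod_right'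
  · intro x X hX
    exact hrep _ X hX (fun y => ENNReal.ofReal
      (normalPDF next.m (next.P ⊗ₖ X) y / normalPDF pred.m (pred.P ⊗ₖ X) y))
      ((measurable_normalPDF _ _).div (measurable_normalPDF _ _)).ennreal_ofReal

/-- Multiplying a conditional Gaussian inverse Wishart law by the kinematic integral and an inverse
Wishart density. -/
lemma condGIW_withDensity_kinFactor {F D G : Matrix (Fin s) (Fin s) ℝ} (hD : D.PosSemidef)
    {filt pred next smooth : GIWParam s d} (hfilt : filt.Valid) (hpred : pred.P.PosDef)
    (hnext : next.P.PosDef)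
    (hm : pred.m = toEuclideanLin (F ⊗ₖ (1 : Matrix (Fin d) (Fin d) ℝ)) filt.m)
    (hP : pred.P = F * filt.P * Fᵀ + D) (hG : G = filt.P * Fᵀ * pred.P⁻¹)
    {c w : ℝ} {W : Matrix (Fin d) (Fin d) ℝ} (hc : 0 < c) (hw : 2 * (d : ℝ) < w) (hW : W.PosDef)
    (hsm : smooth.m = filt.m +
      toEuclideanLin (G ⊗ₖ (1 : Matrix (Fin d) (Fin d) ℝ)) (next.m - pred.m))
    (hsP : smooth.P = filt.P - G * (pred.P - next.P) * Gᵀ) (hsPpos : smooth.P.PosSemidef)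
    (hsv : smooth.v = filt.v + w) (hsV : smooth.V = filt.V + W) :
    ∃ K : ℝ, 0 < K ∧ (condGIW filt).withDensity (fun ξ =>
      kinFactor F D pred next ξ.1 ξ.2 * ENNReal.ofReal (c * invWishartPDF w W ξ.2)) =
        ENNReal.ofReal K • condGIW smooth := by
  obtain ⟨K, hK, hprod⟩ := invWishartPDF_mul hfilt.lt_v hw hfilt.V_posDef hW
  obtain ⟨g, hg, hkin⟩ := exists_measurable_kinFactor F hD pred next
  -- `K` arises from merging the two inverse Wishart densities; the kinematic part contributes no
  -- constant.
  refine ⟨c * K, by positivity, ?_⟩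
  have hiw : Measurable fun X : Matrix (Fin d) (Fin d) ℝ =>
      ENNReal.ofReal (c * invWishartPDF w W X) :=
    ((measurable_invWishartPDF w W).const_mul c).ennreal_ofReal
  have hgw : Measurable fun ξ : Kin s d × Matrix (Fin d) (Fin d) ℝ =>
      g ξ * ENNReal.ofReal (c * invWishartPDF w W ξ.2) := hg.mul (hiw.comp measurable_snd)
  have hae : (fun ξ : Kin s d × Matrix (Fin d) (Fin d) ℝ => kinFactor F D pred next ξ.1 ξ.2 *
      ENNReal.ofReal (c * invWishartPDF w W ξ.2)) =ᵐ[condGIW filt]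
      fun ξ => g ξ * ENNReal.ofReal (c * invWishartPDF w W ξ.2) := by
    filter_upwards [ae_posDef_condGIW hfilt.P_posSemidef] with ξ hξ
    rw [hkin _ _ hξ]
  rw [withDensity_congr_ae hae]
  refine Measure.ext_of_lintegral _ fun f hf => ?_
  rw [lintegral_withDensity_eq_lintegral_mul _ hgw hf,
    lintegral_condGIW_withDensity hfilt.P_posSemidef (hgw.mul hf), lintegral_smul_measure,
    lintegral_condGIW_withDensity hsPpos hf, invWishartMeasure, invWishartMeasure, smul_eq_mul]
  have hiw1 := (measurable_invWishartPDF filt.v filt.V).ennreal_ofReal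
  have hiw2 := (measurable_invWishartPDF smooth.v smooth.V).ennreal_ofReal
  -- Weight `1` specialises the measurability statement to `spdVolume` itself.
  rw [lintegral_withDensity_eq_lintegral_mul₀ hiw1.aemeasurable
      (by simpa using aemeasurable_inner_condGIW hfilt.P_posSemidef (hgw.mul hf) 1),
    lintegral_withDensity_eq_lintegral_mul₀ hiw2.aemeasurable
      (by simpa using aemeasurable_inner_condGIW hsPpos hf 1),
    ← lintegral_const_mul'' _ (hiw2.aemeasurable.mul
      (by simpa using aemeasurable_inner_condGIW hsPpos hf 1))]
  refine lintegral_congr_ae ?_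
  filter_upwards [ae_posDef_spdVolume] with X hX
  have hkX : (fun x => kinFactor F D pred next x X) = fun x => g (x, X) := by
    funext x; exact hkin x X hX
  have hgX : Measurable fun x => g (x, X) := hg.comp measurable_prodMk_right
  have hfX : Measurable fun x => f (x, X) := hf.comp measurable_prodMk_right
  have h1 := kinematic_smoothing hD hfilt.P_posSemidef hpred hnext hm hP hG hX
  -- Given `X`, the kinematic reweighting produces a probability law, so no further factor depending
  -- on `X` appears.
  have h2 : ∫⁻ x, ((fun ξ => g ξ * ENNReal.ofReal (c * invWishartPDF w W ξ.2)) * f) (x, X)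
      ∂(multivariateGaussian filt.m (filt.P ⊗ₖ X)) = ENNReal.ofReal (c * invWishartPDF w W X) *
        ∫⁻ x, f (x, X) ∂(multivariateGaussian smooth.m (smooth.P ⊗ₖ X)) := by
    rw [hsm, hsP, ← h1, hkX, lintegral_withDensity_eq_lintegral_mul _ hgX hfX,
      ← lintegral_const_mul _ (hgX.mul hfX)]
    refine lintegral_congr fun x => ?_
    simp only [Pi.mul_apply]
    ring
  have h3 := (invWishartPDF_pos hfilt.lt_v hfilt.V_posDef hX).le
  simp only [Pi.mul_apply] at h2 ⊢
  rw [h2, ← mul_assoc, ← mul_assoc, ← ENNReal.ofReal_mul h3, ← ENNReal.ofReal_mul (by positivity),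
    mul_left_comm, hprod X hX, hsv, hsV, mul_assoc]

end Smoothing

end RandomMatrix

end

/-! ### Assembly of the smoothed law -/

open RandomMatrix
theorem theorem1 {s d : ℕ} (hd : 0 < d)
    -- motion model: kinematic matrices, extent matrix, degrees of freedom
    (F D : Matrix (Fin s) (Fin s) ℝ) (hD : D.PosSemidef)
    (A : Matrix (Fin d) (Fin d) ℝ) (hA : IsUnit A.det)
    (n : ℝ) (hn : 2 * (d : ℝ) + 2 < n)
    -- filtered, predicted and next smoothed conditional Gaussian inverse Wishart laws
    (filt pred next : GIWParam s d)
    (hfilt : filt.Valid) (hpred : pred.Valid) (hnext : next.Valid)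
    (hpredP : pred.P.PosDef) (hnextP : next.P.PosDef)
    -- the predicted kinematic density is the Chapman-Kolmogorov prediction given the extent
    (hCK : ∀ X : Matrix (Fin d) (Fin d) ℝ, X.PosDef →
      multivariateGaussian pred.m (pred.P ⊗ₖ X) =
        (multivariateGaussian filt.m (filt.P ⊗ₖ X)).bind (fun x => kinTransition F D x X))
    -- the quotient of the extent densities has the moments that are to be matched
    (hv : 2 * (d : ℝ) + 2 < next.v - pred.v) (hV : (next.V - pred.V).PosDef)
    -- the smoothed parameters
    (smooth : GIWParam s d) (G : Matrix (Fin s) (Fin s) ℝ) (η : ℝ)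
    (hG : G = filt.P * Fᵀ * pred.P⁻¹)
    (hη : η = 1 + (next.v - pred.v - 3 * ((d : ℝ) + 1)) / n)
    (hsm : smooth.m = filt.m +
      Matrix.toEuclideanLin (G ⊗ₖ (1 : Matrix (Fin d) (Fin d) ℝ)) (next.m - pred.m))
    (hsP : smooth.P = filt.P - G * (pred.P - next.P) * Gᵀ)
    (hsv : smooth.v = filt.v + η⁻¹ * (next.v - pred.v - 2 * ((d : ℝ) + 1) ^ 2 / n))
    (hsV : smooth.V = filt.V + η⁻¹ • (A⁻¹ * (next.V - pred.V) * (A⁻¹)ᵀ)) :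
    smooth.Valid ∧ IsProbabilityMeasure (condGIW smooth) ∧
    -- with the next extent replaced by the current one, the backward integral factorises
    (∀ (x : Kin s d) (X : Matrix (Fin d) (Fin d) ℝ), X.PosDef →
      backwardFactor F D A n pred next (fun _ => X) x X =
        kinFactor F D pred next x X *
          ENNReal.ofReal (extFactor pred next (extTransition A n) X)) ∧
    -- the smoothing step is well defined, and its result is the law with these parameters
    (∀ μ : Measure (Kin s d × Matrix (Fin d) (Fin d) ℝ),
      IsSmoothed F D A n filt pred next μ ↔ μ = condGIW smooth) := by

  have hd0 : (0 : ℝ) ≤ d := by positivity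
  obtain ⟨hpm, hpP⟩ := predicted_kinematics hd hfilt.P_posSemidef hpredP.posSemidef hD hCK
  obtain ⟨C, hC, hwish⟩ := isWishartApprox_extTransition_iff hd hA hn
  obtain ⟨hη0, hw0, K, hK, hinv⟩ := isInvWishartApprox_extFactor_iff hd hA hn hpred hv hV hη hC
  have hW0 : (η⁻¹ • (A⁻¹ * (next.V - pred.V) * (A⁻¹)ᵀ)).PosDef :=
    (posDef_conj_inv hA hV).smul (inv_pos.2 hη0)
  have hPpos : smooth.P.PosSemidef := by
    -- Residual covariance plus propagated covariance, both positive semidefinite.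
    have e : smooth.P = (filt.P - G * pred.P * Gᵀ) + G * next.P * Gᵀ := by
      rw [hsP, Matrix.mul_sub, Matrix.sub_mul]; abel
    rw [e]
    refine (residual_covariance hfilt.P_posSemidef hD hpredP hpP hG).2.add ?_
    simpa using hnextP.posSemidef.mul_mul_conjTranspose_same G
  have hvalid : smooth.Valid := by
    refine ⟨hPpos, ?_, ?_⟩
    · have := hfilt.lt_v
      rw [hsv]; linarith
    · rw [hsV]
      exact hfilt.V_posDef.add hW0
  have hprob := isProbabilityMeasure_condGIW hvalid
  obtain ⟨L, hL, hν⟩ := condGIW_withDensity_kinFactor hD hfilt hpredP hnextP hpm hpP hG hK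
    (by linarith) hW0 hsm hsP hPpos hsv hsV
  have hL0 : ENNReal.ofReal L ≠ 0 := by simpa using hL
  have hmass : (ENNReal.ofReal L • condGIW smooth) Set.univ = ENNReal.ofReal L := by simp
  have hnorm : (ENNReal.ofReal L)⁻¹ • ENNReal.ofReal L • condGIW smooth = condGIW smooth := by
    rw [smul_smul, ENNReal.inv_mul_cancel hL0 ENNReal.ofReal_ne_top, one_smul]
  refine ⟨hvalid, hprob, fun x X hX =>
    backwardFactor_const_eq F D hA hn hpred hnext hv hV x hX, fun μ => ⟨?_, ?_⟩⟩
  -- Matching fixes `c`, `w` and `W` at positive definite `Y`, which determines the extent integral,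
  -- hence also `c'`, `w'` and `W'`; values at other `Y` are irrelevant.
  · rintro ⟨c, w, W, c', w', W', h1, h2, ν, rfl, -, -, rfl⟩
    obtain ⟨rfl, rfl, rfl⟩ :=
      (hinv c w W (fun Y hY => (hwish Y hY _ _ _).1 (h1 Y hY)) c' w' W').1 h2
    rw [hν, hmass, hnorm]
  · rintro rfl
    -- Existence: the matched parameters, given by the same formulas for every `Y`.
    refine ⟨fun _ => C, fun _ => n - d - 1,
      fun Y => (n / ((n - d - 1) * (n - 2 * d - 2))) • (A⁻¹ * Y * (A⁻¹)ᵀ), K, _, _,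
      fun Y hY => (hwish Y hY _ _ _).2 ⟨rfl, rfl, rfl⟩,
      (hinv _ _ _ (fun Y hY => ⟨rfl, rfl, rfl⟩) _ _ _).2 ⟨rfl, rfl, rfl⟩, _, hν.symm, ?_, ?_, ?_⟩
    · rw [hmass]; exact hL0
    · rw [hmass]; exact ENNReal.ofReal_ne_top
    · rw [hmass, hnorm]
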